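/- **Model.** There are finitely many treatments $1,\dots,K$. Responses take values in a Polish space; under treatment $x$ a response has density $f_x$ before the change and $g_x$ after it, with respect to a $\sigma$-finite measure $\mu$. For every $x$ assume $$\int \Big(\log\tfrac{g_x}{f_x}\Big)^2 g_x\,d\mu<\infty,\quad I_x=\int \log\tfrac{g_x}{f_x}\,g_x\,d\mu>0,\quad \int \Big(\log\tfrac{f_x}{g_x}\Big)^2 f_x\,d\mu<\infty,\quad J_x=\int \log\tfrac{f_x}{g_x}\,f_x\,d\mu>0 .$$ For every tolerance level $\alpha\in(0,1)$ let $\pi_0(\alpha)\in[0,1]$ and $\pi_t(\cdot\,;\alpha):\{1,\dots,K\}^t\to[0,1]$, $t\ge1$, be given. Let $U_0,U_1,\dots,V_0,V_1,\dots$ be independent and uniform on $(0,1)$, and let $h$ be measurable such that $h(x,0,V_t)$ has density $f_x$ and $h(x,1,V_t)$ has density $g_x$. For treatments $\mathcal X=(X_t)_{t\ge1}$ put $\Pi_0=\pi_0(\alpha)$, $\Pi_t=\pi_t(X_1,\dots,X_t;\alpha)$; let $L_0=1$ if $U_0\le\Pi_0$ and $L_0=0$ otherwise; for $t\ge1$ let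 $L_t=1$ if $L_{t-1}=1$ or $U_t\le\Pi_t$, and $L_t=0$ otherwise. Let $Y_t=h(X_t,L_t,V_t)$, $\mathcal F_t=\sigma(Y_1,\dots,Y_t)$, $\Theta_{\mathcal X}=\inf\{t\ge0:L_t=1\}$ and $\Gamma_t=\mathsf P(L_t=1\mid\mathcal F_t)/\mathsf P(L_t=0\mid\mathcal F_t)$. The class $\mathcal C_\alpha$ consists of all pairs $(T,\mathcal X)$ such that $X_t$ is $\mathcal F_{t-1}$-measurable for $t\ge1$, $T$ is an $(\mathcal F_t)$-stopping time, $\mathsf P(T<\Theta_{\mathcal X})\le\alpha$ and $\mathsf P(T<\infty,\Theta_{\mathcal X}<\infty)=1$. **Notation.** $\lambda_x(\alpha)$ is the expected change-point when only treatment $x$ is assigned. $\pi^*_t(\alpha)=\max_z\pi_t(z;\alpha)$ (with $\pi_0^*=\pi_0$), and $\lambda_*(\alpha)$ is the expected value of the first $t\ge0$ with $U_t\le\pi^*_t(\alpha)$. $\zeta_1(\alpha)$ is the infimum of $\pi_{t+1}(z,1;\alpha)$ over $t\ge0$ and $z\in\{1,\dots,K\}^t$. For functions $p_x(\alpha)$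 put $D_x(\alpha)=I_x+|\log(1-p_x(\alpha))|$. **Assumptions on the change-point model.** (a) For every $x$, $\sup_{\alpha}\sup_{z}|\pi_t(z,x;\alpha)-p_x(\alpha)|\to0$ as $t\to\infty$. (b) $|\log\zeta_1(\alpha)|=o(|\log\alpha|)$ as $\alpha\to0$. (c) There is $\delta\in(0,1)$ with $\pi^*_t(\alpha)\le1-\delta$ for all $t\ge0$, $\alpha\in(0,1)$. (d) $\lambda_1(\alpha)=\min_x\lambda_x(\alpha)$ and $D_K(\alpha)=\max_xD_x(\alpha)$ for all $\alpha\in(0,1)$. (e) As $\alpha\to0$, either $\lambda_1(\alpha)\sim\lambda_*(\alpha)$ or $\lambda_1(\alpha)=o(|\log\alpha|)$. **Procedure.** Put $$b_K=\frac{1-\alpha}{\alpha},\qquad b_1=\frac{1/\zeta_1(\alpha)+\log(b_K)/D_K(\alpha)}{1/D_1(\alpha)-1/D_K(\alpha)},\qquad d=b_1\,\frac{1/\zeta_1(\alpha)+\log(b_K)/D_K(\alpha)}{1/I_K+1/J_K},$$ and assume that $D_1(\alpha)<D_K(\alpha)$ and $b_1<b_K$ for all sufficiently small $\alpha$. Put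 $\sigma(t;b)=\inf\{s\ge1:\Gamma_{t+s}\ge b\}$, $\tau(t;d)=\inf\{s\ge1:\prod_{j=1}^s f_K(Y_{t+j})/g_K(Y_{t+j})\ge d\}$, $S_0=0$, $S_n=S_{n-1}+\sigma(S_{n-1};b_1)$ for odd $n$ and $S_n=S_{n-1}+\min\{\sigma(S_{n-1};b_K),\tau(S_{n-1};d)\}$ for even $n$. The rule $\widetilde{\mathcal X}$ assigns treatment $1$ at the times $t\in(S_{2m-2},S_{2m-1}]$ and treatment $K$ at the times $t\in(S_{2m-1},S_{2m}]$, $m\ge1$, where $\Gamma$ and $Y$ are those of $\widetilde{\mathcal X}$ itself, and $\widetilde T=S_{2N}$ with $N=\inf\{m\ge1:\sigma(S_{2m-1};b_K)\le\tau(S_{2m-1};d)\}$. **Conclusion.** $(\widetilde T,\widetilde{\mathcal X})\in\mathcal C_\alpha$ for all sufficiently small $\alpha$, and as $\alpha\to0$ $$\mathsf E[\widetilde T]\;\sim\;\lambda_1(\alpha)+\frac{|\log\alpha|}{D_K(\alpha)}\;\sim\;\inf_{(T,\mathcal X)\in\mathcal C_\alpha}\mathsf E[T].$$ -/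

import Mathlib

open Set Filter Topology MeasureTheory ProbabilityTheory
open scoped ENNReal

noncomputable section

namespace ChangeAccel

/-! ## The model

There are `k + 1` treatments, indexed by `Fin (k + 1)`.  The treatment called `1` in the text is the
index `0`; the treatment called `K` is the index `Fin.last k`. -/

/-- Response densities with respect to a sigma-finite measure on a Polish space: `f x` before and
`g x` after the change, under treatment `x`. -/
structure ResponseModel (k : ℕ) (𝕐 : Type*) [MeasurableSpace 𝕐] where
  μ : Measure 𝕐
  sigmaFinite : SigmaFinite μ
  f : Fin (k + 1) → 𝕐 → ℝ
  g : Fin (k + 1) → 𝕐 → ℝ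
  f_meas : ∀ x, Measurable (f x)
  g_meas : ∀ x, Measurable (g x)
  f_nonneg : ∀ x y, 0 ≤ f x y
  g_nonneg : ∀ x y, 0 ≤ g x y
  f_total : ∀ x, ∫⁻ y, ENNReal.ofReal (f x y) ∂μ = 1
  g_total : ∀ x, ∫⁻ y, ENNReal.ofReal (g x y) ∂μ = 1

namespace ResponseModel

variable {k : ℕ} {𝕐 : Type*} [MeasurableSpace 𝕐]

/-- The density of a response to treatment `x` in state `i`. -/
def dens (R : ResponseModel k 𝕐) (x : Fin (k + 1)) (i : Fin 2) : 𝕐 → ℝ :=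
  if i = 0 then R.f x else R.g x

/-- The Kullback-Leibler information number of `g x` relative to `f x`. -/
def I (R : ResponseModel k 𝕐) (x : Fin (k + 1)) : ℝ :=
  ∫ y, Real.log (R.g x y / R.f x y) * R.g x y ∂(R.μ)

/-- The Kullback-Leibler information number of `f x` relative to `g x`. -/
def J (R : ResponseModel k 𝕐) (x : Fin (k + 1)) : ℝ :=
  ∫ y, Real.log (R.f x y / R.g x y) * R.f x y ∂(R.μ)

/-- Square-integrable log-likelihood ratios and positive information numbers.  Where exactly one of
`f x`, `g x` vanishes the logarithm in the mathematical text is infinite, so finiteness of its two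
second moments contains the first clause; the real logarithm of Mathlib takes the value `0` there,
so the clause is written out. -/
def Regular (R : ResponseModel k 𝕐) : Prop :=
  ∀ x, (∀ᵐ y ∂(R.μ), R.f x y = 0 ↔ R.g x y = 0) ∧
    Integrable (fun y => Real.log (R.g x y / R.f x y) ^ 2 * R.g x y) R.μ ∧ 0 < R.I x ∧
    Integrable (fun y => Real.log (R.f x y / R.g x y) ^ 2 * R.f x y) R.μ ∧ 0 < R.J x

end ResponseModel

/-- The uniform distribution on the interval (0, 1). -/
def unif : Measure ℝ := volume.restrict (Ioo 0 1)

/-- The randomness that drives the system: two independent sequences of independent uniform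
variables, and a measurable function `h` that turns a uniform variable into a response with
density `f x` (state `0`) or `g x` (state `1`). -/
structure Noise {k : ℕ} {𝕐 : Type*} [MeasurableSpace 𝕐] (R : ResponseModel k 𝕐)
    {Ω : Type*} [MeasurableSpace Ω] (P : Measure Ω) where
  U : ℕ → Ω → ℝ
  V : ℕ → Ω → ℝ
  h : Fin (k + 1) → Fin 2 → ℝ → 𝕐
  U_meas : ∀ t, Measurable (U t)
  V_meas : ∀ t, Measurable (V t)
  U_law : ∀ t, P.map (U t) = unif
  V_law : ∀ t, P.map (V t) = unif
  indep : iIndepFun (Sum.elim U V : ℕ ⊕ ℕ → Ω → ℝ) P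
  h_meas : ∀ x i, Measurable (h x i)
  h_law : ∀ x i, unif.map (h x i) = R.μ.withDensity (fun y => ENNReal.ofReal (R.dens x i y))

/-- A prior probability `π 0 ![]` together with transition functions `π t` of the first `t`
treatments: the change-point model at one fixed tolerance level. -/
abbrev Transition (k : ℕ) : Type := (t : ℕ) → (Fin t → Fin (k + 1)) → ℝ

/-- The latent state driven by the conditional change probabilities `q t`. -/
def latent {Ω : Type*} (U q : ℕ → Ω → ℝ) : ℕ → Ω → Fin 2
  | 0, ω => if U 0 ω ≤ q 0 ω then 1 else 0
  | t + 1, ω => if latent U q t ω = 1 then 1 else if U (t + 1) ω ≤ q (t + 1) ω then 1 else 0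

/-- The first time at which a path is in state `1` (infinite if there is none). -/
def firstOne {Ω : Type*} (L : ℕ → Ω → Fin 2) (ω : Ω) : ℕ∞ :=
  sInf {s : ℕ∞ | ∃ t : ℕ, s = t ∧ L t ω = 1}

/-- The largest transition probability at time `t`. -/
def piStar {k : ℕ} (π : Transition k) (t : ℕ) : ℝ := ⨆ z : Fin t → Fin (k + 1), π t z

/-- The smallest transition probability whenever treatment `x` is assigned. -/
def zeta {k : ℕ} (π : Transition k) (x : Fin (k + 1)) : ℝ :=
  ⨅ t : ℕ, ⨅ z : Fin t → Fin (k + 1), π (t + 1) (Fin.snoc z x)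

section System

variable {k : ℕ} {𝕐 : Type*} [MeasurableSpace 𝕐] {R : ResponseModel k 𝕐}
  {Ω : Type*} [MeasurableSpace Ω] {P : Measure Ω}

/-- The conditional probability of a change at time `t` under the treatments `X 1, ..., X t`.
(The value `X 0` is never used.) -/
def transProb (π : Transition k) (X : ℕ → Ω → Fin (k + 1)) (t : ℕ) (ω : Ω) : ℝ :=
  π t (fun i => X (i + 1) ω)

/-- The latent state under the treatments `X`. -/
def state (W : Noise R P) (π : Transition k) (X : ℕ → Ω → Fin (k + 1)) : ℕ → Ω → Fin 2 :=
  latent W.U (transProb π X)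

/-- The change-point under the treatments `X`. -/
def changePoint (W : Noise R P) (π : Transition k) (X : ℕ → Ω → Fin (k + 1)) : Ω → ℕ∞ :=
  firstOne (state W π X)

/-- The response at time `t`, for `t ≥ 1`, under the treatments `X`. -/
def response (W : Noise R P) (π : Transition k) (X : ℕ → Ω → Fin (k + 1)) (t : ℕ) (ω : Ω) : 𝕐 :=
  W.h (X t ω) (state W π X t ω) (W.V t ω)

/-- The sigma-algebra generated by the responses at the times `1, ..., t`. -/
@[reducible]
def obs (W : Noise R P) (π : Transition k) (X : ℕ → Ω → Fin (k + 1)) (t : ℕ) :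
    MeasurableSpace Ω :=
  ⨆ s ∈ Finset.Icc 1 t, MeasurableSpace.comap (response W π X s) inferInstance

/-- The posterior odds that the change has occurred by time `t`. -/
def odds (W : Noise R P) (π : Transition k) (X : ℕ → Ω → Fin (k + 1)) (t : ℕ) (ω : Ω) : ℝ :=
  (P⟦{ω' | state W π X t ω' = 1} | obs W π X t⟧) ω /
    (P⟦{ω' | state W π X t ω' = 0} | obs W π X t⟧) ω

/-- Admissible procedures: a stopping time of the observed responses, and treatments each of which
is determined by the earlier responses. -/
def Admissible (W : Noise R P) (π : Transition k) (T : Ω → ℕ∞) (X : ℕ → Ω → Fin (k + 1)) : Prop :=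
  (∀ t : ℕ, MeasurableSet[obs W π X t] {ω | T ω = t}) ∧
    ∀ t : ℕ, Measurable[obs W π X t] (X (t + 1))

/-- Admissible procedures with false alarm probability at most `α`. -/
def procedures (W : Noise R P) (π : Transition k) (α : ℝ) :
    Set ((Ω → ℕ∞) × (ℕ → Ω → Fin (k + 1))) :=
  {p | Admissible W π p.1 p.2 ∧ P {ω | p.1 ω < changePoint W π p.2 ω} ≤ ENNReal.ofReal α ∧
    P {ω | p.1 ω < ⊤ ∧ changePoint W π p.2 ω < ⊤} = 1}

/-- The expected value of a random time. -/
def expTime (P : Measure Ω) (T : Ω → ℕ∞) : ℝ≥0∞ := ∫⁻ ω, (T ω : ℝ≥0∞) ∂P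

/-- The smallest possible expected sample size. -/
def optimalTime (W : Noise R P) (π : Transition k) (α : ℝ) : ℝ≥0∞ :=
  ⨅ p ∈ procedures W π α, expTime P p.1

/-- The expected change-point when only treatment `x` is assigned. -/
def lam (W : Noise R P) (π : Transition k) (x : Fin (k + 1)) : ℝ≥0∞ :=
  expTime P (changePoint W π (fun _ _ => x))

/-- The expected change-point under the maximal transition probabilities. -/
def lamStar (W : Noise R P) (π : Transition k) : ℝ≥0∞ :=
  expTime P (firstOne (latent W.U (fun t _ => piStar π t)))

end System

/-! ## The proposed procedure -/

/-- The number of steps after time `t` until `Γ` reaches the threshold `b`. -/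
def detect (Γ : ℕ → ℝ) (b : ℝ) (t : ℕ) : ℕ∞ :=
  sInf {s : ℕ∞ | ∃ j : ℕ, s = j ∧ 1 ≤ j ∧ b ≤ Γ (t + j)}

/-- The number of steps after time `t` until the product of the ratios `r` reaches `d`. -/
def sprt (r : ℕ → ℝ) (d : ℝ) (t : ℕ) : ℕ∞ :=
  sInf {s : ℕ∞ | ∃ j : ℕ, s = j ∧ 1 ≤ j ∧ d ≤ ∏ i ∈ Finset.Icc 1 j, r (t + i)}

/-- The ends of the stages along a path `Γ` of posterior odds and a path `r` of likelihood ratios.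
Stage `n + 1` is a training stage if `n` is even and an assessment stage if `n` is odd. -/
def stageEnd (Γ r : ℕ → ℝ) (b₁ bK d : ℝ) : ℕ → ℕ∞
  | 0 => 0
  | n + 1 => stageEnd Γ r b₁ bK d n +
      if Even n then detect Γ b₁ (stageEnd Γ r b₁ bK d n).toNat
      else min (detect Γ bK (stageEnd Γ r b₁ bK d n).toNat)
        (sprt r d (stageEnd Γ r b₁ bK d n).toNat)

/-- The number of cycles until stopping. -/
def cycles (Γ r : ℕ → ℝ) (b₁ bK d : ℝ) : ℕ∞ :=
  sInf {s : ℕ∞ | ∃ m : ℕ, s = m ∧ 1 ≤ m ∧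
    detect Γ bK (stageEnd Γ r b₁ bK d (2 * m - 1)).toNat ≤
      sprt r d (stageEnd Γ r b₁ bK d (2 * m - 1)).toNat}

/-- The end of the last cycle (infinite if there are infinitely many cycles). -/
def stopTime (Γ r : ℕ → ℝ) (b₁ bK d : ℝ) : ℕ∞ :=
  if cycles Γ r b₁ bK d = ⊤ then ⊤ else stageEnd Γ r b₁ bK d (2 * (cycles Γ r b₁ bK d).toNat)

open Classical in
/-- The treatment at time `t`: the first one in training stages, the last one otherwise. -/
def stageTreatment (k : ℕ) (Γ r : ℕ → ℝ) (b₁ bK d : ℝ) (t : ℕ) : Fin (k + 1) :=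
  if ∃ m : ℕ, 1 ≤ m ∧ stageEnd Γ r b₁ bK d (2 * m - 2) < t ∧ t ≤ stageEnd Γ r b₁ bK d (2 * m - 1)
  then 0 else Fin.last k

section Proposed

variable {k : ℕ} {𝕐 : Type*} [MeasurableSpace 𝕐] {R : ResponseModel k 𝕐}
  {Ω : Type*} [MeasurableSpace Ω] {P : Measure Ω}

/-- The likelihood ratio of state `0` against state `1` under the last treatment, at the response
at time `t`. -/
def ratioK (W : Noise R P) (π : Transition k) (X : ℕ → Ω → Fin (k + 1)) (t : ℕ) (ω : Ω) : ℝ :=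
  R.f (Fin.last k) (response W π X t ω) / R.g (Fin.last k) (response W π X t ω)

/-- The treatments prescribed by the stages that are computed from the posterior odds and the
responses under the treatments `X`. -/
def prescribed (W : Noise R P) (π : Transition k) (b₁ bK d : ℝ) (X : ℕ → Ω → Fin (k + 1)) :
    ℕ → Ω → Fin (k + 1) :=
  fun t ω => stageTreatment k (fun s => odds W π X s ω) (fun s => ratioK W π X s ω) b₁ bK d t

/-- The proposed treatments.  They are the solution `X` of the equation
`prescribed W π b₁ bK d X = X` (see `prescribed_proposedRule` below).  The treatment prescribed at
time `t` depends only on the treatments at the times `1, ..., t - 1`, so that `t` iterations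
determine it. -/
def proposedRule (W : Noise R P) (π : Transition k) (b₁ bK d : ℝ) : ℕ → Ω → Fin (k + 1) :=
  fun t => ((prescribed W π b₁ bK d)^[t] fun _ _ => Fin.last k) t

/-- The proposed stopping time. -/
def proposedTime (W : Noise R P) (π : Transition k) (b₁ bK d : ℝ) (ω : Ω) : ℕ∞ :=
  stopTime (fun s => odds W π (proposedRule W π b₁ bK d) s ω)
    (fun s => ratioK W π (proposedRule W π b₁ bK d) s ω) b₁ bK d

end Proposed

/-! ### The proposed treatments solve their defining equation -/

section FixedPoint

lemma sInf_le_nat_iff (p : ℕ → Prop) (i : ℕ) :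
    sInf {s : ℕ∞ | ∃ j : ℕ, s = j ∧ p j} ≤ i ↔ ∃ j ≤ i, p j := by
  constructor
  · intro h
    by_contra hc
    push Not at hc
    have h1 : ((i + 1 : ℕ) : ℕ∞) ≤ sInf {s : ℕ∞ | ∃ j : ℕ, s = j ∧ p j} := by
      refine le_sInf ?_
      rintro _ ⟨j, rfl, hj⟩
      have : i < j := by
        by_contra hij
        exact hc j (by omega) hj
      exact_mod_cast this
    have h2 := h1.trans h
    have : i + 1 ≤ i := by exact_mod_cast h2
    omega
  · rintro ⟨j, hj, hp⟩
    have h1 : sInf {s : ℕ∞ | ∃ j : ℕ, s = j ∧ p j} ≤ (j : ℕ∞) := sInf_le ⟨j, rfl, hp⟩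
    exact h1.trans (by exact_mod_cast hj)

lemma eq_of_le_iff {a a' : ℕ∞} {m : ℕ} (h : ∀ i ≤ m, (a ≤ (i : ℕ) ↔ a' ≤ (i : ℕ)))
    (ha : a ≤ m) : a' = a := by
  lift a to ℕ using ne_top_of_le_ne_top (ENat.natCast_ne_top m) ha
  have ham : a ≤ m := by exact_mod_cast ha
  have h1 : a' ≤ a := (h a ham).1 le_rfl
  lift a' to ℕ using ne_top_of_le_ne_top (ENat.natCast_ne_top a) h1
  have h1' : a' ≤ a := by exact_mod_cast h1
  exact le_antisymm h1 ((h a' (h1'.trans ham)).2 le_rfl)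

lemma stageEnd_le_iff {Γ Γ' r r' : ℕ → ℝ} {t : ℕ} (hΓ : ∀ s, 1 ≤ s → s ≤ t → Γ s = Γ' s)
    (hr : ∀ s, 1 ≤ s → s ≤ t → r s = r' s) (b₁ bK d : ℝ) (n : ℕ) :
    ∀ i ≤ t, (stageEnd Γ r b₁ bK d n ≤ (i : ℕ) ↔ stageEnd Γ' r' b₁ bK d n ≤ (i : ℕ)) := by
  induction n with
  | zero => intro i _; simp [stageEnd]
  | succ n ih =>
    have hdet : ∀ (b : ℝ) (S j : ℕ), S + j ≤ t →
        (detect Γ b S ≤ (j : ℕ) ↔ detect Γ' b S ≤ (j : ℕ)) := by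
      intro b S j hj
      unfold detect
      rw [sInf_le_nat_iff (fun j => 1 ≤ j ∧ b ≤ Γ (S + j)),
        sInf_le_nat_iff (fun j => 1 ≤ j ∧ b ≤ Γ' (S + j))]
      refine exists_congr fun l => and_congr_right fun hl => and_congr_right fun hl1 => ?_
      rw [hΓ _ (by omega) (by omega)]
    have hsprt : ∀ (S j : ℕ), S + j ≤ t →
        (sprt r d S ≤ (j : ℕ) ↔ sprt r' d S ≤ (j : ℕ)) := by
      intro S j hj
      unfold sprt
      rw [sInf_le_nat_iff (fun j => 1 ≤ j ∧ d ≤ ∏ i ∈ Finset.Icc 1 j, r (S + i)),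
        sInf_le_nat_iff (fun j => 1 ≤ j ∧ d ≤ ∏ i ∈ Finset.Icc 1 j, r' (S + i))]
      refine exists_congr fun l => and_congr_right fun hl => and_congr_right fun hl1 => ?_
      rw [Finset.prod_congr rfl fun i hi => ?_]
      rw [Finset.mem_Icc] at hi
      exact hr _ (by omega) (by omega)
    have hstep : ∀ (S : ℕ) (i : ℕ), i ≤ t →
        ((S : ℕ∞) + (if Even n then detect Γ b₁ S else min (detect Γ bK S) (sprt r d S)) ≤ i ↔
        (S : ℕ∞) + (if Even n then detect Γ' b₁ S else min (detect Γ' bK S) (sprt r' d S)) ≤ i) := by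
      intro S i hi
      by_cases hSi : S ≤ i
      · obtain ⟨j, rfl⟩ := Nat.exists_eq_add_of_le hSi
        have hc : ∀ a : ℕ∞, (S : ℕ∞) + a ≤ ((S + j : ℕ) : ℕ∞) ↔ a ≤ (j : ℕ) := by
          intro a
          rw [Nat.cast_add]
          exact WithTop.add_le_add_iff_left (ENat.natCast_ne_top S)
        rw [hc, hc]
        split_ifs
        · exact hdet _ _ _ hi
        · rw [min_le_iff, min_le_iff, hdet _ _ _ hi, hsprt _ _ hi]
      · have hn : ∀ a : ℕ∞, ¬ (S : ℕ∞) + a ≤ (i : ℕ) := by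
          intro a ha
          have h1 : (S : ℕ∞) ≤ (i : ℕ) := le_self_add.trans ha
          exact hSi (by exact_mod_cast h1)
        exact iff_of_false (hn _) (hn _)
    intro i hi
    by_cases hS : stageEnd Γ r b₁ bK d n ≤ (t : ℕ)
    · have he := eq_of_le_iff ih hS
      rw [stageEnd, stageEnd, he]
      generalize stageEnd Γ r b₁ bK d n = S at hS
      lift S to ℕ using ne_top_of_le_ne_top (ENat.natCast_ne_top t) hS
      exact hstep S i hi
    · have hS' : ¬ stageEnd Γ' r' b₁ bK d n ≤ (t : ℕ) := fun h => hS ((ih t le_rfl).2 h)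
      have hit : (i : ℕ∞) ≤ t := by exact_mod_cast hi
      rw [stageEnd, stageEnd]
      exact iff_of_false (fun h => hS (le_self_add.trans (h.trans hit)))
        (fun h => hS' (le_self_add.trans (h.trans hit)))

lemma stageTreatment_congr (k : ℕ) {Γ Γ' r r' : ℕ → ℝ} {u : ℕ}
    (hΓ : ∀ s, 1 ≤ s → s < u → Γ s = Γ' s) (hr : ∀ s, 1 ≤ s → s < u → r s = r' s)
    (b₁ bK d : ℝ) : stageTreatment k Γ r b₁ bK d u = stageTreatment k Γ' r' b₁ bK d u := by
  rcases u with _ | t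
  · simp [stageTreatment]
  · have key : ∀ n, (stageEnd Γ r b₁ bK d n < ((t + 1 : ℕ) : ℕ∞) ↔
        stageEnd Γ' r' b₁ bK d n < ((t + 1 : ℕ) : ℕ∞)) := by
      intro n
      have h := stageEnd_le_iff (t := t) (fun s h1 h2 => hΓ s h1 (by omega))
        (fun s h1 h2 => hr s h1 (by omega)) b₁ bK d n t le_rfl
      have hlt : ∀ a : ℕ∞, a < ((t + 1 : ℕ) : ℕ∞) ↔ a ≤ (t : ℕ) := by
        intro a
        rw [Nat.cast_add, Nat.cast_one]
        exact ENat.lt_add_one_iff (ENat.natCast_ne_top t)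
      rw [hlt, hlt, h]
    have key' : ∀ n, (((t + 1 : ℕ) : ℕ∞) ≤ stageEnd Γ r b₁ bK d n ↔
        ((t + 1 : ℕ) : ℕ∞) ≤ stageEnd Γ' r' b₁ bK d n) := by
      intro n
      rw [← not_lt, ← not_lt, key n]
    unfold stageTreatment
    have e : (∃ m : ℕ, 1 ≤ m ∧ stageEnd Γ r b₁ bK d (2 * m - 2) < ((t + 1 : ℕ) : ℕ∞) ∧
          ((t + 1 : ℕ) : ℕ∞) ≤ stageEnd Γ r b₁ bK d (2 * m - 1)) ↔
        ∃ m : ℕ, 1 ≤ m ∧ stageEnd Γ' r' b₁ bK d (2 * m - 2) < ((t + 1 : ℕ) : ℕ∞) ∧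
          ((t + 1 : ℕ) : ℕ∞) ≤ stageEnd Γ' r' b₁ bK d (2 * m - 1) :=
      exists_congr fun m => and_congr_right fun _ => and_congr (key _) (key' _)
    split_ifs with h1 h2 h2
    · rfl
    · exact absurd (e.1 h1) h2
    · exact absurd (e.2 h2) h1
    · rfl

variable {k : ℕ} {𝕐 : Type*} [MeasurableSpace 𝕐] {R : ResponseModel k 𝕐}
  {Ω : Type*} [MeasurableSpace Ω] {P : Measure Ω}

lemma state_congr (W : Noise R P) (π : Transition k) {X X' : ℕ → Ω → Fin (k + 1)} (t : ℕ)
    (h : ∀ s, 1 ≤ s → s ≤ t → X s = X' s) : state W π X t = state W π X' t := by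
  have htp : ∀ s ≤ t, transProb π X s = transProb π X' s := by
    intro s hs
    funext ω
    unfold transProb
    congr 1
    funext i
    rw [h (i + 1) (by omega) (by omega)]
  unfold state
  induction t with
  | zero => funext ω; simp [latent, htp 0 le_rfl]
  | succ t ih =>
    funext ω
    have := ih (fun s h1 h2 => h s h1 (by omega)) (fun s h1 => htp s (by omega))
    simp [latent, htp (t + 1) le_rfl, this]

lemma response_congr (W : Noise R P) (π : Transition k) {X X' : ℕ → Ω → Fin (k + 1)} (t : ℕ)
    (ht : 1 ≤ t) (h : ∀ s, 1 ≤ s → s ≤ t → X s = X' s) :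
    response W π X t = response W π X' t := by
  funext ω
  unfold response
  rw [state_congr W π t h, h t ht le_rfl]

lemma obs_congr (W : Noise R P) (π : Transition k) {X X' : ℕ → Ω → Fin (k + 1)} (t : ℕ)
    (h : ∀ s, 1 ≤ s → s ≤ t → X s = X' s) : obs W π X t = obs W π X' t := by
  unfold obs
  refine iSup_congr fun s => iSup_congr fun hs => ?_
  rw [Finset.mem_Icc] at hs
  rw [response_congr W π s hs.1 fun u h1 h2 => h u h1 (h2.trans hs.2)]

lemma odds_congr (W : Noise R P) (π : Transition k) {X X' : ℕ → Ω → Fin (k + 1)} (t : ℕ)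
    (h : ∀ s, 1 ≤ s → s ≤ t → X s = X' s) : odds W π X t = odds W π X' t := by
  funext ω
  unfold odds
  rw [state_congr W π t h, obs_congr W π t h]

lemma prescribed_congr (W : Noise R P) (π : Transition k) (b₁ bK d : ℝ)
    {X X' : ℕ → Ω → Fin (k + 1)} (u : ℕ) (h : ∀ s, 1 ≤ s → s < u → X s = X' s) :
    prescribed W π b₁ bK d X u = prescribed W π b₁ bK d X' u := by
  funext ω
  unfold prescribed
  refine stageTreatment_congr k (fun s h1 h2 => ?_) (fun s h1 h2 => ?_) b₁ bK d
  · rw [odds_congr W π s fun v hv1 hv2 => h v hv1 (by omega)]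
  · unfold ratioK
    rw [response_congr W π s h1 fun v hv1 hv2 => h v hv1 (by omega)]

/-- The treatments of the proposed procedure are those prescribed by the stages that are computed
from its own posterior odds and responses. -/
theorem prescribed_proposedRule (W : Noise R P) (π : Transition k) (b₁ bK d : ℝ) :
    prescribed W π b₁ bK d (proposedRule W π b₁ bK d) = proposedRule W π b₁ bK d := by
  set F := prescribed W π b₁ bK d with hF
  set X₀ : ℕ → Ω → Fin (k + 1) := fun _ _ => Fin.last k with hX₀
  have step : ∀ n, ∀ u ≤ n, F^[n + 1] X₀ u = F^[n] X₀ u := by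
    intro n
    induction n with
    | zero =>
      intro u hu
      obtain rfl : u = 0 := by omega
      funext ω
      simp [hF, hX₀, prescribed, stageTreatment]
    | succ n ih =>
      intro u hu
      rw [Function.iterate_succ_apply' F (n + 1), Function.iterate_succ_apply' F n]
      refine prescribed_congr W π b₁ bK d u fun s h1 h2 => ?_
      rw [← Function.iterate_succ_apply' F n]
      exact ih s (by omega)
  have stable : ∀ u m, F^[u + m] X₀ u = F^[u] X₀ u := by
    intro u m
    induction m with
    | zero => rfl
    | succ m ih => rw [← add_assoc, step (u + m) u (by omega), ih]
  funext u
  have h1 : F (proposedRule W π b₁ bK d) u = F (F^[u] X₀) u := by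
    refine prescribed_congr W π b₁ bK d u fun s hs1 hs2 => ?_
    obtain ⟨m, rfl⟩ := Nat.exists_eq_add_of_le hs2.le
    exact (stable s m).symm
  rw [h1, ← Function.iterate_succ_apply' F u, step u u le_rfl]
  rfl

end FixedPoint

/-! ## Asymptotics as the tolerance level vanishes -/

/-- The ratio of the two quantities tends to one as `α` decreases to zero. -/
def Equivalent (u v : ℝ → ℝ≥0∞) : Prop :=
  Tendsto (fun α => u α / v α) (𝓝[>] 0) (𝓝 1)

section Framework

variable {k : ℕ} {𝕐 : Type*} [MeasurableSpace 𝕐]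

/-- Change-point models indexed by the tolerance level. -/
structure ChangeModel (k : ℕ) where
  π : ℝ → Transition k
  mem_Icc : ∀ α ∈ Ioo (0 : ℝ) 1, ∀ t z, π α t z ∈ Icc (0 : ℝ) 1

/-- Transition probabilities that become Markovian, uniformly in the tolerance level: for each
treatment `x`, the supremum over `α` and `z` of `|π α t (z, x) - p x α|` tends to `0` as `t`
tends to infinity. -/
def AsympMarkov (M : ChangeModel k) (p : Fin (k + 1) → ℝ → ℝ) : Prop :=
  ∀ x, ∀ ε > 0, ∃ t₀ : ℕ, ∀ t ≥ t₀, ∀ α ∈ Ioo (0 : ℝ) 1, ∀ z : Fin t → Fin (k + 1),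
    |M.π α (t + 1) (Fin.snoc z x) - p x α| ≤ ε

/-- The quantity `|log (zeta 1)|` is `o(|log α|)`.  (This entails positivity for small `α`, which
is written out because the real logarithm of Mathlib takes the value `0` at `0`.) -/
def ZetaRate (M : ChangeModel k) : Prop :=
  (∀ᶠ α in 𝓝[>] 0, 0 < zeta (M.π α) 0) ∧
    Tendsto (fun α => |Real.log (zeta (M.π α) 0)| / |Real.log α|) (𝓝[>] 0) (𝓝 0)

/-- All transition probabilities are bounded away from one. -/
def BoundedAway (M : ChangeModel k) : Prop :=
  ∃ δ ∈ Ioo (0 : ℝ) 1, ∀ α ∈ Ioo (0 : ℝ) 1, ∀ t, piStar (M.π α) t ≤ 1 - δ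

/-- The detection rate of treatment `x`. -/
def detRate (R : ResponseModel k 𝕐) (p : Fin (k + 1) → ℝ → ℝ) (x : Fin (k + 1)) (α : ℝ) : ℝ :=
  R.I x + |Real.log (1 - p x α)|

/-- The threshold of the posterior odds in assessment stages. -/
def thrK (α : ℝ) : ℝ := (1 - α) / α

/-- The threshold of the posterior odds in training stages (meaningful if the last treatment has a
larger detection rate than the first). -/
def thr1 (R : ResponseModel k 𝕐) (M : ChangeModel k) (p : Fin (k + 1) → ℝ → ℝ) (α : ℝ) : ℝ :=
  (1 / zeta (M.π α) 0 + Real.log (thrK α) / detRate R p (Fin.last k) α) /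
    (1 / detRate R p 0 α - 1 / detRate R p (Fin.last k) α)

/-- The threshold of the sequential probability ratio test. -/
def thrD (R : ResponseModel k 𝕐) (M : ChangeModel k) (p : Fin (k + 1) → ℝ → ℝ) (α : ℝ) : ℝ :=
  thr1 R M p α * ((1 / zeta (M.π α) 0 + Real.log (thrK α) / detRate R p (Fin.last k) α) /
    (1 / R.I (Fin.last k) + 1 / R.J (Fin.last k)))

/-- The treatments of the proposed procedure at tolerance level `α`. -/
def tildeX {R : ResponseModel k 𝕐} {Ω : Type*} [MeasurableSpace Ω] {P : Measure Ω}
    (W : Noise R P) (M : ChangeModel k) (p : Fin (k + 1) → ℝ → ℝ) (α : ℝ) :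
    ℕ → Ω → Fin (k + 1) :=
  proposedRule W (M.π α) (thr1 R M p α) (thrK α) (thrD R M p α)

/-- The stopping time of the proposed procedure at tolerance level `α`. -/
def tildeT {R : ResponseModel k 𝕐} {Ω : Type*} [MeasurableSpace Ω] {P : Measure Ω}
    (W : Noise R P) (M : ChangeModel k) (p : Fin (k + 1) → ℝ → ℝ) (α : ℝ) : Ω → ℕ∞ :=
  proposedTime W (M.π α) (thr1 R M p α) (thrK α) (thrD R M p α)

/-- The first-order approximation `lambda_1 + |log α| / D_K`. -/
def approxTime {R : ResponseModel k 𝕐} {Ω : Type*} [MeasurableSpace Ω] {P : Measure Ω}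
    (W : Noise R P) (M : ChangeModel k) (p : Fin (k + 1) → ℝ → ℝ) (α : ℝ) : ℝ≥0∞ :=
  lam W (M.π α) 0 + ENNReal.ofReal (|Real.log α| / detRate R p (Fin.last k) α)

end Framework

end ChangeAccel

end

/-!
The expected time of the proposed procedure is squeezed between two bounds that agree to first
order.

**Posterior odds.** On the responses up to time `t`, the likelihood ratio of a change at time `s`
against no change by time `t` is an explicit product, `changeWeight`. This is a change of measure
(`setLIntegral_changedAt`), and summing over `s` shows that the posterior odds are `totalWeight`
(`odds_ae_eq`). Hence the odds obey a recursion: a step adds the transition probability `q`, divides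
by `1 - q`, and multiplies by the likelihood ratio of the response. After the change their logarithm
therefore has drift close to `D x` under treatment `x`.

**Lower bound.** Let `m` be slightly less than `|log α| / D K`, where `D K` is the largest of the
drifts. A procedure that stops after the
change, but by fewer than `m` steps, stops either while the likelihood ratio of the change is at
most `exp c`, which by the change of measure is at most `m * exp c` times as likely as a false alarm
(`measure_early_small_le`), or when that ratio is unusually large. The logarithm of the ratio is at
most its drift plus a sum of orthogonal centred increments, and Chebyshev's inequality applies
(`measure_early_large_le`). Outside of an event of small probability, the procedure thus needs `m`
steps after the change-point, which is never earlier than the change-point under the maximal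
transition probabilities. On the exceptional event the expected value of the latter is controlled by
`ζ` and the square root of `α` (`lamStar_add_le`). Since `|log ζ| = o(|log α|)`, all the errors stay
bounded, and the last hypothesis permits to replace `lamStar` by `lam` (`eventually_approxTime_le`).

**Upper bound.** The steps of the proposed procedure are sorted into types, such as training steps
after the change or assessment steps before it, and for each type consecutive steps are grouped into
runs. Along a run the log-odds (or, before the change, the logarithm of the statistic of the
sequential test) climb from a known level to a known threshold, by independent increments with
positive mean. With the increments truncated from above there is no uncontrolled overshoot, so that
an argument in the style of Wald's identity bounds the expected number of steps by the number of
runs times the height of the climb divided by the drift (`count_le`). The runs are few: the first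
training stage ends before the change with probability at most `1 / (1 + b₁)`, in later training
stages the change comes at each step with probability at least `ζ`, and an assessment stage that
began after the change is ended by the sequential test with probability at most `1 / d`. In the sum
of all types (`sum_alive_le`), training after the change costs about `log b₁ / D 1` and the decisive
assessment stage `(log bK - log b₁) / D K`. The total exceeds `log bK / D K` by
`log b₁ * (1 / D 1 - 1 / D K)`, which is negligible because `b₁` is `A / (1 / D 1 - 1 / D K)` with
`log A = o(|log α|)` and `-x * log x` is bounded (`stopping_bound_le`).

The probability of a false alarm is at most `1 / (1 + bK) = α`, as the procedure stops only when the
posterior odds are at least `bK` (`proposed_mem_procedures`).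
-/

noncomputable section

namespace ChangeAccel

/-! ### Independence and the uniform law -/

instance : IsProbabilityMeasure unif := ⟨by simp [unif]⟩

lemma unif_Iic {q : ℝ} (h1 : q < 1) : unif (Iic q) = ENNReal.ofReal q := by
  have : Iic q ∩ Ioo (0 : ℝ) 1 = Ioc 0 q := by
    ext x; simp only [mem_inter_iff, mem_Iic, mem_Ioo, mem_Ioc]
    constructor
    · rintro ⟨a, b, c⟩; exact ⟨b, a⟩
    · rintro ⟨a, b⟩; exact ⟨b, a, by linarith⟩
  rw [unif, Measure.restrict_apply measurableSet_Iic, this, Real.volume_Ioc, sub_zero]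

lemma unif_Ioi {q : ℝ} (h0 : 0 ≤ q) (h1 : q < 1) : unif (Ioi q) = ENNReal.ofReal (1 - q) := by
  rw [← compl_Iic, prob_compl_eq_one_sub measurableSet_Iic, unif_Iic h1,
    ENNReal.ofReal_sub _ h0, ENNReal.ofReal_one]

/-- Integrating a function of a variable `Z` that is known at stage `m` and of a variable `V` that
is independent of `m`, over an event known at stage `m`: the variable `Z` can be frozen. -/
lemma setLIntegral_freeze {Ω E : Type*} {m mΩ : MeasurableSpace Ω} {P : Measure Ω}
    [IsFiniteMeasure P] [MeasurableSpace E] (hm : m ≤ mΩ) {V : Ω → ℝ}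
    (hV : Measurable V) (hind : Indep m (MeasurableSpace.comap V inferInstance) P)
    {ν : Measure ℝ} [IsProbabilityMeasure ν] (hlaw : P.map V = ν) {D : Set Ω}
    (hD : MeasurableSet[m] D) {Z : Ω → E} (hZ : Measurable[m] Z) {F : E × ℝ → ℝ≥0∞}
    (hF : Measurable F) :
    ∫⁻ ω in D, F (Z ω, V ω) ∂P = ∫⁻ ω in D, ∫⁻ v, F (Z ω, v) ∂ν ∂P := by
  have hZ' : Measurable Z := hZ.mono hm le_rfl
  have hpair : ((P.restrict D).map Z).prod ν = (P.restrict D).map fun ω => (Z ω, V ω) := by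
    refine Measure.prod_eq fun A B hA hB => ?_
    rw [Measure.map_apply (hZ'.prodMk hV) (hA.prod hB), Measure.map_apply hZ' hA, ← hlaw,
      Measure.map_apply hV hB, Measure.restrict_apply (hZ' hA),
      Measure.restrict_apply ((hZ'.prodMk hV) (hA.prod hB)),
      ← (Indep_iff _ _ _).1 hind _ _ ((hZ hA).inter hD) ⟨B, hB, rfl⟩]
    congr 1
    ext ω
    simp only [mem_inter_iff, mem_preimage, mem_prod]
    tauto
  calc ∫⁻ ω in D, F (Z ω, V ω) ∂P
      = ∫⁻ z, F z ∂((P.restrict D).map fun ω => (Z ω, V ω)) :=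
        (lintegral_map hF (hZ'.prodMk hV)).symm
    _ = ∫⁻ ω in D, ∫⁻ v, F (Z ω, v) ∂ν ∂P := by
        rw [← hpair, lintegral_prod _ hF.aemeasurable,
          lintegral_map hF.lintegral_prod_right' hZ']

/-- A variable that is independent of an event is integrated over it separately. -/
lemma setIntegral_indep {Ω : Type*} {m mΩ : MeasurableSpace Ω} {P : Measure Ω} (hm : m ≤ mΩ)
    {V : Ω → ℝ} (hV : Measurable V) (hind : Indep m (MeasurableSpace.comap V inferInstance) P)
    {ν : Measure ℝ} (hlaw : P.map V = ν) {f : Ω → ℝ}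
    (hf : Measurable[m] f) {z : ℝ → ℝ} (hz : Measurable z) :
    ∫ ω, f ω * z (V ω) ∂P = (∫ ω, f ω ∂P) * ∫ v, z v ∂ν := by
  have hi : IndepFun f (fun ω => z (V ω)) P := by
    rw [IndepFun_iff_Indep]
    refine indep_of_indep_of_le_left (indep_of_indep_of_le_right hind ?_) hf.comap_le
    rw [show (fun ω => z (V ω)) = z ∘ V from rfl, ← MeasurableSpace.comap_comp]
    exact MeasurableSpace.comap_mono hz.comap_le
  rw [hi.integral_fun_mul_eq_mul_integral (hf.mono hm le_rfl).aestronglyMeasurable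
    (hz.comp hV).aestronglyMeasurable, ← hlaw, integral_map hV.aemeasurable
    hz.aestronglyMeasurable]

lemma toENNReal_eq_tsum (a : ℕ∞) :
    (a : ℝ≥0∞) = ∑' t : ℕ, {t : ℕ | (t : ℕ∞) < a}.indicator (fun _ => 1) t := by
  rw [← tsum_subtype, ENNReal.tsum_set_one]
  congr 1
  induction a with
  | top => simp
  | coe n =>
    simp only [Nat.cast_lt]
    rw [show {t : ℕ | t < n} = (Finset.range n : Set ℕ) by ext; simp,
      Set.encard_coe_eq_coe_finsetCard, Finset.card_range]

/-! ### The latent state -/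

section Latent

variable {k : ℕ} {Ω : Type*}

lemma measurable_transProb {m : MeasurableSpace Ω} (π : Transition k) {X : ℕ → Ω → Fin (k + 1)}
    (t : ℕ) (h : ∀ s < t, Measurable[m] (X (s + 1))) : Measurable[m] (transProb π X t) := by
  have : Measurable[m] fun ω (i : Fin t) => X (i + 1) ω :=
    measurable_pi_lambda _ fun i => h i i.2
  exact (Measurable.of_discrete (f := π t)).comp this

lemma latent_mono {U q : ℕ → Ω → ℝ} {ω : Ω} {s t : ℕ} (h : s ≤ t) (hs : latent U q s ω = 1) :
    latent U q t ω = 1 := by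
  induction t, h using Nat.le_induction with
  | base => exact hs
  | succ t _ ih => simp [latent, ih]

lemma fin_two_ne_one {a : Fin 2} : a ≠ 1 ↔ a = 0 := by omega

lemma latent_succ_eq_zero {U q : ℕ → Ω → ℝ} {ω : Ω} {t : ℕ} :
    latent U q (t + 1) ω = 0 ↔ latent U q t ω = 0 ∧ q (t + 1) ω < U (t + 1) ω := by
  rw [← not_le]
  simp only [latent]
  split_ifs with h1 h2
  · simp [h1]
  · simp [h2]
  · simp [h2, fin_two_ne_one.1 h1]

lemma latent_zero_eq_zero {U q : ℕ → Ω → ℝ} {ω : Ω} :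
    latent U q 0 ω = 0 ↔ q 0 ω < U 0 ω := by
  rw [← not_le]
  simp only [latent]
  split_ifs with h <;> simp [h]

lemma lt_firstOne_iff (L : ℕ → Ω → Fin 2) (ω : Ω) (hL : ∀ s t, s ≤ t → L s ω = 1 → L t ω = 1)
    (t : ℕ) : (t : ℕ∞) < firstOne L ω ↔ L t ω = 0 := by
  rw [← not_le]
  unfold firstOne
  rw [sInf_le_nat_iff (fun j => L j ω = 1), ← fin_two_ne_one, not_iff_not]
  exact ⟨fun ⟨j, hj, h⟩ => hL j t hj h, fun h => ⟨t, le_rfl, h⟩⟩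

lemma lt_firstOne_latent {U q : ℕ → Ω → ℝ} {ω : Ω} {t : ℕ} :
    (t : ℕ∞) < firstOne (latent U q) ω ↔ latent U q t ω = 0 :=
  lt_firstOne_iff _ _ (fun _ _ h => latent_mono h) t

end Latent

/-! ### The information before and during a step -/

section System

variable {k : ℕ} {𝕐 : Type*} [MeasurableSpace 𝕐] {R : ResponseModel k 𝕐}
  {Ω : Type*} [mΩ : MeasurableSpace Ω] {P : Measure Ω}

namespace Noise

/-- The sigma-algebra generated by the uniform variables whose indices belong to `S`. -/
@[reducible]
def sigma (W : Noise R P) (S : Set (ℕ ⊕ ℕ)) : MeasurableSpace Ω :=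
  ⨆ i ∈ S, MeasurableSpace.comap (Sum.elim W.U W.V i) inferInstance

/-- The information generated by all uniform variables with an index less than `t`. -/
@[reducible]
def before (W : Noise R P) (t : ℕ) : MeasurableSpace Ω :=
  W.sigma {i | Sum.elim (· < t) (· < t) i}

/-- The information before time `t` together with the variable `U t`: it determines the latent
state at time `t`, and is independent of `V t`. -/
@[reducible]
def mid (W : Noise R P) (t : ℕ) : MeasurableSpace Ω :=
  W.sigma {i | Sum.elim (· ≤ t) (· < t) i}

lemma sum_meas (W : Noise R P) (i : ℕ ⊕ ℕ) : Measurable (Sum.elim W.U W.V i) := by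
  rcases i with i | i
  · exact W.U_meas i
  · exact W.V_meas i

lemma sigma_le (W : Noise R P) (S : Set (ℕ ⊕ ℕ)) : W.sigma S ≤ mΩ :=
  iSup₂_le fun i _ => (W.sum_meas i).comap_le

lemma sigma_mono (W : Noise R P) {S T : Set (ℕ ⊕ ℕ)} (h : S ⊆ T) : W.sigma S ≤ W.sigma T :=
  biSup_mono fun _ hi => h hi

lemma before_le (W : Noise R P) (t : ℕ) : W.before t ≤ mΩ := W.sigma_le _

lemma mid_le (W : Noise R P) (t : ℕ) : W.mid t ≤ mΩ := W.sigma_le _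

lemma before_le_mid (W : Noise R P) (t : ℕ) : W.before t ≤ W.mid t := by
  refine W.sigma_mono ?_
  rintro (i | i) (h : i < t)
  · exact h.le
  · exact h

lemma mid_le_before (W : Noise R P) (t : ℕ) : W.mid t ≤ W.before (t + 1) := by
  refine W.sigma_mono ?_
  rintro (i | i) h
  · exact Nat.lt_succ_of_le (show i ≤ t from h)
  · exact Nat.lt_succ_of_lt (show i < t from h)

lemma before_mono (W : Noise R P) {s t : ℕ} (h : s ≤ t) : W.before s ≤ W.before t := by
  refine W.sigma_mono ?_
  rintro (i | i) hi
  · exact lt_of_lt_of_le hi h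
  · exact lt_of_lt_of_le hi h

lemma mid_mono (W : Noise R P) {s t : ℕ} (h : s ≤ t) : W.mid s ≤ W.mid t := by
  refine W.sigma_mono ?_
  rintro (i | i) hi
  · exact le_trans hi h
  · exact lt_of_lt_of_le hi h

lemma U_mid (W : Noise R P) (t : ℕ) : Measurable[W.mid t] (W.U t) :=
  measurable_iff_comap_le.2 (le_biSup (fun i => MeasurableSpace.comap (Sum.elim W.U W.V i) _)
    (show Sum.inl t ∈ {i : ℕ ⊕ ℕ | Sum.elim (· ≤ t) (· < t) i} from le_refl t))

lemma V_before (W : Noise R P) (t : ℕ) : Measurable[W.before (t + 1)] (W.V t) :=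
  measurable_iff_comap_le.2 (le_biSup (fun i => MeasurableSpace.comap (Sum.elim W.U W.V i) _)
    (show Sum.inr t ∈ {i : ℕ ⊕ ℕ | Sum.elim (· < t + 1) (· < t + 1) i} from Nat.lt_succ_self t))

lemma indep_sigma (W : Noise R P) {S : Set (ℕ ⊕ ℕ)} {i : ℕ ⊕ ℕ} (hi : i ∉ S) :
    Indep (W.sigma S) (MeasurableSpace.comap (Sum.elim W.U W.V i) inferInstance) P := by
  have h := indep_iSup_of_disjoint (fun i => (W.sum_meas i).comap_le)
    ((iIndepFun_iff_iIndep _ _ _).1 W.indep) (disjoint_singleton_right.2 hi)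
  simpa [sigma] using h

lemma indep_U (W : Noise R P) (t : ℕ) :
    Indep (W.before t) (MeasurableSpace.comap (W.U t) inferInstance) P :=
  W.indep_sigma (i := Sum.inl t) (lt_irrefl t)

lemma indep_V (W : Noise R P) (t : ℕ) :
    Indep (W.mid t) (MeasurableSpace.comap (W.V t) inferInstance) P :=
  W.indep_sigma (i := Sum.inr t) (lt_irrefl t)

end Noise

/-! ### Adapted treatments -/

lemma obs_zero (W : Noise R P) (π : Transition k) (X : ℕ → Ω → Fin (k + 1)) :
    obs W π X 0 = ⊥ := by
  simp [obs]

lemma obs_succ (W : Noise R P) (π : Transition k) (X : ℕ → Ω → Fin (k + 1)) (t : ℕ) :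
    obs W π X (t + 1) =
      obs W π X t ⊔ MeasurableSpace.comap (response W π X (t + 1)) inferInstance := by
  unfold obs
  rw [← Finset.insert_Icc_right_eq_Icc_add_one (by omega), Finset.iSup_insert, sup_comm]

lemma obs_mono (W : Noise R P) (π : Transition k) (X : ℕ → Ω → Fin (k + 1)) {s t : ℕ}
    (h : s ≤ t) : obs W π X s ≤ obs W π X t :=
  biSup_mono fun i hi => by rw [Finset.mem_Icc] at *; omega

lemma measurable_transProb_obs (W : Noise R P) (π : Transition k) {X : ℕ → Ω → Fin (k + 1)}
    (hX : ∀ t, Measurable[obs W π X t] (X (t + 1))) (t : ℕ) :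
    Measurable[obs W π X t] (transProb π X (t + 1)) :=
  measurable_transProb π _ fun s hs => (hX s).mono (obs_mono W π X (by omega)) le_rfl

lemma measurable_latent (W : Noise R P) {q : ℕ → Ω → ℝ} (t : ℕ)
    (h : ∀ s ≤ t, Measurable[W.before s] (q s)) : Measurable[W.mid t] (latent W.U q t) := by
  have key : ∀ s ≤ t, MeasurableSet[W.mid s] {ω | W.U s ω ≤ q s ω} := fun s hs =>
    measurableSet_le (W.U_mid s) ((h s hs).mono (W.before_le_mid s) le_rfl)
  induction t with
  | zero => exact Measurable.ite (key 0 le_rfl) measurable_const measurable_const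
  | succ t ih =>
    have h1 : Measurable[W.mid (t + 1)] (latent W.U q t) :=
      (ih (fun s hs => h s (by omega)) (fun s hs => key s (by omega))).mono
        (W.mid_mono (by omega)) le_rfl
    refine Measurable.ite (h1 (measurableSet_singleton 1)) measurable_const ?_
    exact Measurable.ite (key _ le_rfl) measurable_const measurable_const

lemma measurable_response_before (W : Noise R P) (π : Transition k) {X : ℕ → Ω → Fin (k + 1)}
    {t : ℕ} (hX : Measurable[W.mid t] (X t)) (hL : Measurable[W.mid t] (state W π X t)) :
    Measurable[W.before (t + 1)] (response W π X t) := by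
  have h : Measurable fun p : (Fin (k + 1) × Fin 2) × ℝ => W.h p.1.1 p.1.2 p.2 :=
    measurable_from_prod_countable_right fun p => W.h_meas p.1 p.2
  exact h.comp (((hX.prodMk hL).mono (W.mid_le_before t) le_rfl).prodMk (W.V_before t))

/-- The responses up to time `t` are determined by the noise up to time `t`. -/
lemma obs_le_before (W : Noise R P) (π : Transition k) {X : ℕ → Ω → Fin (k + 1)}
    (hX : ∀ t, Measurable[obs W π X t] (X (t + 1))) (t : ℕ) :
    obs W π X t ≤ W.before (t + 1) := by
  induction t using Nat.strong_induction_on with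
  | _ t ih =>
    rcases t with _ | t
    · rw [obs_zero]; exact bot_le
    · have hX' : ∀ s ≤ t, Measurable[W.before (s + 1)] (X (s + 1)) := fun s hs =>
        (hX s).mono (ih s (by omega)) le_rfl
      have hq : ∀ s ≤ t + 1, Measurable[W.before s] (transProb π X s) := fun s hs =>
        measurable_transProb π s fun u hu =>
          (hX' u (by omega)).mono (W.before_mono (by omega)) le_rfl
      rw [obs_succ]
      refine sup_le ((ih t (by omega)).trans (W.before_mono (by omega))) ?_
      exact (measurable_response_before W π
        ((hX' t le_rfl).mono (W.before_le_mid _) le_rfl) (measurable_latent W _ hq)).comap_le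

lemma obs_le (W : Noise R P) (π : Transition k) {X : ℕ → Ω → Fin (k + 1)}
    (hX : ∀ t, Measurable[obs W π X t] (X (t + 1))) (t : ℕ) : obs W π X t ≤ mΩ :=
  (obs_le_before W π hX t).trans (W.before_le _)

lemma measurable_transProb_before (W : Noise R P) (π : Transition k) {X : ℕ → Ω → Fin (k + 1)}
    (hX : ∀ t, Measurable[obs W π X t] (X (t + 1))) (t : ℕ) :
    Measurable[W.before t] (transProb π X t) :=
  measurable_transProb π t fun s hs =>
    ((hX s).mono (obs_le_before W π hX s) le_rfl).mono (W.before_mono (by omega)) le_rfl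

lemma measurable_state (W : Noise R P) (π : Transition k) {X : ℕ → Ω → Fin (k + 1)}
    (hX : ∀ t, Measurable[obs W π X t] (X (t + 1))) (t : ℕ) :
    Measurable[W.mid t] (state W π X t) :=
  measurable_latent W t fun s _ => measurable_transProb_before W π hX s

lemma measurable_response (W : Noise R P) (π : Transition k) (X : ℕ → Ω → Fin (k + 1)) (t : ℕ) :
    Measurable[obs W π X (t + 1)] (response W π X (t + 1)) := by
  rw [obs_succ]
  exact measurable_iff_comap_le.2 le_sup_right

/-- The expected value of a random time is the sum of its tail probabilities. -/
lemma expTime_eq_tsum {T : Ω → ℕ∞} (hT : ∀ t : ℕ, MeasurableSet {ω | (t : ℕ∞) < T ω}) :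
    expTime P T = ∑' t : ℕ, P {ω | (t : ℕ∞) < T ω} := by
  have h : ∀ ω, (T ω : ℝ≥0∞) = ∑' t : ℕ, {ω | (t : ℕ∞) < T ω}.indicator (fun _ => 1) ω :=
    fun ω => toENNReal_eq_tsum (T ω)
  unfold expTime
  simp_rw [h]
  rw [lintegral_tsum fun t => (measurable_const.indicator (hT t)).aemeasurable]
  refine tsum_congr fun t => ?_
  rw [lintegral_indicator (hT t)]
  simp

end System

/-! ### Change of measure -/

section ChangeOfMeasure

variable {k : ℕ} {𝕐 : Type*} [MeasurableSpace 𝕐] {R : ResponseModel k 𝕐}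
  {Ω : Type*} [mΩ : MeasurableSpace Ω] {P : Measure Ω}

lemma ResponseModel.dens_meas (R : ResponseModel k 𝕐) (x : Fin (k + 1)) (i : Fin 2) :
    Measurable (R.dens x i) := by
  unfold ResponseModel.dens
  split_ifs
  · exact R.f_meas x
  · exact R.g_meas x

lemma Noise.lintegral_h (W : Noise R P) (x : Fin (k + 1)) (i : Fin 2) {φ : 𝕐 → ℝ≥0∞}
    (hφ : Measurable φ) :
    ∫⁻ v, φ (W.h x i v) ∂unif = ∫⁻ y, φ y * ENNReal.ofReal (R.dens x i y) ∂(R.μ) := by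
  rw [← lintegral_map hφ (W.h_meas x i), W.h_law,
    lintegral_withDensity_eq_lintegral_mul _ (R.dens_meas x i).ennreal_ofReal hφ]
  simp only [Pi.mul_apply, mul_comm]

/-- The expectation of a function of a response in state `1` is the expectation in state `0` of the
function times the likelihood ratio. -/
lemma Noise.lintegral_ratio (W : Noise R P) (hR : R.Regular) (x : Fin (k + 1)) {φ : 𝕐 → ℝ≥0∞}
    (hφ : Measurable φ) :
    ∫⁻ v, φ (W.h x 0 v) * ENNReal.ofReal (R.g x (W.h x 0 v) / R.f x (W.h x 0 v)) ∂unif =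
      ∫⁻ v, φ (W.h x 1 v) ∂unif := by
  rw [W.lintegral_h x 1 hφ, W.lintegral_h x 0
    (φ := fun y => φ y * ENNReal.ofReal (R.g x y / R.f x y))
    (hφ.mul ((R.g_meas x).div (R.f_meas x)).ennreal_ofReal)]
  refine lintegral_congr_ae ?_
  filter_upwards [(hR x).1] with y hy
  rw [mul_assoc, ← ENNReal.ofReal_mul (div_nonneg (R.g_nonneg x y) (R.f_nonneg x y))]
  simp only [ResponseModel.dens, if_true, one_ne_zero, if_false]
  by_cases h : R.f x y = 0
  · simp [h, hy.1 h]
  · rw [div_mul_cancel₀ _ h]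

/-- The expected likelihood ratio of state `0` against state `1` is at most one in state `1`. -/
lemma Noise.lintegral_inv_ratio (W : Noise R P) (hR : R.Regular) (x : Fin (k + 1)) :
    ∫⁻ v, ENNReal.ofReal (R.f x (W.h x 1 v) / R.g x (W.h x 1 v)) ∂unif = 1 := by
  rw [W.lintegral_h x 1 (φ := fun y => ENNReal.ofReal (R.f x y / R.g x y))
    ((R.f_meas x).div (R.g_meas x)).ennreal_ofReal, ← R.f_total x]
  refine lintegral_congr_ae ?_
  filter_upwards [(hR x).1] with y hy
  rw [← ENNReal.ofReal_mul (div_nonneg (R.f_nonneg x y) (R.g_nonneg x y))]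
  simp only [ResponseModel.dens, one_ne_zero, if_false]
  by_cases h : R.g x y = 0
  · simp [h, hy.2 h]
  · rw [div_mul_cancel₀ _ h]

lemma Noise.ae_pos (W : Noise R P) (hR : R.Regular) (x : Fin (k + 1)) (i : Fin 2) :
    ∀ᵐ v ∂unif, 0 < R.f x (W.h x i v) ∧ 0 < R.g x (W.h x i v) := by
  have h : ∀ᵐ y ∂(unif.map (W.h x i)), 0 < R.f x y ∧ 0 < R.g x y := by
    rw [W.h_law, ae_withDensity_iff (R.dens_meas x i).ennreal_ofReal]
    filter_upwards [(hR x).1] with y hy hd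
    have hd' : R.dens x i y ≠ 0 := fun h => hd (by rw [h, ENNReal.ofReal_zero])
    have hf : R.f x y ≠ 0 := by
      intro h
      unfold ResponseModel.dens at hd'
      split_ifs at hd'
      · exact hd' h
      · exact hd' (hy.1 h)
    exact ⟨lt_of_le_of_ne (R.f_nonneg x y) hf.symm,
      lt_of_le_of_ne (R.g_nonneg x y) fun h => hf (hy.2 h.symm)⟩
  exact ae_of_ae_map (W.h_meas x i).aemeasurable h

lemma Noise.ae_V (W : Noise R P) {p : ℝ → Prop} (h : ∀ᵐ v ∂unif, p v) (t : ℕ) :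
    ∀ᵐ ω ∂P, p (W.V t ω) := by
  rw [← W.V_law t] at h
  exact ae_of_ae_map (W.V_meas t).aemeasurable h

/-- Both densities are positive at all responses. -/
lemma ae_response_pos (W : Noise R P) (hR : R.Regular) :
    ∀ᵐ ω ∂P, ∀ (t : ℕ) (x : Fin (k + 1)) (i : Fin 2),
      0 < R.f x (W.h x i (W.V t ω)) ∧ 0 < R.g x (W.h x i (W.V t ω)) := by
  rw [ae_all_iff]; intro t
  rw [ae_all_iff]; intro x
  rw [ae_all_iff]; intro i
  exact W.ae_V (W.ae_pos hR x i) t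

/-- The likelihood ratio of state `1` against state `0` at the response at time `t`. -/
def likRatio (W : Noise R P) (π : Transition k) (X : ℕ → Ω → Fin (k + 1)) (t : ℕ) (ω : Ω) : ℝ :=
  R.g (X t ω) (response W π X t ω) / R.f (X t ω) (response W π X t ω)

/-- The likelihood ratio, on the responses up to time `t`, of a change at time `s` against no change
up to time `t`. -/
def changeWeight (W : Noise R P) (π : Transition k) (X : ℕ → Ω → Fin (k + 1)) (s : ℕ) :
    ℕ → Ω → ℝ
  | 0, ω => if s = 0 then transProb π X 0 ω / (1 - transProb π X 0 ω) else 0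
  | t + 1, ω => (if s = t + 1 then transProb π X (t + 1) ω else changeWeight W π X s t ω) *
      (1 / (1 - transProb π X (t + 1) ω)) * likRatio W π X (t + 1) ω

/-- The event that the change occurs at time `s`. -/
def changedAt (W : Noise R P) (π : Transition k) (X : ℕ → Ω → Fin (k + 1)) (s : ℕ) : Set Ω :=
  {ω | state W π X s ω = 1 ∧ ∀ u < s, state W π X u ω = 0}

lemma likRatio_nonneg (W : Noise R P) (π : Transition k) (X : ℕ → Ω → Fin (k + 1)) (t : ℕ)
    (ω : Ω) : 0 ≤ likRatio W π X t ω :=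
  div_nonneg (R.g_nonneg _ _) (R.f_nonneg _ _)

lemma changeWeight_nonneg (W : Noise R P) {π : Transition k} (h0 : ∀ t z, 0 ≤ π t z)
    (h1 : ∀ t z, π t z < 1) (X : ℕ → Ω → Fin (k + 1)) (s t : ℕ) (ω : Ω) :
    0 ≤ changeWeight W π X s t ω := by
  have h1' : ∀ t, 0 ≤ 1 - transProb π X t ω := fun t => by
    have := h1 t fun i => X (i + 1) ω
    unfold transProb
    linarith
  induction t with
  | zero =>
    unfold changeWeight
    split_ifs
    · exact div_nonneg (h0 _ _) (h1' 0)
    · exact le_rfl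
  | succ t ih =>
    unfold changeWeight
    refine mul_nonneg (mul_nonneg ?_ (one_div_nonneg.2 (h1' _))) (likRatio_nonneg W π X _ ω)
    split_ifs
    · exact h0 _ _
    · exact ih

variable [IsProbabilityMeasure P]

/-- One step of the change of measure.  If, for functions of the information `Z` before time `t`,
integration over the event `D` is integration over the event `S` of no change with weight `ρ`, then
the response at time `t` multiplies the weight by `1 / (1 - q)` and by the likelihood ratio. -/
lemma change_step {E : Type*} [MeasurableSpace E] (W : Noise R P) (hR : R.Regular) {t : ℕ}
    {Z : Ω → E} (hZ : Measurable[W.before t] Z) {S D : Set Ω}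
    (hS : MeasurableSet[W.before t] S) (hD : MeasurableSet[W.mid t] D)
    {x : E → Fin (k + 1)} (hx : Measurable x) {q : E → ℝ} (hq : Measurable q)
    (hq0 : ∀ e, 0 ≤ q e) (hq1 : ∀ e, q e < 1) {ρ : E → ℝ≥0∞} (hρ : Measurable ρ)
    (hyp : ∀ φ : E → ℝ≥0∞, Measurable φ →
      ∫⁻ ω in D, φ (Z ω) ∂P = ∫⁻ ω in S, φ (Z ω) * ρ (Z ω) ∂P)
    {ψ : E × 𝕐 → ℝ≥0∞} (hψ : Measurable ψ) :
    ∫⁻ ω in D, ψ (Z ω, W.h (x (Z ω)) 1 (W.V t ω)) ∂P =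
      ∫⁻ ω in S ∩ {ω | q (Z ω) < W.U t ω}, ψ (Z ω, W.h (x (Z ω)) 0 (W.V t ω)) *
        (ρ (Z ω) * ENNReal.ofReal (1 / (1 - q (Z ω))) *
          ENNReal.ofReal (R.g (x (Z ω)) (W.h (x (Z ω)) 0 (W.V t ω)) /
            R.f (x (Z ω)) (W.h (x (Z ω)) 0 (W.V t ω)))) ∂P := by
  have hh : ∀ i : Fin 2, Measurable fun p : E × ℝ => W.h (x p.1) i p.2 := fun i =>
    (measurable_from_prod_countable_right (f := fun p : Fin (k + 1) × ℝ => W.h p.1 i p.2)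
      fun p => W.h_meas p i).comp ((hx.comp measurable_fst).prodMk measurable_snd)
  have hgf : Measurable fun p : Fin (k + 1) × 𝕐 => R.g p.1 p.2 / R.f p.1 p.2 :=
    measurable_from_prod_countable_right fun p => (R.g_meas p).div (R.f_meas p)
  have hψi : ∀ i : Fin 2, Measurable fun p : E × ℝ => ψ (p.1, W.h (x p.1) i p.2) := fun i =>
    hψ.comp (measurable_fst.prodMk (hh i))
  set φ : E → ℝ≥0∞ := fun e => ∫⁻ v, ψ (e, W.h (x e) 1 v) ∂unif with hφ
  have hφm : Measurable φ := (hψi 1).lintegral_prod_right'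
  have h1 : Measurable fun e => ENNReal.ofReal (1 / (1 - q e)) :=
    (measurable_const.div (measurable_const.sub hq)).ennreal_ofReal
  have hZm : Measurable[W.mid t] Z := hZ.mono (W.before_le_mid t) le_rfl
  have hSU : MeasurableSet[W.mid t] (S ∩ {ω | q (Z ω) < W.U t ω}) :=
    (W.before_le_mid t _ hS).inter (measurableSet_lt (hq.comp hZm) (W.U_mid t))
  calc ∫⁻ ω in D, ψ (Z ω, W.h (x (Z ω)) 1 (W.V t ω)) ∂P
      = ∫⁻ ω in D, φ (Z ω) ∂P :=
        setLIntegral_freeze (W.mid_le t) (W.V_meas t) (W.indep_V t) (W.V_law t) hD hZm (hψi 1)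
    _ = ∫⁻ ω in S, φ (Z ω) * ρ (Z ω) ∂P := hyp φ hφm
    _ = ∫⁻ ω in S, ∫⁻ u, (Ioi (q (Z ω))).indicator (fun _ => φ (Z ω) *
          (ρ (Z ω) * ENNReal.ofReal (1 / (1 - q (Z ω))))) u ∂unif ∂P := by
        refine lintegral_congr fun ω => ?_
        rw [lintegral_indicator measurableSet_Ioi, setLIntegral_const,
          unif_Ioi (hq0 _) (hq1 _), mul_assoc, mul_assoc, ← ENNReal.ofReal_mul, one_div,
          inv_mul_cancel₀, ENNReal.ofReal_one, mul_one]
        · linarith [hq1 (Z ω)]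
        · exact one_div_nonneg.2 (by linarith [hq1 (Z ω)])
    _ = ∫⁻ ω in S, (Ioi (q (Z ω))).indicator (fun _ => φ (Z ω) *
          (ρ (Z ω) * ENNReal.ofReal (1 / (1 - q (Z ω))))) (W.U t ω) ∂P := by
        refine (setLIntegral_freeze (W.before_le t) (W.U_meas t) (W.indep_U t) (W.U_law t) hS hZ
          (F := fun p => (Ioi (q p.1)).indicator (fun _ => φ p.1 *
          (ρ p.1 * ENNReal.ofReal (1 / (1 - q p.1)))) p.2) ?_).symm
        refine Measurable.ite (measurableSet_lt (hq.comp measurable_fst) measurable_snd) ?_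
          measurable_const
        exact ((hφm.mul (hρ.mul h1))).comp measurable_fst
    _ = ∫⁻ ω in S ∩ {ω | q (Z ω) < W.U t ω}, φ (Z ω) *
          (ρ (Z ω) * ENNReal.ofReal (1 / (1 - q (Z ω)))) ∂P := by
        rw [← lintegral_indicator (W.before_le t _ hS), ← lintegral_indicator (W.mid_le t _ hSU)]
        refine lintegral_congr fun ω => ?_
        by_cases hω : ω ∈ S <;> by_cases hu : q (Z ω) < W.U t ω <;> simp [indicator, hω, hu]
    _ = ∫⁻ ω in S ∩ {ω | q (Z ω) < W.U t ω}, ∫⁻ v, ψ (Z ω, W.h (x (Z ω)) 0 v) *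
        (ρ (Z ω) * ENNReal.ofReal (1 / (1 - q (Z ω))) *
          ENNReal.ofReal (R.g (x (Z ω)) (W.h (x (Z ω)) 0 v) /
            R.f (x (Z ω)) (W.h (x (Z ω)) 0 v))) ∂unif ∂P := by
        refine lintegral_congr fun ω => ?_
        have := W.lintegral_ratio hR (x (Z ω)) (φ := fun y => ψ (Z ω, y))
          (hψ.comp measurable_prodMk_left)
        simp only [hφ]
        rw [← this, ← lintegral_mul_const]
        · refine lintegral_congr fun v => ?_
          ring
        · exact (hψ.comp measurable_prodMk_left).comp (W.h_meas _ 0) |>.mul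
            ((((R.g_meas _).div (R.f_meas _)).ennreal_ofReal).comp (W.h_meas _ 0))
    _ = _ := by
        refine (setLIntegral_freeze (W.mid_le t) (W.V_meas t) (W.indep_V t) (W.V_law t) hSU hZm
          (F := fun p => ψ (p.1, W.h (x p.1) 0 p.2) *
            (ρ p.1 * ENNReal.ofReal (1 / (1 - q p.1)) *
            ENNReal.ofReal (R.g (x p.1) (W.h (x p.1) 0 p.2) /
              R.f (x p.1) (W.h (x p.1) 0 p.2)))) ?_).symm
        refine (hψi 0).mul (((hρ.mul h1).comp measurable_fst).mul ?_)
        exact (hgf.comp ((hx.comp measurable_fst).prodMk (hh 0))).ennreal_ofReal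

end ChangeOfMeasure

section Posterior

variable {k : ℕ} {𝕐 : Type*} [MeasurableSpace 𝕐] {R : ResponseModel k 𝕐}
  {Ω : Type*} [mΩ : MeasurableSpace Ω] {P : Measure Ω}

lemma state_mono (W : Noise R P) (π : Transition k) (X : ℕ → Ω → Fin (k + 1)) {s t : ℕ} {ω : Ω}
    (h : s ≤ t) (hs : state W π X s ω = 1) : state W π X t ω = 1 := latent_mono h hs

lemma state_zero_of_le (W : Noise R P) (π : Transition k) (X : ℕ → Ω → Fin (k + 1)) {s t : ℕ}
    {ω : Ω} (h : s ≤ t) (ht : state W π X t ω = 0) : state W π X s ω = 0 := by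
  by_contra hc
  have := state_mono W π X h (by omega : state W π X s ω = 1)
  omega

lemma measurable_likRatio (W : Noise R P) (π : Transition k) {X : ℕ → Ω → Fin (k + 1)}
    (hX : ∀ t, Measurable[obs W π X t] (X (t + 1))) (t : ℕ) :
    Measurable[obs W π X (t + 1)] (likRatio W π X (t + 1)) := by
  have hgf : Measurable fun p : Fin (k + 1) × 𝕐 => R.g p.1 p.2 / R.f p.1 p.2 :=
    measurable_from_prod_countable_right fun p => (R.g_meas p).div (R.f_meas p)
  exact hgf.comp (((hX t).mono (obs_mono W π X (by omega)) le_rfl).prodMk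
    (measurable_response W π X t))

lemma measurable_changeWeight (W : Noise R P) (π : Transition k) {X : ℕ → Ω → Fin (k + 1)}
    (hX : ∀ t, Measurable[obs W π X t] (X (t + 1))) (s t : ℕ) :
    Measurable[obs W π X t] (changeWeight W π X s t) := by
  induction t with
  | zero =>
    have h : Measurable[obs W π X 0] (transProb π X 0) :=
      measurable_transProb π 0 fun s hs => absurd hs (by omega)
    change Measurable[obs W π X 0] fun ω => changeWeight W π X s 0 ω
    simp only [changeWeight]
    split_ifs
    · exact h.div (measurable_const.sub h)
    · exact measurable_const
  | succ t ih =>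
    have hq : Measurable[obs W π X (t + 1)] (transProb π X (t + 1)) :=
      (measurable_transProb_obs W π hX t).mono (obs_mono W π X (by omega)) le_rfl
    have ih' := ih.mono (obs_mono W π X (by omega : t ≤ t + 1)) le_rfl
    change Measurable[obs W π X (t + 1)] fun ω => changeWeight W π X s (t + 1) ω
    simp only [changeWeight]
    refine Measurable.mul (Measurable.mul ?_ (measurable_const.div (measurable_const.sub hq)))
      (measurable_likRatio W π hX t)
    split_ifs
    · exact hq
    · exact ih'

lemma measurableSet_state (W : Noise R P) (π : Transition k) {X : ℕ → Ω → Fin (k + 1)}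
    (hX : ∀ t, Measurable[obs W π X t] (X (t + 1))) (t : ℕ) (i : Fin 2) :
    MeasurableSet[W.mid t] {ω | state W π X t ω = i} :=
  measurable_state W π hX t (measurableSet_singleton i)

lemma measurableSet_changedAt (W : Noise R P) (π : Transition k) {X : ℕ → Ω → Fin (k + 1)}
    (hX : ∀ t, Measurable[obs W π X t] (X (t + 1))) (s : ℕ) :
    MeasurableSet[W.mid s] (changedAt W π X s) := by
  have : changedAt W π X s = {ω | state W π X s ω = 1} ∩
      ⋂ u : ℕ, ⋂ _ : u < s, {ω | state W π X u ω = 0} := by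
    ext ω; simp [changedAt]
  rw [this]
  refine (measurableSet_state W π hX s 1).inter
    (MeasurableSet.iInter fun u => MeasurableSet.iInter fun hu => ?_)
  exact W.mid_mono hu.le _ (measurableSet_state W π hX u 0)

lemma changedAt_succ (W : Noise R P) (π : Transition k) (X : ℕ → Ω → Fin (k + 1)) (t : ℕ) :
    changedAt W π X (t + 1) = {ω | state W π X t ω = 0} ∩
      {ω | W.U (t + 1) ω ≤ transProb π X (t + 1) ω} := by
  ext ω
  simp only [changedAt, mem_ofPred_eq, mem_inter_iff]
  have h := latent_succ_eq_zero (U := W.U) (q := transProb π X) (ω := ω) (t := t)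
  change state W π X (t + 1) ω = 0 ↔ state W π X t ω = 0 ∧ _ at h
  rw [← fin_two_ne_one] at h
  constructor
  · rintro ⟨h1, h2⟩
    refine ⟨h2 t (by omega), ?_⟩
    by_contra hc
    exact h.2 ⟨h2 t (by omega), not_le.1 hc⟩ h1
  · rintro ⟨h1, h2⟩
    refine ⟨?_, fun u hu => state_zero_of_le W π X (by omega) h1⟩
    by_contra hc
    exact absurd (h.1 hc).2 (not_lt.2 h2)

/-- The likelihood ratio, on the responses up to time `t`, of a change by time `t` against no change
by time `t`. -/
def totalWeight (W : Noise R P) (π : Transition k) (X : ℕ → Ω → Fin (k + 1)) (t : ℕ) (ω : Ω) : ℝ :=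
  ∑ s ∈ Finset.range (t + 1), changeWeight W π X s t ω

lemma totalWeight_succ (W : Noise R P) (π : Transition k) (X : ℕ → Ω → Fin (k + 1)) (t : ℕ)
    (ω : Ω) : totalWeight W π X (t + 1) ω =
      (totalWeight W π X t ω + transProb π X (t + 1) ω) / (1 - transProb π X (t + 1) ω) *
        likRatio W π X (t + 1) ω := by
  unfold totalWeight
  rw [Finset.sum_range_succ]
  have : ∀ s ∈ Finset.range (t + 1), changeWeight W π X s (t + 1) ω =
      changeWeight W π X s t ω * (1 / (1 - transProb π X (t + 1) ω)) *
        likRatio W π X (t + 1) ω := by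
    intro s hs
    rw [Finset.mem_range] at hs
    simp only [changeWeight, if_neg hs.ne]
  rw [Finset.sum_congr rfl this, ← Finset.sum_mul, ← Finset.sum_mul]
  simp only [changeWeight, if_true]
  ring

lemma state_one_eq_iUnion (W : Noise R P) (π : Transition k) (X : ℕ → Ω → Fin (k + 1)) (t : ℕ) :
    {ω | state W π X t ω = 1} = ⋃ s ∈ Finset.range (t + 1), changedAt W π X s := by
  classical
  ext ω
  simp only [mem_ofPred_eq, mem_iUnion, Finset.mem_range, changedAt, exists_prop]
  constructor
  · intro h
    have hex : ∃ s, state W π X s ω = 1 := ⟨t, h⟩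
    refine ⟨Nat.find hex, Nat.lt_succ_of_le (Nat.find_min' hex h), Nat.find_spec hex, fun u hu =>
      fin_two_ne_one.1 (Nat.find_min hex hu)⟩
  · rintro ⟨s, hs, h, _⟩
    exact state_mono W π X (by omega) h

lemma disjoint_changedAt (W : Noise R P) (π : Transition k) (X : ℕ → Ω → Fin (k + 1)) :
    Pairwise fun s t => Disjoint (changedAt W π X s) (changedAt W π X t) := by
  intro s t hst
  rw [Set.disjoint_left]
  rintro ω ⟨h1, h2⟩ ⟨h3, h4⟩
  rcases lt_or_gt_of_ne hst with h | h
  · have := h4 s h; omega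
  · have := h2 t h; omega

variable [IsProbabilityMeasure P]

/-- On the responses up to time `t`, integration over the event of a change at time `s ≤ t` is
integration over the event of no change up to time `t`, weighted by the likelihood ratio. -/
theorem setLIntegral_changedAt (W : Noise R P) (hR : R.Regular) {π : Transition k}
    (h0 : ∀ t z, 0 ≤ π t z) (h1 : ∀ t z, π t z < 1) {X : ℕ → Ω → Fin (k + 1)}
    (hX : ∀ t, Measurable[obs W π X t] (X (t + 1))) (t : ℕ) :
    ∀ s ≤ t, ∀ φ : Ω → ℝ≥0∞, Measurable[obs W π X t] φ →
      ∫⁻ ω in changedAt W π X s, φ ω ∂P = ∫⁻ ω in {ω | state W π X t ω = 0},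
        φ ω * ENNReal.ofReal (changeWeight W π X s t ω) ∂P := by
  have hq0 : ∀ t ω, 0 ≤ transProb π X t ω := fun t ω => h0 _ _
  have hq1 : ∀ t ω, transProb π X t ω < 1 := fun t ω => h1 _ _
  induction t with
  | zero =>
    intro s hs φ hφ
    obtain rfl : s = 0 := by omega
    rw [obs_zero] at hφ
    obtain ⟨c, hc⟩ : ∃ c, ∀ ω, φ ω = c := by
      obtain ⟨ω₀⟩ : Nonempty Ω := nonempty_of_isProbabilityMeasure P
      refine ⟨φ ω₀, fun ω => ?_⟩
      have h := hφ (measurableSet_singleton (φ ω₀))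
      rw [MeasurableSpace.measurableSet_bot_iff] at h
      rcases h with h | h
      · exact absurd (show ω₀ ∈ φ ⁻¹' {φ ω₀} from rfl) (by rw [h]; exact notMem_empty _)
      · have : ω ∈ φ ⁻¹' {φ ω₀} := by rw [h]; trivial
        exact this
    obtain ⟨q, hq⟩ : ∃ q, ∀ ω, transProb π X 0 ω = q :=
      ⟨π 0 finZeroElim, fun ω => congrArg (π 0) (Subsingleton.elim _ _)⟩
    obtain ⟨ω₀⟩ : Nonempty Ω := nonempty_of_isProbabilityMeasure P
    have hqq0 : 0 ≤ q := hq ω₀ ▸ hq0 0 ω₀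
    have hqq1 : q < 1 := hq ω₀ ▸ hq1 0 ω₀
    have e0 : {ω | state W π X 0 ω = 0} = W.U 0 ⁻¹' Ioi q := by
      ext ω
      exact latent_zero_eq_zero.trans (by rw [hq]; rfl)
    have e1 : changedAt W π X 0 = W.U 0 ⁻¹' Iic q := by
      have : changedAt W π X 0 = {ω | state W π X 0 ω = 0}ᶜ := by
        ext ω; simp [changedAt, ← fin_two_ne_one]
      rw [this, e0, ← preimage_compl, compl_Ioi]
    have m0 : P (W.U 0 ⁻¹' Ioi q) = ENNReal.ofReal (1 - q) := by
      rw [← Measure.map_apply (W.U_meas 0) measurableSet_Ioi, W.U_law, unif_Ioi hqq0 hqq1]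
    have m1 : P (W.U 0 ⁻¹' Iic q) = ENNReal.ofReal q := by
      rw [← Measure.map_apply (W.U_meas 0) measurableSet_Iic, W.U_law, unif_Iic hqq1]
    rw [e0, e1]
    simp only [hc, changeWeight, if_true, hq]
    rw [setLIntegral_const, setLIntegral_const, m0, m1, mul_assoc, ← ENNReal.ofReal_mul
      (div_nonneg hqq0 (by linarith)), div_mul_cancel₀]
    linarith
  | succ t ih =>
    intro s hs φ hφ
    rw [obs_succ, ← MeasurableSpace.comap_id (m := obs W π X t),
      ← MeasurableSpace.comap_prodMk] at hφ
    obtain ⟨ψ, hψ, rfl⟩ := @Measurable.exists_eq_measurable_comp Ω (Ω × 𝕐) ℝ≥0∞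
      ((obs W π X t).prod inferInstance) _ _ _ _ _ hφ
    have hcur : ∀ u ≤ t + 1, ∀ ω ∈ changedAt W π X u, response W π X (t + 1) ω =
        W.h (X (t + 1) ω) 1 (W.V (t + 1) ω) := by
      intro u hu ω hω
      unfold response
      rw [state_mono W π X hu hω.1]
    have hS : {ω | state W π X (t + 1) ω = 0} = {ω | state W π X t ω = 0} ∩
        {ω | transProb π X (t + 1) ω < W.U (t + 1) ω} := by
      ext ω
      exact latent_succ_eq_zero
    have hmS : MeasurableSet[W.before (t + 1)] {ω | state W π X t ω = 0} :=
      W.mid_le_before t _ (measurableSet_state W π hX t 0)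
    have hmD : MeasurableSet (changedAt W π X s) :=
      W.mid_le s _ (measurableSet_changedAt W π hX s)
    have hmS' : MeasurableSet {ω | state W π X (t + 1) ω = 0} :=
      W.mid_le _ _ (measurableSet_state W π hX _ 0)
    have hid : @Measurable Ω Ω (W.before (t + 1)) (obs W π X t) id :=
      measurable_id'' (obs_le_before W π hX t)
    have hqm := measurable_transProb_obs W π hX t
    set ρ : Ω → ℝ := fun ω => if s = t + 1 then transProb π X (t + 1) ω
      else changeWeight W π X s t ω with hρ
    have hρ0 : ∀ ω, 0 ≤ ρ ω := by
      intro ω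
      simp only [hρ]
      split_ifs
      · exact hq0 _ _
      · exact changeWeight_nonneg W h0 h1 X s t ω
    have hρm : Measurable[obs W π X t] ρ := by
      by_cases h : s = t + 1
      · simp only [hρ, h, if_true]; exact hqm
      · simp only [hρ, h, if_false]; exact measurable_changeWeight W π hX s t
    have hyp : ∀ φ : Ω → ℝ≥0∞, Measurable[obs W π X t] φ →
        ∫⁻ ω in changedAt W π X s, φ ω ∂P = ∫⁻ ω in {ω | state W π X t ω = 0},
          φ ω * ENNReal.ofReal (ρ ω) ∂P := by
      intro φ hφ
      by_cases h : s = t + 1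
      · subst h
        simp only [hρ, if_true]
        have hφ' : Measurable[W.before (t + 1)] φ := hφ.mono (obs_le_before W π hX t) le_rfl
        have hq' := measurable_transProb_before W π hX (t + 1)
        have hfr := setLIntegral_freeze (W.before_le (t + 1)) (W.U_meas (t + 1))
          (W.indep_U (t + 1)) (W.U_law (t + 1)) hmS (hφ'.prodMk hq')
          (F := fun p => (Iic p.1.2).indicator (fun _ => p.1.1) p.2)
          (Measurable.ite (measurableSet_le measurable_snd
            (measurable_snd.comp measurable_fst)) (measurable_fst.comp measurable_fst)
            measurable_const)
        have hr : ∀ ω, ∫⁻ v, (Iic (transProb π X (t + 1) ω)).indicator (fun _ => φ ω) v ∂unif =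
            φ ω * ENNReal.ofReal (transProb π X (t + 1) ω) := by
          intro ω
          rw [lintegral_indicator measurableSet_Iic, setLIntegral_const, unif_Iic (hq1 _ _)]
        simp only [hr] at hfr
        rw [← hfr, ← lintegral_indicator hmD, ← lintegral_indicator (W.before_le _ _ hmS),
          changedAt_succ]
        refine lintegral_congr fun ω => ?_
        by_cases hω : state W π X t ω = 0 <;>
          by_cases hu : W.U (t + 1) ω ≤ transProb π X (t + 1) ω <;> simp [indicator, hω, hu]
      · simp only [hρ, h, if_false]
        exact ih s (by omega) φ hφ
    have key := @change_step k 𝕐 _ R Ω mΩ P _ Ω (obs W π X t) W hR (t + 1) id hid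
      _ _ hmS (W.mid_mono hs _ (measurableSet_changedAt W π hX s)) (X (t + 1)) (hX t)
      (transProb π X (t + 1)) hqm (hq0 _) (hq1 _) (fun ω => ENNReal.ofReal (ρ ω))
      hρm.ennreal_ofReal hyp ψ hψ
    calc ∫⁻ ω in changedAt W π X s, (ψ ∘ fun ω => (id ω, response W π X (t + 1) ω)) ω ∂P
        = ∫⁻ ω in changedAt W π X s, ψ (id ω, W.h (X (t + 1) (id ω)) 1 (W.V (t + 1) ω)) ∂P := by
          refine setLIntegral_congr_fun hmD fun ω hω => ?_
          simp only [Function.comp, hcur s hs ω hω, id]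
      _ = _ := key
      _ = _ := by
          simp only [id]
          rw [← hS]
          refine setLIntegral_congr_fun hmS' fun ω hω => ?_
          have hY : response W π X (t + 1) ω = W.h (X (t + 1) ω) 0 (W.V (t + 1) ω) := by
            unfold response
            rw [show state W π X (t + 1) ω = 0 from hω]
          simp only [Function.comp, changeWeight, likRatio, hY]
          rw [ENNReal.ofReal_mul, ENNReal.ofReal_mul (hρ0 ω)]
          exact mul_nonneg (hρ0 ω) (one_div_nonneg.2 (by linarith [hq1 (t + 1) ω]))

lemma setLIntegral_state_one (W : Noise R P) (hR : R.Regular) {π : Transition k}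
    (h0 : ∀ t z, 0 ≤ π t z) (h1 : ∀ t z, π t z < 1) {X : ℕ → Ω → Fin (k + 1)}
    (hX : ∀ t, Measurable[obs W π X t] (X (t + 1))) (t : ℕ) {φ : Ω → ℝ≥0∞}
    (hφ : Measurable[obs W π X t] φ) :
    ∫⁻ ω in {ω | state W π X t ω = 1}, φ ω ∂P = ∫⁻ ω in {ω | state W π X t ω = 0},
        φ ω * ENNReal.ofReal (totalWeight W π X t ω) ∂P := by
  have hle := obs_le W π hX t
  rw [state_one_eq_iUnion, lintegral_biUnion_finset
    (fun s _ u _ h => disjoint_changedAt W π X h)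
    (fun s _ => W.mid_le s _ (measurableSet_changedAt W π hX s)),
    Finset.sum_congr rfl fun s hs => setLIntegral_changedAt W hR h0 h1 hX t s
      (by rw [Finset.mem_range] at hs; omega) φ hφ, ← lintegral_finsetSum]
  · refine lintegral_congr fun ω => ?_
    rw [totalWeight, ENNReal.ofReal_sum_of_nonneg fun s _ => changeWeight_nonneg W h0 h1 X s t ω,
      Finset.mul_sum]
  · exact fun s _ => (hφ.mono hle le_rfl).mul
      ((measurable_changeWeight W π hX s t).mono hle le_rfl).ennreal_ofReal

/-- The posterior odds are the likelihood ratio of a change against no change. -/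
theorem odds_ae_eq (W : Noise R P) (hR : R.Regular) {π : Transition k}
    (h0 : ∀ t z, 0 ≤ π t z) (h1 : ∀ t z, π t z < 1) {X : ℕ → Ω → Fin (k + 1)}
    (hX : ∀ t, Measurable[obs W π X t] (X (t + 1))) :
    ∀ᵐ ω ∂P, ∀ t, odds W π X t ω = totalWeight W π X t ω := by
  rw [ae_all_iff]
  intro t
  have hle := obs_le W π hX t
  have hG0 : ∀ ω, 0 ≤ totalWeight W π X t ω := fun ω =>
    Finset.sum_nonneg fun s _ => changeWeight_nonneg W h0 h1 X s t ω
  have hGm : Measurable[obs W π X t] (totalWeight W π X t) :=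
    Finset.measurable_fun_sum _ fun s _ => measurable_changeWeight W π hX s t
  have hGm' := hGm.mono hle le_rfl
  set S0 : Set Ω := {ω | state W π X t ω = 0} with hS0
  set S1 : Set Ω := {ω | state W π X t ω = 1} with hS1
  have hm0 : MeasurableSet S0 := W.mid_le t _ (measurableSet_state W π hX t 0)
  have hm1 : MeasurableSet S1 := W.mid_le t _ (measurableSet_state W π hX t 1)
  have hcompl : S1 = S0ᶜ := by
    ext ω
    simp only [hS0, hS1, mem_ofPred_eq, mem_compl_iff]
    omega
  have hset : ∀ A, MeasurableSet[obs W π X t] A →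
      P (A ∩ S1) = ∫⁻ ω in A ∩ S0, ENNReal.ofReal (totalWeight W π X t ω) ∂P := by
    intro A hA
    have h := setLIntegral_state_one W hR h0 h1 hX t (φ := A.indicator fun _ => 1)
      (measurable_const.indicator hA)
    rw [setLIntegral_indicator (hle _ hA), setLIntegral_const, one_mul] at h
    rw [h, ← setLIntegral_indicator (hle _ hA)]
    refine lintegral_congr fun ω => ?_
    by_cases hω : ω ∈ A <;> simp [hω]
  have hfin : ∫⁻ ω in S0, ENNReal.ofReal (totalWeight W π X t ω) ∂P ≠ ⊤ := by
    have := hset univ MeasurableSet.univ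
    simp only [univ_inter] at this
    rw [← this]
    exact measure_ne_top _ _
  have hI1 : Integrable (S1.indicator fun _ => (1 : ℝ)) P :=
    (integrable_const 1).indicator hm1
  have hI0 : Integrable (S0.indicator fun _ => (1 : ℝ)) P :=
    (integrable_const 1).indicator hm0
  have hIG : Integrable (totalWeight W π X t * S0.indicator fun _ => (1 : ℝ)) P := by
    have : (totalWeight W π X t * S0.indicator fun _ => (1 : ℝ)) =
        S0.indicator (totalWeight W π X t) := by
      ext ω; by_cases hω : ω ∈ S0 <;> simp [hω]
    rw [this, integrable_indicator_iff hm0]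
    refine ⟨hGm'.aestronglyMeasurable, ?_⟩
    rw [hasFiniteIntegral_iff_ofReal (ae_of_all _ hG0)]
    exact hfin.lt_top
  have hc1 : P[S1.indicator (fun _ => (1 : ℝ))|obs W π X t] =ᵐ[P]
      P[totalWeight W π X t * S0.indicator (fun _ => (1 : ℝ))|obs W π X t] := by
    refine (ae_eq_condExp_of_forall_setIntegral_eq hle hI1
      (fun _ _ _ => integrable_condExp.integrableOn) (fun A hA _ => ?_)
      stronglyMeasurable_condExp.aestronglyMeasurable).symm
    rw [setIntegral_condExp hle hIG hA, setIntegral_indicator hm1, setIntegral_const,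
      smul_eq_mul, mul_one]
    have : ∀ ω, (totalWeight W π X t * S0.indicator fun _ => (1 : ℝ)) ω =
        S0.indicator (totalWeight W π X t) ω := by
      intro ω; by_cases hω : ω ∈ S0 <;> simp [hω]
    simp only [this]
    rw [setIntegral_indicator hm0, integral_eq_lintegral_of_nonneg_ae (ae_of_all _ hG0)
      hGm'.aestronglyMeasurable, ← hset A hA]
    rfl
  have hc2 : P[totalWeight W π X t * S0.indicator (fun _ => (1 : ℝ))|obs W π X t] =ᵐ[P]
      totalWeight W π X t * P[S0.indicator (fun _ => (1 : ℝ))|obs W π X t] :=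
    condExp_mul_of_stronglyMeasurable_left hGm.stronglyMeasurable hIG hI0
  have hc3 : P[S1.indicator (fun _ => (1 : ℝ))|obs W π X t] +
      P[S0.indicator (fun _ => (1 : ℝ))|obs W π X t] =ᵐ[P] fun _ => 1 := by
    refine (condExp_add hI1 hI0 _).symm.trans ?_
    have : (S1.indicator (fun _ => (1 : ℝ)) + S0.indicator fun _ => (1 : ℝ)) = fun _ => 1 := by
      ext ω
      rw [hcompl]
      by_cases hω : ω ∈ S0 <;> simp [hω]
    rw [this, condExp_const hle]
  filter_upwards [hc1, hc2, hc3] with ω e1 e2 e3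
  simp only [Pi.add_apply, Pi.mul_apply] at e2 e3
  unfold odds
  change (P[S1.indicator (fun _ => (1 : ℝ))|obs W π X t]) ω /
    (P[S0.indicator (fun _ => (1 : ℝ))|obs W π X t]) ω = _
  rw [e1, e2] at e3 ⊢
  refine mul_div_cancel_right₀ _ fun hz => ?_
  rw [hz] at e3
  simp at e3

end Posterior

/-! ### The stages as a recursion in time -/

section Machine

open Classical in
/-- The stages along a path of posterior odds and a path of likelihood ratios, computed step by
step: whether the stage in progress after time `t` is an assessment stage, and the product of the
likelihood ratios in this stage.  (The product is kept at the last time of an assessment stage, and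
is `1` elsewhere in training stages.) -/
def stagePath (Γ r : ℕ → ℝ) (b₁ bK d : ℝ) : ℕ → Bool × ℝ
  | 0 => (false, 1)
  | t + 1 =>
    (if (stagePath Γ r b₁ bK d t).1 then
        decide (Γ (t + 1) < bK ∧ (stagePath Γ r b₁ bK d t).2 * r (t + 1) < d)
      else decide (b₁ ≤ Γ (t + 1)),
      if (stagePath Γ r b₁ bK d t).1 then (stagePath Γ r b₁ bK d t).2 * r (t + 1) else 1)

variable {Γ r : ℕ → ℝ} {b₁ bK d : ℝ}

lemma lt_sInf_nat_iff (p : ℕ → Prop) (i : ℕ) :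
    (i : ℕ∞) < sInf {s : ℕ∞ | ∃ j : ℕ, s = j ∧ p j} ↔ ∀ j ≤ i, ¬ p j := by
  rw [← not_le, sInf_le_nat_iff]
  push Not
  rfl

lemma lt_detect_iff {b : ℝ} {t j : ℕ} :
    (j : ℕ∞) < detect Γ b t ↔ ∀ i, 1 ≤ i → i ≤ j → Γ (t + i) < b := by
  unfold detect
  rw [lt_sInf_nat_iff (fun j => 1 ≤ j ∧ b ≤ Γ (t + j))]
  refine forall_congr' fun i => ?_
  rw [not_and, not_le]
  tauto

lemma lt_sprt_iff {t j : ℕ} :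
    (j : ℕ∞) < sprt r d t ↔ ∀ i, 1 ≤ i → i ≤ j → ∏ l ∈ Finset.Icc 1 i, r (t + l) < d := by
  unfold sprt
  rw [lt_sInf_nat_iff (fun j => 1 ≤ j ∧ d ≤ ∏ l ∈ Finset.Icc 1 j, r (t + l))]
  refine forall_congr' fun i => ?_
  rw [not_and, not_le]
  tauto

lemma detect_pos (b : ℝ) (t : ℕ) : 0 < detect Γ b t := by
  have := (lt_detect_iff (Γ := Γ) (b := b) (t := t) (j := 0)).2 (fun i h1 h2 => by omega)
  exact_mod_cast this

lemma nat_add_lt_iff {s : ℕ} {a b : ℕ∞} : (s : ℕ∞) + a < s + b ↔ a < b :=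
  WithTop.add_lt_add_iff_left (ENat.natCast_ne_top s)

lemma stageEnd_mono : Monotone (stageEnd Γ r b₁ bK d) :=
  monotone_nat_of_le_succ fun n => by rw [stageEnd]; exact le_self_add

lemma lt_stageEnd_even {n s t : ℕ} (hn : Even n) (hs : stageEnd Γ r b₁ bK d n = s) (hst : s ≤ t) :
    (t : ℕ∞) < stageEnd Γ r b₁ bK d (n + 1) ↔ ∀ i, s < i → i ≤ t → Γ i < b₁ := by
  obtain ⟨j, rfl⟩ := Nat.exists_eq_add_of_le hst
  rw [stageEnd, hs, if_pos hn, ENat.toNat_natCast, Nat.cast_add,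
    nat_add_lt_iff, lt_detect_iff]
  constructor
  · intro h i h1 h2
    have := h (i - s) (by omega) (by omega)
    rwa [Nat.add_sub_cancel' h1.le] at this
  · intro h i h1 h2
    exact h _ (by omega) (by omega)

lemma lt_stageEnd_odd {n s t : ℕ} (hn : ¬ Even n) (hs : stageEnd Γ r b₁ bK d n = s)
    (hst : s ≤ t) :
    (t : ℕ∞) < stageEnd Γ r b₁ bK d (n + 1) ↔ ∀ i, s < i → i ≤ t →
      Γ i < bK ∧ ∏ l ∈ Finset.Icc 1 (i - s), r (s + l) < d := by
  obtain ⟨j, rfl⟩ := Nat.exists_eq_add_of_le hst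
  rw [stageEnd, hs, if_neg hn, ENat.toNat_natCast, Nat.cast_add,
    nat_add_lt_iff, lt_min_iff, lt_detect_iff, lt_sprt_iff,
    ← forall_and]
  constructor
  · intro h i h1 h2
    have := h (i - s)
    rw [Nat.add_sub_cancel' h1.le] at this
    exact ⟨this.1 (by omega) (by omega), this.2 (by omega) (by omega)⟩
  · intro h i
    refine ⟨fun h1 h2 => (h (s + i) (by omega) (by omega)).1, fun h1 h2 => ?_⟩
    have := (h (s + i) (by omega) (by omega)).2
    rwa [Nat.add_sub_cancel_left] at this

lemma lt_stageEnd_succ {n s : ℕ} (hs : stageEnd Γ r b₁ bK d n = s) :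
    (s : ℕ∞) < stageEnd Γ r b₁ bK d (n + 1) := by
  by_cases hn : Even n
  · exact (lt_stageEnd_even hn hs le_rfl).2 fun i h1 h2 => by omega
  · exact (lt_stageEnd_odd hn hs le_rfl).2 fun i h1 h2 => by omega

/-- The recursion in time describes the stage in progress after time `t`. -/
lemma stagePath_spec (Γ r : ℕ → ℝ) (b₁ bK d : ℝ) (t : ℕ) :
    ∃ n s : ℕ, stageEnd Γ r b₁ bK d n = s ∧ s ≤ t ∧ (t : ℕ∞) < stageEnd Γ r b₁ bK d (n + 1) ∧
      ((stagePath Γ r b₁ bK d t).1 = true ↔ ¬ Even n) ∧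
      ((stagePath Γ r b₁ bK d t).1 = true →
        (stagePath Γ r b₁ bK d t).2 = ∏ i ∈ Finset.Icc 1 (t - s), r (s + i)) := by
  induction t with
  | zero =>
    have h0 : stageEnd Γ r b₁ bK d 0 = (0 : ℕ) := by simp [stageEnd]
    exact ⟨0, 0, h0, le_rfl, lt_stageEnd_succ h0, by simp [stagePath], by simp [stagePath]⟩
  | succ t ih =>
    obtain ⟨n, s, hs, hst, hlt, hpar, hprod⟩ := ih
    -- either the stage goes on, or the next one begins at time `t + 1`
    have hcase : (t + 1 : ℕ) < stageEnd Γ r b₁ bK d (n + 1) ∨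
        stageEnd Γ r b₁ bK d (n + 1) = (t + 1 : ℕ) := by
      rcases lt_or_ge ((t + 1 : ℕ) : ℕ∞) (stageEnd Γ r b₁ bK d (n + 1)) with h | h
      · exact Or.inl h
      · refine Or.inr (le_antisymm h ?_)
        have := Order.add_one_le_of_lt hlt
        exact_mod_cast this
    by_cases hn : Even n
    · have hf : (stagePath Γ r b₁ bK d t).1 = false := by
        simpa using (not_congr hpar).2 (not_not.2 hn)
      have hiff : (t + 1 : ℕ) < stageEnd Γ r b₁ bK d (n + 1) ↔ Γ (t + 1) < b₁ := by
        rw [lt_stageEnd_even hn hs (by omega)]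
        rw [lt_stageEnd_even hn hs hst] at hlt
        refine ⟨fun h => h _ (by omega) le_rfl, fun h i h1 h2 => ?_⟩
        rcases Nat.lt_or_ge i (t + 1) with h3 | h3
        · exact hlt i h1 (by omega)
        · obtain rfl : i = t + 1 := by omega
          exact h
      rcases hcase with h | h
      · refine ⟨n, s, hs, by omega, h, ?_, ?_⟩
        · simp [stagePath, hf, hn, hiff.1 h]
        · simp [stagePath, hf, hiff.1 h]
      · have hb : b₁ ≤ Γ (t + 1) := by
          rw [h, lt_self_iff_false, false_iff, not_lt] at hiff
          exact hiff
        refine ⟨n + 1, t + 1, h, le_rfl, lt_stageEnd_succ h, ?_, ?_⟩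
        · simp [stagePath, hf, hb, Nat.even_add_one, hn]
        · simp [stagePath, hf]
    · have hf : (stagePath Γ r b₁ bK d t).1 = true := hpar.2 hn
      have hP : (stagePath Γ r b₁ bK d t).2 * r (t + 1) =
          ∏ i ∈ Finset.Icc 1 (t + 1 - s), r (s + i) := by
        rw [Nat.succ_sub hst, Finset.prod_Icc_succ_top (by omega), ← hprod hf,
          show s + (t - s).succ = t + 1 by omega]
      have hiff : (t + 1 : ℕ) < stageEnd Γ r b₁ bK d (n + 1) ↔
          Γ (t + 1) < bK ∧ (stagePath Γ r b₁ bK d t).2 * r (t + 1) < d := by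
        rw [hP, lt_stageEnd_odd hn hs (by omega)]
        rw [lt_stageEnd_odd hn hs hst] at hlt
        refine ⟨fun h => h _ (by omega) le_rfl, fun h i h1 h2 => ?_⟩
        rcases Nat.lt_or_ge i (t + 1) with h3 | h3
        · exact hlt i h1 (by omega)
        · obtain rfl : i = t + 1 := by omega
          exact h
      rcases hcase with h | h
      · refine ⟨n, s, hs, by omega, h, ?_, fun _ => ?_⟩
        · simp [stagePath, hf, hn, hiff.1 h]
        · rw [← hP]; simp [stagePath, hf]
      · have hb : ¬ (Γ (t + 1) < bK ∧ (stagePath Γ r b₁ bK d t).2 * r (t + 1) < d) := by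
          rw [h, lt_self_iff_false, false_iff] at hiff
          exact hiff
        have hf' : (stagePath Γ r b₁ bK d (t + 1)).1 = false := by
          simp only [stagePath, hf, if_true, hb, decide_false]
        refine ⟨n + 1, t + 1, h, le_rfl, lt_stageEnd_succ h, ?_, ?_⟩
        · rw [hf', Nat.even_add_one]; simp [hn]
        · rw [hf']; simp

lemma stage_unique {n n' t : ℕ} (h1 : stageEnd Γ r b₁ bK d n ≤ t)
    (h2 : (t : ℕ∞) < stageEnd Γ r b₁ bK d (n + 1)) (h1' : stageEnd Γ r b₁ bK d n' ≤ t)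
    (h2' : (t : ℕ∞) < stageEnd Γ r b₁ bK d (n' + 1)) : n = n' := by
  by_contra hne
  rcases lt_or_gt_of_ne hne with h | h
  · exact absurd ((stageEnd_mono (show n + 1 ≤ n' by omega)).trans h1') (not_le.2 h2)
  · exact absurd ((stageEnd_mono (show n' + 1 ≤ n by omega)).trans h1) (not_le.2 h2')

/-- The first treatment is prescribed at time `t + 1` exactly if the stage in progress after
time `t` is a training stage. -/
lemma stageTreatment_succ (k : ℕ) (Γ r : ℕ → ℝ) (b₁ bK d : ℝ) (t : ℕ) :
    stageTreatment k Γ r b₁ bK d (t + 1) =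
      if (stagePath Γ r b₁ bK d t).1 = true then Fin.last k else 0 := by
  obtain ⟨n, s, hs, hst, hlt, hpar, -⟩ := stagePath_spec Γ r b₁ bK d t
  have hlt' : ∀ a : ℕ∞, a < ((t + 1 : ℕ) : ℕ∞) ↔ a ≤ (t : ℕ) := by
    intro a
    rw [Nat.cast_add, Nat.cast_one]
    exact ENat.lt_add_one_iff (ENat.natCast_ne_top t)
  have hle' : ∀ a : ℕ∞, ((t + 1 : ℕ) : ℕ∞) ≤ a ↔ (t : ℕ∞) < a := by
    intro a
    rw [← not_lt, hlt', not_le]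
  have hs' : stageEnd Γ r b₁ bK d n ≤ t := by rw [hs]; exact_mod_cast hst
  unfold stageTreatment
  have e : (∃ m : ℕ, 1 ≤ m ∧ stageEnd Γ r b₁ bK d (2 * m - 2) < ((t + 1 : ℕ) : ℕ∞) ∧
      ((t + 1 : ℕ) : ℕ∞) ≤ stageEnd Γ r b₁ bK d (2 * m - 1)) ↔ Even n := by
    simp only [hlt', hle']
    constructor
    · rintro ⟨m, hm, h1, h2⟩
      rw [show 2 * m - 1 = 2 * m - 2 + 1 by omega] at h2
      rw [← stage_unique h1 h2 hs' hlt]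
      exact ⟨m - 1, by omega⟩
    · rintro ⟨m, rfl⟩
      refine ⟨m + 1, by omega, ?_, ?_⟩
      · rwa [show 2 * (m + 1) - 2 = m + m by omega]
      · rwa [show 2 * (m + 1) - 1 = m + m + 1 by omega]
  by_cases hn : Even n
  · rw [if_pos (e.2 hn), if_neg (fun h => hpar.1 h hn)]
  · rw [if_neg (fun h => hn (e.1 h)), if_pos (hpar.2 hn)]

/-- The proposed stopping time is the first time in an assessment stage at which the posterior odds
reach the upper threshold. -/
lemma lt_stopTime_iff (Γ r : ℕ → ℝ) (b₁ bK d : ℝ) (t : ℕ) :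
    (t : ℕ∞) < stopTime Γ r b₁ bK d ↔
      ∀ s < t, ¬ ((stagePath Γ r b₁ bK d s).1 = true ∧ bK ≤ Γ (s + 1)) := by
  have hcyc : ∀ i : ℕ, cycles Γ r b₁ bK d ≤ (i : ℕ) ↔ ∃ m ≤ i, 1 ≤ m ∧
      detect Γ bK (stageEnd Γ r b₁ bK d (2 * m - 1)).toNat ≤
      sprt r d (stageEnd Γ r b₁ bK d (2 * m - 1)).toNat := fun i => by
    unfold cycles
    rw [sInf_le_nat_iff (fun m => 1 ≤ m ∧ detect Γ bK (stageEnd Γ r b₁ bK d (2 * m - 1)).toNat ≤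
      sprt r d (stageEnd Γ r b₁ bK d (2 * m - 1)).toNat)]
  -- a detection in an assessment stage ends the last cycle
  have hdet : ∀ s, (stagePath Γ r b₁ bK d s).1 = true → bK ≤ Γ (s + 1) →
      ∃ m : ℕ, cycles Γ r b₁ bK d ≤ (m : ℕ) ∧ stageEnd Γ r b₁ bK d (2 * m) ≤ (s + 1 : ℕ) := by
    intro s hs hb
    obtain ⟨n, u, hu, hus, hlt, hpar, -⟩ := stagePath_spec Γ r b₁ bK d s
    have hn := hpar.1 hs
    obtain ⟨m, hm⟩ := Nat.not_even_iff_odd.1 hn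
    have hend : ¬ ((s + 1 : ℕ) < stageEnd Γ r b₁ bK d (n + 1)) := by
      rw [lt_stageEnd_odd hn hu (by omega)]
      intro h
      exact absurd (h (s + 1) (by omega) le_rfl).1 (not_lt.2 hb)
    refine ⟨m + 1, (hcyc _).2 ⟨m + 1, le_rfl, by omega, ?_⟩, ?_⟩
    · rw [show 2 * (m + 1) - 1 = n by omega, hu, ENat.toNat_natCast]
      have h1 : ((s - u : ℕ) : ℕ∞) < sprt r d u := by
        rw [lt_stageEnd_odd hn hu hus] at hlt
        rw [lt_sprt_iff]
        intro i h1 h2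
        have := (hlt (u + i) (by omega) (by omega)).2
        rwa [Nat.add_sub_cancel_left] at this
      have h2 : detect Γ bK u ≤ ((s - u + 1 : ℕ) : ℕ∞) := by
        rw [← not_lt, lt_detect_iff]
        intro h
        have := h (s - u + 1) (by omega) le_rfl
        rw [show u + (s - u + 1) = s + 1 by omega] at this
        exact absurd this (not_lt.2 hb)
      refine h2.trans ?_
      have := Order.add_one_le_of_lt h1
      exact_mod_cast this
    · rw [show 2 * (m + 1) = n + 1 by omega]
      exact not_lt.1 hend
  unfold stopTime
  split_ifs with htop
  · simp only [ENat.natCast_lt_top, true_iff]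
    rintro s - ⟨h1, h2⟩
    obtain ⟨m, hm, -⟩ := hdet s h1 h2
    rw [htop] at hm
    exact absurd hm (by simp)
  · obtain ⟨m, hm⟩ := ENat.ne_top_iff_exists.1 htop
    rw [← hm, ENat.toNat_natCast]
    constructor
    · rintro hlt s hs ⟨h1, h2⟩
      obtain ⟨m', hm', he⟩ := hdet s h1 h2
      rw [← hm] at hm'
      have hmm : m ≤ m' := by exact_mod_cast hm'
      have h3 := hlt.trans_le ((stageEnd_mono (show 2 * m ≤ 2 * m' by omega)).trans he)
      have : t < s + 1 := by exact_mod_cast h3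
      omega
    · intro h
      by_contra hc
      rw [not_lt] at hc
      obtain ⟨m', hm', hm1, hds⟩ := (hcyc m).1 hm.ge
      obtain rfl : m' = m := by
        have : cycles Γ r b₁ bK d ≤ (m' : ℕ) := (hcyc m').2 ⟨m', le_rfl, hm1, hds⟩
        rw [← hm] at this
        have : m ≤ m' := by exact_mod_cast this
        omega
      obtain ⟨n, hn⟩ : ∃ n, n + 1 = 2 * m' := ⟨2 * m' - 1, by omega⟩
      have hodd : ¬ Even n := by
        rw [Nat.not_even_iff_odd]
        exact ⟨m' - 1, by omega⟩
      rw [← hn] at hc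
      rw [show 2 * m' - 1 = n by omega] at hds
      obtain ⟨u, hu⟩ := ENat.ne_top_iff_exists.1
        (ne_top_of_le_ne_top (ENat.natCast_ne_top t) ((stageEnd_mono (Nat.le_succ n)).trans hc))
      rw [← hu, ENat.toNat_natCast] at hds
      have hc' := hc
      rw [stageEnd, ← hu, if_neg hodd, ENat.toNat_natCast, min_eq_left hds] at hc'
      obtain ⟨j, hj⟩ := ENat.ne_top_iff_exists.1
        (ne_top_of_le_ne_top (ENat.natCast_ne_top t) (le_add_self.trans hc'))
      have hj1 : 1 ≤ j := by
        have := detect_pos (Γ := Γ) bK u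
        rw [← hj] at this
        exact_mod_cast this
      rw [← hj] at hc'
      have hujt : u + j ≤ t := by exact_mod_cast hc'
      have hlt : ((u + j - 1 : ℕ) : ℕ∞) < stageEnd Γ r b₁ bK d (n + 1) := by
        rw [stageEnd, ← hu, if_neg hodd, ENat.toNat_natCast, min_eq_left hds, ← hj]
        exact_mod_cast (by omega : u + j - 1 < u + j)
      have hge : stageEnd Γ r b₁ bK d n ≤ ((u + j - 1 : ℕ) : ℕ∞) := by
        rw [← hu]
        exact_mod_cast (by omega : u ≤ u + j - 1)
      obtain ⟨n', s', hs', hst', hlt', hpar', -⟩ := stagePath_spec Γ r b₁ bK d (u + j - 1)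
      obtain rfl := stage_unique hge hlt (by rw [hs']; exact_mod_cast hst') hlt'
      refine h (u + j - 1) (by omega) ⟨hpar'.2 hodd, ?_⟩
      rw [show u + j - 1 + 1 = u + j by omega]
      by_contra hb
      have : ((j : ℕ) : ℕ∞) < detect Γ bK u := by
        rw [lt_detect_iff]
        intro i h1 h2
        rcases Nat.lt_or_ge i j with h3 | h3
        · have h4 : ((i : ℕ) : ℕ∞) < detect Γ bK u := by rw [← hj]; exact_mod_cast h3
          exact lt_detect_iff.1 h4 i h1 le_rfl
        · obtain rfl : i = j := by omega
          exact not_le.1 hb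
      rw [hj] at this
      exact lt_irrefl _ this

lemma measurable_stagePath {Ω : Type*} {m : MeasurableSpace Ω} {Γ r : ℕ → Ω → ℝ} (b₁ bK d : ℝ)
    (t : ℕ) (hΓ : ∀ s < t, Measurable[m] (Γ (s + 1))) (hr : ∀ s < t, Measurable[m] (r (s + 1))) :
    Measurable[m] fun ω => stagePath (fun s => Γ s ω) (fun s => r s ω) b₁ bK d t := by
  induction t with
  | zero => simp only [stagePath]; exact measurable_const
  | succ t ih =>
    have ih' := ih (fun s hs => hΓ s (by omega)) (fun s hs => hr s (by omega))
    have h1 := hΓ t (by omega)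
    have h2 := ih'.snd.mul (hr t (by omega))
    have hA : MeasurableSet[m] {ω | (stagePath (fun s => Γ s ω) (fun s => r s ω) b₁ bK d t).1
        = true} := ih'.fst (measurableSet_singleton true)
    simp only [stagePath]
    refine Measurable.prodMk ?_ (Measurable.ite hA h2 measurable_const)
    refine Measurable.ite hA ?_ ?_
    · refine measurable_to_bool ?_
      have : MeasurableSet[m] ({ω | Γ (t + 1) ω < bK} ∩ {ω |
          (stagePath (fun s => Γ s ω) (fun s => r s ω) b₁ bK d t).2 * r (t + 1) ω < d}) :=
        (measurableSet_lt h1 measurable_const).inter (measurableSet_lt h2 measurable_const)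
      convert this using 1
      ext ω
      simp
    · refine measurable_to_bool ?_
      have : MeasurableSet[m] {ω | b₁ ≤ Γ (t + 1) ω} := measurableSet_le measurable_const h1
      convert this using 1
      ext ω
      simp

end Machine

/-! ### The proposed procedure is admissible -/

section Proposed

variable {k : ℕ} {𝕐 : Type*} [MeasurableSpace 𝕐] {R : ResponseModel k 𝕐}
  {Ω : Type*} [mΩ : MeasurableSpace Ω] {P : Measure Ω}

lemma measurable_odds (W : Noise R P) (π : Transition k) (X : ℕ → Ω → Fin (k + 1)) (t : ℕ) :
    Measurable[obs W π X t] (odds W π X t) :=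
  stronglyMeasurable_condExp.measurable.div stronglyMeasurable_condExp.measurable

lemma measurable_ratioK (W : Noise R P) (π : Transition k) (X : ℕ → Ω → Fin (k + 1)) (t : ℕ) :
    Measurable[obs W π X (t + 1)] (ratioK W π X (t + 1)) :=
  ((R.f_meas _).div (R.g_meas _)).comp (measurable_response W π X t)

/-- The stage in progress after time `t` in the proposed procedure, and the product of the
likelihood ratios in this stage. -/
def stageAt (W : Noise R P) (π : Transition k) (b₁ bK d : ℝ) (t : ℕ) (ω : Ω) : Bool × ℝ :=
  stagePath (fun s => odds W π (proposedRule W π b₁ bK d) s ω)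
    (fun s => ratioK W π (proposedRule W π b₁ bK d) s ω) b₁ bK d t

variable (W : Noise R P) (π : Transition k) (b₁ bK d : ℝ)

lemma measurable_stageAt (t : ℕ) :
    Measurable[obs W π (proposedRule W π b₁ bK d) t] (stageAt W π b₁ bK d t) :=
  measurable_stagePath b₁ bK d t
    (fun s hs => (measurable_odds W π _ (s + 1)).mono (obs_mono W π _ hs) le_rfl)
    (fun s hs => (measurable_ratioK W π _ s).mono (obs_mono W π _ hs) le_rfl)

lemma proposedRule_succ (t : ℕ) (ω : Ω) :
    proposedRule W π b₁ bK d (t + 1) ω =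
      if (stageAt W π b₁ bK d t ω).1 = true then Fin.last k else 0 := by
  conv_lhs => rw [← prescribed_proposedRule]
  exact stageTreatment_succ k _ _ b₁ bK d t

lemma measurable_proposedRule (t : ℕ) :
    Measurable[obs W π (proposedRule W π b₁ bK d) t] (proposedRule W π b₁ bK d (t + 1)) := by
  have : proposedRule W π b₁ bK d (t + 1) = fun ω =>
      if (stageAt W π b₁ bK d t ω).1 = true then Fin.last k else 0 :=
    funext (proposedRule_succ W π b₁ bK d t)
  rw [this]
  exact Measurable.ite ((measurable_stageAt W π b₁ bK d t).fst (measurableSet_singleton true))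
    measurable_const measurable_const

/-- The event that the proposed procedure has not stopped by time `t`. -/
def alive (t : ℕ) : Set Ω := {ω | (t : ℕ∞) < proposedTime W π b₁ bK d ω}

lemma mem_alive_iff {t : ℕ} {ω : Ω} : ω ∈ alive W π b₁ bK d t ↔
    ∀ s < t, ¬ ((stageAt W π b₁ bK d s ω).1 = true ∧
      bK ≤ odds W π (proposedRule W π b₁ bK d) (s + 1) ω) :=
  lt_stopTime_iff _ _ b₁ bK d t

lemma measurableSet_alive (t : ℕ) :
    MeasurableSet[obs W π (proposedRule W π b₁ bK d) t] (alive W π b₁ bK d t) := by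
  have : alive W π b₁ bK d t = ⋂ s : ℕ, ⋂ _ : s < t, ({ω | (stageAt W π b₁ bK d s ω).1 = true} ∩
      {ω | bK ≤ odds W π (proposedRule W π b₁ bK d) (s + 1) ω})ᶜ := by
    ext ω
    rw [mem_alive_iff]
    simp
  rw [this]
  refine MeasurableSet.iInter fun s => MeasurableSet.iInter fun hs => MeasurableSet.compl ?_
  refine MeasurableSet.inter ?_ ?_
  · exact obs_mono W π _ hs.le _ ((measurable_stageAt W π b₁ bK d s).fst
      (measurableSet_singleton true))
  · exact obs_mono W π _ (Nat.succ_le_of_lt hs) _ (measurableSet_le measurable_const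
      (measurable_odds W π _ (s + 1)))

lemma eq_nat_iff_lt {a : ℕ∞} {t : ℕ} :
    a = (t + 1 : ℕ) ↔ (t : ℕ∞) < a ∧ ¬ ((t + 1 : ℕ) : ℕ∞) < a := by
  induction a with
  | top => exact iff_of_false (ENat.natCast_ne_top _).symm fun h => h.2 (ENat.natCast_lt_top _)
  | coe n =>
    simp only [Nat.cast_inj, Nat.cast_lt]
    omega

lemma measurableSet_proposedTime_eq (t : ℕ) :
    MeasurableSet[obs W π (proposedRule W π b₁ bK d) t]
      {ω | proposedTime W π b₁ bK d ω = t} := by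
  rcases t with _ | t
  · have : {ω | proposedTime W π b₁ bK d ω = (0 : ℕ)} = (alive W π b₁ bK d 0)ᶜ := by
      ext ω; simp [alive]
    rw [this]
    exact (measurableSet_alive W π b₁ bK d 0).compl
  · have : {ω | proposedTime W π b₁ bK d ω = (t + 1 : ℕ)} =
        alive W π b₁ bK d t \ alive W π b₁ bK d (t + 1) := by
      ext ω; exact eq_nat_iff_lt
    rw [this]
    exact (obs_mono W π _ (Nat.le_succ t) _ (measurableSet_alive W π b₁ bK d t)).diff
      (measurableSet_alive W π b₁ bK d (t + 1))

end Proposed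

/-! ### Runs of consecutive steps -/

section Runs

variable {Ω : Type*}

/-- The event that step `t` starts a run of consecutive steps of type `Q`. -/
def runStart (Q : ℕ → Set Ω) : ℕ → Set Ω
  | 0 => Q 0
  | t + 1 => Q (t + 1) \ Q t

/-- The indicator function of an event, with real values. -/
abbrev ind (A : Set Ω) : Ω → ℝ := A.indicator fun _ => 1

lemma ind_nonneg (A : Set Ω) (ω : Ω) : 0 ≤ ind A ω :=
  indicator_nonneg (fun _ _ => zero_le_one) ω

lemma ind_le_one (A : Set Ω) (ω : Ω) : ind A ω ≤ 1 := by
  by_cases h : ω ∈ A <;> simp [h]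

lemma ind_mono {A B : Set Ω} {ω : Ω} (h : ω ∈ A → ω ∈ B) : ind A ω ≤ ind B ω := by
  by_cases hA : ω ∈ A
  · simp [hA, h hA]
  · simpa [hA] using ind_nonneg B ω

/-- If the increments are at most `B`, and along each run they are dominated by the increments of a
quantity that starts at `0` and is at most `c` until the last step of the run, then they add up to
at most `c + B` in each run. -/
lemma sum_run_le {Q : ℕ → Set Ω} {ω : Ω} {inc ℓ : ℕ → ℝ} {c B : ℝ} (hc : 0 ≤ c) (hB : 0 ≤ B)
    (hinc : ∀ t, inc t ≤ B) (hnew : ∀ t, ω ∈ runStart Q t → inc t ≤ ℓ (t + 1))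
    (hcont : ∀ t, ω ∈ Q t → ω ∈ Q (t + 1) → ℓ (t + 1) ≤ c ∧ ℓ (t + 1) + inc (t + 1) ≤ ℓ (t + 2))
    (n : ℕ) :
    ∑ t ∈ Finset.range n, ind (Q t) ω * inc t ≤
      (c + B) * ∑ t ∈ Finset.range n, ind (runStart Q t) ω := by
  have key : ∀ n, ∑ t ∈ Finset.range n, ind (Q t) ω * inc t ≤
      (c + B) * ∑ t ∈ Finset.range n, ind (runStart Q t) ω ∧
      ∀ m, n = m + 1 → ω ∈ Q m → ∑ t ∈ Finset.range n, ind (Q t) ω * inc t ≤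
      (c + B) * (∑ t ∈ Finset.range n, ind (runStart Q t) ω - 1) + ℓ n := by
    intro n
    induction n with
    | zero => simp
    | succ n ih =>
      obtain ⟨ih1, ih2⟩ := ih
      rw [Finset.sum_range_succ, Finset.sum_range_succ]
      by_cases hQ : ω ∈ Q n
      · have e1 : ind (Q n) ω = 1 := by simp [hQ]
        rw [e1, one_mul]
        by_cases hN : ω ∈ runStart Q n
        · have e2 : ind (runStart Q n) ω = 1 := by simp [hN]
          rw [e2]
          have h1 := hinc n
          have h2 := hnew n hN
          refine ⟨by linarith, fun m hm _ => ?_⟩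
          linarith
        · have e2 : ind (runStart Q n) ω = 0 := by simp [hN]
          rw [e2]
          rcases n with _ | n
          · exact absurd hQ hN
          · have hQ' : ω ∈ Q n := by
              by_contra h
              exact hN ⟨hQ, h⟩
            have h1 := hinc (n + 1)
            have h2 := hcont n hQ' hQ
            have h3 := ih2 n rfl hQ'
            refine ⟨by linarith [h2.1], fun m hm _ => by linarith [h2.2]⟩
      · have e1 : ind (Q n) ω = 0 := by simp [hQ]
        have h0 := ind_nonneg (runStart Q n) ω
        rw [e1, zero_mul, add_zero]
        refine ⟨ih1.trans (mul_le_mul_of_nonneg_left (by linarith) (by linarith)),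
          fun m hm h => ?_⟩
        obtain rfl : n = m := by omega
        exact absurd h hQ
  exact (key n).1

lemma sum_ind_le_of_subset {A B : ℕ → Set Ω} {ω : Ω} (h : ∀ t, ω ∈ A t → ω ∈ B t) (n : ℕ) :
    ∑ t ∈ Finset.range n, ind (A t) ω ≤ ∑ t ∈ Finset.range n, ind (B t) ω :=
  Finset.sum_le_sum fun t _ => ind_mono (h t)

lemma sum_drop_le (Q : ℕ → Set Ω) (ω : Ω) (n : ℕ) :
    ∑ t ∈ Finset.range n, ind (Q t \ Q (t + 1)) ω ≤
      ∑ t ∈ Finset.range n, ind (runStart Q t) ω := by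
  have key : ∀ n, ∑ t ∈ Finset.range n, ind (Q t \ Q (t + 1)) ω + ind (Q n) ω ≤
      ∑ t ∈ Finset.range n, ind (runStart Q t) ω + ind (runStart Q n) ω := by
    intro n
    induction n with
    | zero => simp [runStart]
    | succ n ih =>
      rw [Finset.sum_range_succ, Finset.sum_range_succ]
      by_cases h1 : ω ∈ Q n <;> by_cases h2 : ω ∈ Q (n + 1) <;>
        simp [runStart, h1, h2] at ih ⊢ <;> linarith
  have h := key n
  have h' : ind (runStart Q n) ω ≤ ind (Q n) ω := ind_mono fun h => by
    rcases n with _ | n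
    · exact h
    · exact h.1
  linarith

end Runs

/-! ### Types of steps of the proposed procedure -/

section Steps

variable {k : ℕ} {𝕐 : Type*} [MeasurableSpace 𝕐] {R : ResponseModel k 𝕐}
  {Ω : Type*} [mΩ : MeasurableSpace Ω] {P : Measure Ω}
  (W : Noise R P) (π : Transition k) (b₁ bK d : ℝ)

/-- The event that the latent state of the proposed procedure at time `t` is `i`. -/
def inState (i : Fin 2) (t : ℕ) : Set Ω := {ω | state W π (proposedRule W π b₁ bK d) t ω = i}

/-- The event that step `t + 1` belongs to an assessment stage. -/
def assess (t : ℕ) : Set Ω := {ω | (stageAt W π b₁ bK d t ω).1 = true}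

/-- The event that step `t + 1` belongs to the first training stage. -/
def firstStage (t : ℕ) : Set Ω := {ω | ∀ s ≤ t, ω ∉ assess W π b₁ bK d s}

/-- In assessment stages, the event that the change had occurred when the stage in progress after
time `t` began. -/
def late : ℕ → Set Ω
  | 0 => ∅
  | t + 1 => (assess W π b₁ bK d t ∩ late t) ∪
      ((assess W π b₁ bK d t)ᶜ ∩ inState W π b₁ bK d 1 (t + 1))

/-- The event that the first training stage ends at time `t + 1`. -/
def firstEnd (t : ℕ) : Set Ω :=
  firstStage W π b₁ bK d t ∩ {ω | b₁ ≤ odds W π (proposedRule W π b₁ bK d) (t + 1) ω}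

/-- The event that the first training stage ends at time `t + 1`, before the change. -/
def earlyEnd (t : ℕ) : Set Ω := firstEnd W π b₁ bK d t ∩ inState W π b₁ bK d 0 (t + 1)

/-- The event that the change occurs at step `t + 1`, after the first training stage. -/
def laterChange (t : ℕ) : Set Ω :=
  (firstStage W π b₁ bK d t)ᶜ ∩ (inState W π b₁ bK d 0 t ∩ inState W π b₁ bK d 1 (t + 1))

/-- The event that at step `t + 1` an assessment stage ends, in which the change has occurred. -/
def changedStageEnd (t : ℕ) : Set Ω :=
  (assess W π b₁ bK d t ∩ (late W π b₁ bK d t)ᶜ) ∩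
    (inState W π b₁ bK d 1 (t + 1) ∩ (assess W π b₁ bK d (t + 1))ᶜ)

/-- The event that step `t + 1` belongs to an assessment stage that began after the change. -/
def lateStep (t : ℕ) : Set Ω :=
  assess W π b₁ bK d t ∩ alive W π b₁ bK d t ∩ late W π b₁ bK d t

/-- The event that an assessment stage that began after the change is ended at step `t + 1` by the
sequential probability ratio test. -/
def misdetection (t : ℕ) : Set Ω :=
  lateStep W π b₁ bK d t ∩ {ω | d ≤ (stageAt W π b₁ bK d (t + 1) ω).2}

/-- The event that step `t + 1` is made after the change, in a training stage. -/
def changedTraining (t : ℕ) : Set Ω :=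
  (assess W π b₁ bK d t)ᶜ ∩ alive W π b₁ bK d t ∩ inState W π b₁ bK d 1 (t + 1)

/-- The event that a training stage ends at step `t + 1`, after the change. -/
def lateStart (t : ℕ) : Set Ω :=
  changedTraining W π b₁ bK d t ∩ assess W π b₁ bK d (t + 1)

/-- The event that step `t + 1` is made after the change, in an assessment stage that began before
the change. -/
def changedAssess (t : ℕ) : Set Ω :=
  assess W π b₁ bK d t ∩ alive W π b₁ bK d t ∩ (late W π b₁ bK d t)ᶜ ∩
    inState W π b₁ bK d 1 (t + 1)

/-- The event that step `t + 1` is made before the change, in an assessment stage. -/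
def earlyAssess (t : ℕ) : Set Ω := assess W π b₁ bK d t ∩ inState W π b₁ bK d 0 (t + 1)

/-- The event that step `t + 1` is made before the change, in a training stage other than the first
stage. -/
def earlyTraining (t : ℕ) : Set Ω :=
  (assess W π b₁ bK d t)ᶜ ∩ (firstStage W π b₁ bK d t)ᶜ ∩ inState W π b₁ bK d 0 (t + 1)

/-- The event that step `t + 1` is made before the change, in the first stage. -/
def firstTraining (t : ℕ) : Set Ω := firstStage W π b₁ bK d t ∩ inState W π b₁ bK d 0 (t + 1)

variable {W π b₁ bK d} {t : ℕ} {ω : Ω}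

lemma notMem_assess_zero : ω ∉ assess W π b₁ bK d 0 := by
  simp [assess, stageAt, stagePath]

lemma assess_succ_of_mem (h : ω ∈ assess W π b₁ bK d t) : ω ∈ assess W π b₁ bK d (t + 1) ↔
    odds W π (proposedRule W π b₁ bK d) (t + 1) ω < bK ∧
      (stageAt W π b₁ bK d (t + 1) ω).2 < d := by
  simp only [assess, stageAt, mem_ofPred_eq] at h ⊢
  simp [stagePath, h]

lemma assess_succ_of_notMem (h : ω ∉ assess W π b₁ bK d t) : ω ∈ assess W π b₁ bK d (t + 1) ↔
    b₁ ≤ odds W π (proposedRule W π b₁ bK d) (t + 1) ω := by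
  simp only [assess, stageAt, mem_ofPred_eq] at h ⊢
  simp [stagePath, h]

lemma stageAt_succ_of_mem (h : ω ∈ assess W π b₁ bK d t) : (stageAt W π b₁ bK d (t + 1) ω).2 =
    (stageAt W π b₁ bK d t ω).2 * ratioK W π (proposedRule W π b₁ bK d) (t + 1) ω := by
  simp only [assess, stageAt, mem_ofPred_eq] at h ⊢
  simp [stagePath, h]

lemma stageAt_succ_of_notMem (h : ω ∉ assess W π b₁ bK d t) :
    (stageAt W π b₁ bK d (t + 1) ω).2 = 1 := by
  simp only [assess, stageAt, mem_ofPred_eq] at h ⊢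
  simp [stagePath, h]

lemma proposedRule_of_mem (h : ω ∈ assess W π b₁ bK d t) :
    proposedRule W π b₁ bK d (t + 1) ω = Fin.last k := by
  rw [proposedRule_succ]
  exact if_pos h

lemma proposedRule_of_notMem (h : ω ∉ assess W π b₁ bK d t) :
    proposedRule W π b₁ bK d (t + 1) ω = 0 := by
  rw [proposedRule_succ]
  exact if_neg h

lemma inState_one_iff : ω ∈ inState W π b₁ bK d 1 t ↔ ω ∉ inState W π b₁ bK d 0 t := by
  simp only [inState, mem_ofPred_eq]
  omega

lemma inState_zero_of_succ (h : ω ∈ inState W π b₁ bK d 0 (t + 1)) :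
    ω ∈ inState W π b₁ bK d 0 t := state_zero_of_le W π _ (Nat.le_succ t) h

lemma inState_one_succ (h : ω ∈ inState W π b₁ bK d 1 t) :
    ω ∈ inState W π b₁ bK d 1 (t + 1) := state_mono W π _ (Nat.le_succ t) h

lemma firstStage_of_succ (h : ω ∈ firstStage W π b₁ bK d (t + 1)) :
    ω ∈ firstStage W π b₁ bK d t := fun s hs => h s (by omega)

lemma notMem_assess_of_firstStage (h : ω ∈ firstStage W π b₁ bK d t) :
    ω ∉ assess W π b₁ bK d t := h t le_rfl

lemma firstStage_succ_iff (h : ω ∈ firstStage W π b₁ bK d t) :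
    ω ∈ firstStage W π b₁ bK d (t + 1) ↔ ω ∉ assess W π b₁ bK d (t + 1) := by
  refine ⟨notMem_assess_of_firstStage, fun h' s hs => ?_⟩
  rcases Nat.lt_or_ge s (t + 1) with h1 | h1
  · exact h s (by omega)
  · obtain rfl : s = t + 1 := by omega
    exact h'

lemma firstStage_zero : ω ∈ firstStage W π b₁ bK d 0 := fun s hs => by
  obtain rfl : s = 0 := by omega
  exact notMem_assess_zero

lemma late_succ_of_mem (h : ω ∈ assess W π b₁ bK d t) :
    ω ∈ late W π b₁ bK d (t + 1) ↔ ω ∈ late W π b₁ bK d t := by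
  simp [late, h]

lemma late_succ_of_notMem (h : ω ∉ assess W π b₁ bK d t) :
    ω ∈ late W π b₁ bK d (t + 1) ↔ ω ∈ inState W π b₁ bK d 1 (t + 1) := by
  simp [late, h]

lemma inState_of_late (h : ω ∈ late W π b₁ bK d t) : ω ∈ inState W π b₁ bK d 1 t := by
  induction t with
  | zero => exact absurd h (notMem_empty ω)
  | succ t ih =>
    by_cases ha : ω ∈ assess W π b₁ bK d t
    · exact inState_one_succ (ih ((late_succ_of_mem ha).1 h))
    · exact (late_succ_of_notMem ha).1 h

lemma alive_of_succ (h : ω ∈ alive W π b₁ bK d (t + 1)) : ω ∈ alive W π b₁ bK d t := by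
  rw [mem_alive_iff] at h ⊢
  exact fun s hs => h s (by omega)

lemma odds_lt_of_alive (h : ω ∈ alive W π b₁ bK d (t + 1)) (ha : ω ∈ assess W π b₁ bK d t) :
    odds W π (proposedRule W π b₁ bK d) (t + 1) ω < bK := by
  rw [mem_alive_iff] at h
  exact not_le.1 fun hb => h t (Nat.lt_succ_self t) ⟨ha, hb⟩

lemma sum_firstEnd_le (n : ℕ) : ∑ t ∈ Finset.range n, ind (firstEnd W π b₁ bK d t) ω ≤ 1 := by
  have key : ∀ n, ∑ t ∈ Finset.range n, ind (firstEnd W π b₁ bK d t) ω +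
      ind (firstStage W π b₁ bK d n) ω ≤ 1 := by
    intro n
    induction n with
    | zero => simpa using ind_le_one _ ω
    | succ n ih =>
      rw [Finset.sum_range_succ]
      have h0 := ind_nonneg (firstStage W π b₁ bK d n) ω
      by_cases h1 : ω ∈ firstStage W π b₁ bK d n
      · have e1 : ind (firstStage W π b₁ bK d n) ω = 1 := by simp [h1]
        by_cases h2 : ω ∈ firstEnd W π b₁ bK d n
        · have e2 : ind (firstStage W π b₁ bK d (n + 1)) ω = 0 := by
            have := (assess_succ_of_notMem (notMem_assess_of_firstStage h1)).2 h2.2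
            have h3 : ω ∉ firstStage W π b₁ bK d (n + 1) := fun h =>
              notMem_assess_of_firstStage h this
            simp [h3]
          have := ind_le_one (firstEnd W π b₁ bK d n) ω
          linarith
        · have e2 : ind (firstEnd W π b₁ bK d n) ω = 0 := by simp [h2]
          have := ind_le_one (firstStage W π b₁ bK d (n + 1)) ω
          linarith
      · have e1 : ind (firstEnd W π b₁ bK d n) ω = 0 := by simp [firstEnd, h1]
        have e2 : ind (firstStage W π b₁ bK d (n + 1)) ω = 0 := by
          have : ω ∉ firstStage W π b₁ bK d (n + 1) := fun h => h1 (firstStage_of_succ h)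
          simp [this]
        linarith
  have := key n
  have h0 := ind_nonneg (firstStage W π b₁ bK d n) ω
  linarith

lemma sum_laterChange_le (n : ℕ) : ∑ t ∈ Finset.range n, ind (laterChange W π b₁ bK d t) ω ≤
    ∑ t ∈ Finset.range n, ind (earlyEnd W π b₁ bK d t) ω := by
  have key : ∀ n, ∑ t ∈ Finset.range n, ind (laterChange W π b₁ bK d t) ω +
      ind ((firstStage W π b₁ bK d n)ᶜ ∩ inState W π b₁ bK d 0 n) ω ≤
      ∑ t ∈ Finset.range n, ind (earlyEnd W π b₁ bK d t) ω := by
    intro n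
    induction n with
    | zero => simp [firstStage_zero]
    | succ n ih =>
      rw [Finset.sum_range_succ, Finset.sum_range_succ]
      have h0 := ind_nonneg (earlyEnd W π b₁ bK d n) ω
      by_cases hf : ω ∈ firstStage W π b₁ bK d n
      · have e1 : ind (laterChange W π b₁ bK d n) ω = 0 := by simp [laterChange, hf]
        have e2 : ind ((firstStage W π b₁ bK d n)ᶜ ∩ inState W π b₁ bK d 0 n) ω = 0 := by
          simp [hf]
        have e3 : ind ((firstStage W π b₁ bK d (n + 1))ᶜ ∩ inState W π b₁ bK d 0 (n + 1)) ω ≤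
            ind (earlyEnd W π b₁ bK d n) ω := by
          refine ind_mono ?_
          rintro ⟨h1, h2⟩
          rw [mem_compl_iff, firstStage_succ_iff hf, not_not,
            assess_succ_of_notMem (notMem_assess_of_firstStage hf)] at h1
          exact ⟨⟨hf, h1⟩, h2⟩
        linarith
      · have hf' : ω ∉ firstStage W π b₁ bK d (n + 1) := fun h => hf (firstStage_of_succ h)
        by_cases h1 : ω ∈ inState W π b₁ bK d 0 n
        · by_cases h2 : ω ∈ inState W π b₁ bK d 0 (n + 1) <;>
            simp [laterChange, hf, hf', h1, h2, inState_one_iff] at ih ⊢ <;> linarith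
        · have h2 : ω ∉ inState W π b₁ bK d 0 (n + 1) := fun h => h1 (inState_zero_of_succ h)
          simp [laterChange, hf, hf', h1, h2, inState_one_iff] at ih ⊢
          linarith
  have := key n
  have h0 := ind_nonneg ((firstStage W π b₁ bK d n)ᶜ ∩ inState W π b₁ bK d 0 n) ω
  linarith

lemma sum_changedStageEnd_le (n : ℕ) :
    ∑ t ∈ Finset.range n, ind (changedStageEnd W π b₁ bK d t) ω ≤
      ∑ t ∈ Finset.range n, ind (laterChange W π b₁ bK d t) ω := by
  have key : ∀ n, ∑ t ∈ Finset.range n, ind (changedStageEnd W π b₁ bK d t) ω +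
      ind (assess W π b₁ bK d n ∩ ((late W π b₁ bK d n)ᶜ ∩ inState W π b₁ bK d 1 n)) ω ≤
      ∑ t ∈ Finset.range n, ind (laterChange W π b₁ bK d t) ω := by
    intro n
    induction n with
    | zero => simp [notMem_assess_zero]
    | succ n ih =>
      rw [Finset.sum_range_succ, Finset.sum_range_succ]
      have h0 := ind_nonneg (laterChange W π b₁ bK d n) ω
      by_cases ha : ω ∈ assess W π b₁ bK d n
      · have hf : ω ∉ firstStage W π b₁ bK d n := fun h => notMem_assess_of_firstStage h ha
        by_cases hl : ω ∈ late W π b₁ bK d n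
        · have hl' := (late_succ_of_mem ha).2 hl
          simp [changedStageEnd, hl, hl'] at ih ⊢
          linarith
        · have hl' : ω ∉ late W π b₁ bK d (n + 1) := fun h => hl ((late_succ_of_mem ha).1 h)
          by_cases h1 : ω ∈ inState W π b₁ bK d 0 n
          · by_cases h2 : ω ∈ inState W π b₁ bK d 0 (n + 1) <;>
              by_cases ha' : ω ∈ assess W π b₁ bK d (n + 1) <;>
              simp [changedStageEnd, laterChange, ha, ha', hf, hl, hl', h1, h2,
                inState_one_iff] at ih ⊢ <;> linarith
          · have h2 : ω ∉ inState W π b₁ bK d 0 (n + 1) := fun h => h1 (inState_zero_of_succ h)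
            by_cases ha' : ω ∈ assess W π b₁ bK d (n + 1) <;>
              simp [changedStageEnd, laterChange, ha, ha', hf, hl, hl', h1, h2,
                inState_one_iff] at ih ⊢ <;> linarith
      · have e1 : ind (changedStageEnd W π b₁ bK d n) ω = 0 := by simp [changedStageEnd, ha]
        have e2 : ind (assess W π b₁ bK d (n + 1) ∩ ((late W π b₁ bK d (n + 1))ᶜ ∩
            inState W π b₁ bK d 1 (n + 1))) ω = 0 := by
          refine indicator_of_notMem ?_ _
          rintro ⟨-, h1, h2⟩
          exact h1 ((late_succ_of_notMem ha).2 h2)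
        have h3 := ind_nonneg (assess W π b₁ bK d n ∩ ((late W π b₁ bK d n)ᶜ ∩
            inState W π b₁ bK d 1 n)) ω
        linarith
  have := key n
  have h0 := ind_nonneg (assess W π b₁ bK d n ∩ ((late W π b₁ bK d n)ᶜ ∩
    inState W π b₁ bK d 1 n)) ω
  linarith

lemma runStart_changedAssess (h : ω ∈ runStart (changedAssess W π b₁ bK d) t) :
    ω ∈ laterChange W π b₁ bK d t := by
  rcases t with _ | t
  · exact absurd h.1.1.1 notMem_assess_zero
  · obtain ⟨⟨⟨⟨ha, hal⟩, hl⟩, h1⟩, hn⟩ := h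
    refine ⟨fun hf => notMem_assess_of_firstStage hf ha, ?_, h1⟩
    by_contra h0
    rw [← inState_one_iff] at h0
    by_cases ha' : ω ∈ assess W π b₁ bK d t
    · exact hn ⟨⟨⟨ha', alive_of_succ hal⟩, fun h => hl ((late_succ_of_mem ha').2 h)⟩, h0⟩
    · exact hl ((late_succ_of_notMem ha').2 h0)

lemma runStart_lateStep_zero : ω ∉ runStart (lateStep W π b₁ bK d) 0 := fun h =>
  notMem_assess_zero h.1.1

lemma runStart_lateStep (h : ω ∈ runStart (lateStep W π b₁ bK d) (t + 1)) :
    ω ∈ lateStart W π b₁ bK d t := by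
  obtain ⟨⟨⟨ha, hal⟩, hl⟩, hn⟩ := h
  by_cases ha' : ω ∈ assess W π b₁ bK d t
  · exact absurd ⟨⟨ha', alive_of_succ hal⟩, (late_succ_of_mem ha').1 hl⟩ hn
  · exact ⟨⟨⟨ha', alive_of_succ hal⟩, (late_succ_of_notMem ha').1 hl⟩, ha⟩

lemma runStart_earlyAssess_zero : ω ∉ runStart (earlyAssess W π b₁ bK d) 0 := fun h =>
  notMem_assess_zero h.1

lemma notMem_assess_of_runStart (h : ω ∈ runStart (earlyAssess W π b₁ bK d) (t + 1)) :
    ω ∉ assess W π b₁ bK d t := fun ha => h.2 ⟨ha, inState_zero_of_succ h.1.2⟩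

lemma runStart_earlyAssess (h : ω ∈ runStart (earlyAssess W π b₁ bK d) (t + 1)) :
    ω ∈ earlyEnd W π b₁ bK d t ∪ earlyTraining W π b₁ bK d t := by
  have ha := notMem_assess_of_runStart h
  have h0 := inState_zero_of_succ h.1.2
  by_cases hf : ω ∈ firstStage W π b₁ bK d t
  · exact Or.inl ⟨⟨hf, (assess_succ_of_notMem ha).1 h.1.1⟩, h0⟩
  · exact Or.inr ⟨⟨ha, hf⟩, h0⟩

lemma sum_lateStart_le (n : ℕ) : ∑ t ∈ Finset.range n, ind (lateStart W π b₁ bK d t) ω ≤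
    ∑ t ∈ Finset.range n, ind (runStart (changedTraining W π b₁ bK d) t) ω :=
  (sum_ind_le_of_subset (B := fun t => changedTraining W π b₁ bK d t \
    changedTraining W π b₁ bK d (t + 1)) (fun _ h => ⟨h.1, fun h' => h'.1.1 h.2⟩) n).trans
    (sum_drop_le _ ω n)

/-- Each run of training steps after the change starts with the change, or follows an assessment
stage that was ended by the sequential probability ratio test. -/
lemma sum_runStart_changedTraining_le (n : ℕ) :
    ∑ t ∈ Finset.range n, ind (runStart (changedTraining W π b₁ bK d) t) ω ≤
      1 + ∑ t ∈ Finset.range n, ind (changedStageEnd W π b₁ bK d t) ω +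
        ∑ t ∈ Finset.range n, ind (misdetection W π b₁ bK d t) ω := by
  have key : ∀ n, ∑ t ∈ Finset.range (n + 1),
        ind (runStart (changedTraining W π b₁ bK d) t) ω ≤ ind (inState W π b₁ bK d 1 (n + 1)) ω +
      ∑ t ∈ Finset.range n, ind (changedStageEnd W π b₁ bK d t) ω +
        ∑ t ∈ Finset.range n, ind (misdetection W π b₁ bK d t) ω := by
    intro n
    induction n with
    | zero => simpa using ind_mono fun h => h.2
    | succ n ih =>
      rw [Finset.sum_range_succ,
        Finset.sum_range_succ (fun t => ind (changedStageEnd _ _ _ _ _ t) _),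
        Finset.sum_range_succ (fun t => ind (misdetection _ _ _ _ _ t) _)]
      have hc0 := ind_nonneg (changedStageEnd W π b₁ bK d n) ω
      have hm0 := ind_nonneg (misdetection W π b₁ bK d n) ω
      have hmono : ind (inState W π b₁ bK d 1 (n + 1)) ω ≤ ind (inState W π b₁ bK d 1 (n + 2)) ω :=
        ind_mono inState_one_succ
      by_cases hr : ω ∈ runStart (changedTraining W π b₁ bK d) (n + 1)
      · have er : ind (runStart (changedTraining W π b₁ bK d) (n + 1)) ω = 1 := by simp [hr]
        obtain ⟨⟨⟨ha, hal⟩, h1⟩, hn⟩ := hr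
        by_cases h0 : ω ∈ inState W π b₁ bK d 1 (n + 1)
        · have ha' : ω ∈ assess W π b₁ bK d n := by
            by_contra ha'
            exact hn ⟨⟨ha', alive_of_succ hal⟩, h0⟩
          by_cases hl : ω ∈ late W π b₁ bK d n
          · have : ω ∈ misdetection W π b₁ bK d n := by
              refine ⟨⟨⟨ha', alive_of_succ hal⟩, hl⟩, ?_⟩
              by_contra hd
              exact ha ((assess_succ_of_mem ha').2 ⟨odds_lt_of_alive hal ha', not_le.1 hd⟩)
            have : ind (misdetection W π b₁ bK d n) ω = 1 := by simp [this]
            linarith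
          · have : ω ∈ changedStageEnd W π b₁ bK d n := ⟨⟨ha', hl⟩, h0, ha⟩
            have : ind (changedStageEnd W π b₁ bK d n) ω = 1 := by simp [this]
            linarith
        · have e1 : ind (inState W π b₁ bK d 1 (n + 1)) ω = 0 := by simp [h0]
          have e2 : ind (inState W π b₁ bK d 1 (n + 2)) ω = 1 := by simp [h1]
          linarith
      · have er : ind (runStart (changedTraining W π b₁ bK d) (n + 1)) ω = 0 := by simp [hr]
        linarith
  rcases n with _ | n
  · simp
  · refine (key n).trans ?_
    have h1 := ind_le_one (inState W π b₁ bK d 1 (n + 1)) ω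
    rw [Finset.sum_range_succ (fun t => ind (changedStageEnd _ _ _ _ _ t) _),
      Finset.sum_range_succ (fun t => ind (misdetection _ _ _ _ _ t) _)]
    have hc0 := ind_nonneg (changedStageEnd W π b₁ bK d n) ω
    have hm0 := ind_nonneg (misdetection W π b₁ bK d n) ω
    linarith

lemma inState_zero_cover (h : ω ∈ inState W π b₁ bK d 0 (t + 1)) :
    ω ∈ firstTraining W π b₁ bK d t ∪ earlyTraining W π b₁ bK d t ∪
      earlyAssess W π b₁ bK d t := by
  by_cases ha : ω ∈ assess W π b₁ bK d t
  · exact Or.inr ⟨ha, h⟩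
  · by_cases hf : ω ∈ firstStage W π b₁ bK d t
    · exact Or.inl (Or.inl ⟨hf, h⟩)
    · exact Or.inl (Or.inr ⟨⟨ha, hf⟩, h⟩)

lemma alive_cover (h : ω ∈ alive W π b₁ bK d t) :
    ω ∈ inState W π b₁ bK d 0 (t + 1) ∪ changedTraining W π b₁ bK d t ∪
      lateStep W π b₁ bK d t ∪ changedAssess W π b₁ bK d t := by
  by_cases h0 : ω ∈ inState W π b₁ bK d 0 (t + 1)
  · exact Or.inl (Or.inl (Or.inl h0))
  · rw [← inState_one_iff] at h0
    by_cases ha : ω ∈ assess W π b₁ bK d t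
    · by_cases hl : ω ∈ late W π b₁ bK d t
      · exact Or.inl (Or.inr ⟨⟨ha, h⟩, hl⟩)
      · exact Or.inr ⟨⟨⟨ha, h⟩, hl⟩, h0⟩
    · exact Or.inl (Or.inl (Or.inr ⟨⟨ha, h⟩, h0⟩))

end Steps

/-! ### Log-likelihood ratios as functions of the noise -/

section Increments

variable {k : ℕ} {𝕐 : Type*} [MeasurableSpace 𝕐] {R : ResponseModel k 𝕐}
  {Ω : Type*} [mΩ : MeasurableSpace Ω] {P : Measure Ω}

lemma ResponseModel.dens_nonneg (R : ResponseModel k 𝕐) (x : Fin (k + 1)) (i : Fin 2) (y : 𝕐) :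
    0 ≤ R.dens x i y := by
  unfold ResponseModel.dens
  split_ifs
  · exact R.f_nonneg x y
  · exact R.g_nonneg x y

lemma Noise.integrable_h_iff (W : Noise R P) (x : Fin (k + 1)) (i : Fin 2) {φ : 𝕐 → ℝ}
    (hφ : Measurable φ) : Integrable (fun v => φ (W.h x i v)) unif ↔
      Integrable (fun y => φ y * R.dens x i y) R.μ := by
  have h := integrable_map_measure (μ := unif) (f := W.h x i) (g := φ)
    hφ.aestronglyMeasurable (W.h_meas x i).aemeasurable
  rw [W.h_law, integrable_withDensity_iff (R.dens_meas x i).ennreal_ofReal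
    (ae_of_all _ fun _ => ENNReal.ofReal_lt_top)] at h
  simp only [ENNReal.toReal_ofReal (R.dens_nonneg x i _)] at h
  exact h.symm

lemma Noise.integral_h (W : Noise R P) (x : Fin (k + 1)) (i : Fin 2) {φ : 𝕐 → ℝ}
    (hφ : Measurable φ) :
    ∫ v, φ (W.h x i v) ∂unif = ∫ y, φ y * R.dens x i y ∂(R.μ) := by
  have h := integral_map (μ := unif) (φ := W.h x i) (f := φ) (W.h_meas x i).aemeasurable
    hφ.aestronglyMeasurable
  rw [← h, W.h_law, integral_withDensity_eq_integral_toReal_smul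
    (R.dens_meas x i).ennreal_ofReal (ae_of_all _ fun _ => ENNReal.ofReal_lt_top)]
  simp only [ENNReal.toReal_ofReal (R.dens_nonneg x i _), smul_eq_mul, mul_comm]

/-- The log-likelihood ratio of state `1` against state `0` at a response to treatment `x` in
state `1`, as a function of the noise. -/
def Noise.logUp (W : Noise R P) (x : Fin (k + 1)) (v : ℝ) : ℝ :=
  Real.log (R.g x (W.h x 1 v) / R.f x (W.h x 1 v))

/-- The log-likelihood ratio of state `0` against state `1` at a response to treatment `x` in
state `0`, as a function of the noise. -/
def Noise.logDown (W : Noise R P) (x : Fin (k + 1)) (v : ℝ) : ℝ :=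
  Real.log (R.f x (W.h x 0 v) / R.g x (W.h x 0 v))

lemma Noise.measurable_logUp (W : Noise R P) (x : Fin (k + 1)) : Measurable (W.logUp x) :=
  (Real.measurable_log.comp ((R.g_meas x).div (R.f_meas x))).comp (W.h_meas x 1)

lemma Noise.measurable_logDown (W : Noise R P) (x : Fin (k + 1)) : Measurable (W.logDown x) :=
  (Real.measurable_log.comp ((R.f_meas x).div (R.g_meas x))).comp (W.h_meas x 0)

lemma Noise.memLp_logUp (W : Noise R P) (hR : R.Regular) (x : Fin (k + 1)) :
    MemLp (W.logUp x) 2 unif := by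
  rw [memLp_two_iff_integrable_sq (W.measurable_logUp x).aestronglyMeasurable]
  refine (W.integrable_h_iff x 1 (φ := fun y => Real.log (R.g x y / R.f x y) ^ 2)
    ((Real.measurable_log.comp ((R.g_meas x).div (R.f_meas x))).pow_const 2)).2 ?_
  exact (hR x).2.1

lemma Noise.memLp_logDown (W : Noise R P) (hR : R.Regular) (x : Fin (k + 1)) :
    MemLp (W.logDown x) 2 unif := by
  rw [memLp_two_iff_integrable_sq (W.measurable_logDown x).aestronglyMeasurable]
  refine (W.integrable_h_iff x 0 (φ := fun y => Real.log (R.f x y / R.g x y) ^ 2)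
    ((Real.measurable_log.comp ((R.f_meas x).div (R.g_meas x))).pow_const 2)).2 ?_
  exact (hR x).2.2.2.1

lemma Noise.integral_logUp (W : Noise R P) (x : Fin (k + 1)) :
    ∫ v, W.logUp x v ∂unif = R.I x :=
  W.integral_h x 1 (φ := fun y => Real.log (R.g x y / R.f x y))
    (Real.measurable_log.comp ((R.g_meas x).div (R.f_meas x)))

lemma Noise.integral_logDown (W : Noise R P) (x : Fin (k + 1)) :
    ∫ v, W.logDown x v ∂unif = R.J x :=
  W.integral_h x 0 (φ := fun y => Real.log (R.f x y / R.g x y))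
    (Real.measurable_log.comp ((R.f_meas x).div (R.g_meas x)))

/-- Truncation from above at a high level changes an integral by little. -/
lemma exists_truncation {f : ℝ → ℝ} (hf : Integrable f unif) {ε : ℝ} (hε : 0 < ε) :
    ∃ B₀ : ℝ, ∀ B ≥ B₀, ∫ v, f v ∂unif - ε ≤ ∫ v, min (f v) B ∂unif := by
  have hint : ∀ B : ℝ, Integrable (fun v => min (f v) B) unif := fun B =>
    hf.inf (integrable_const B)
  have ht : Tendsto (fun n : ℕ => ∫ v, min (f v) n ∂unif) atTop (𝓝 (∫ v, f v ∂unif)) := by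
    refine tendsto_integral_of_dominated_convergence (fun v => |f v|)
      (fun n => (hint n).aestronglyMeasurable) hf.abs (fun n => ae_of_all _ fun v => ?_)
      (ae_of_all _ fun v => ?_)
    · rw [Real.norm_eq_abs]
      rcases le_total (f v) n with h | h
      · rw [min_eq_left h]
      · rw [min_eq_right h, abs_of_nonneg (Nat.cast_nonneg n)]
        exact h.trans (le_abs_self _)
    · obtain ⟨N, hN⟩ := exists_nat_ge (f v)
      refine tendsto_const_nhds.congr' ?_
      filter_upwards [eventually_ge_atTop N] with n hn
      rw [min_eq_left (hN.trans (Nat.cast_le.2 hn))]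
  obtain ⟨N, hN⟩ := (ht.eventually (lt_mem_nhds (sub_lt_self _ hε))).exists
  refine ⟨N, fun B hB => hN.le.trans (integral_mono (hint N) (hint B) fun v => ?_)⟩
  exact min_le_min_left _ hB

variable [IsProbabilityMeasure P]

lemma measurableSet_runStart {Q : ℕ → Set Ω} (hQ : ∀ t, MeasurableSet (Q t)) (t : ℕ) :
    MeasurableSet (runStart Q t) := by
  rcases t with _ | t
  · exact hQ 0
  · exact (hQ (t + 1)).diff (hQ t)

lemma integral_sum_ind {A : ℕ → Set Ω} (hA : ∀ t, MeasurableSet (A t)) (n : ℕ) :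
    ∫ ω, ∑ t ∈ Finset.range n, ind (A t) ω ∂P = ∑ t ∈ Finset.range n, P.real (A t) := by
  rw [integral_finsetSum _ fun t _ => (integrable_const (1 : ℝ)).indicator (hA t)]
  exact Finset.sum_congr rfl fun t _ => integral_indicator_one (hA t)

lemma sum_real_le_of_sum_ind_le {A B : ℕ → Set Ω} (hA : ∀ t, MeasurableSet (A t))
    (hB : ∀ t, MeasurableSet (B t)) {n m : ℕ} {c : ℝ}
    (h : ∀ ω, ∑ t ∈ Finset.range n, ind (A t) ω ≤ c + ∑ t ∈ Finset.range m, ind (B t) ω) :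
    ∑ t ∈ Finset.range n, P.real (A t) ≤ c + ∑ t ∈ Finset.range m, P.real (B t) := by
  have hi : ∀ {A : ℕ → Set Ω} (_ : ∀ t, MeasurableSet (A t)) (n : ℕ),
      Integrable (fun ω => ∑ t ∈ Finset.range n, ind (A t) ω) P := fun hA n =>
    integrable_finsetSum _ fun t _ => (integrable_const (1 : ℝ)).indicator (hA t)
  rw [← integral_sum_ind hA, ← integral_sum_ind hB]
  calc ∫ ω, ∑ t ∈ Finset.range n, ind (A t) ω ∂P
      ≤ ∫ ω, (c + ∑ t ∈ Finset.range m, ind (B t) ω) ∂P :=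
        integral_mono (hi hA n) ((integrable_const c).add (hi hB m)) h
    _ = _ := by rw [integral_add (integrable_const c) (hi hB m)]; simp

/-- The expected number of steps of a given type.  Each step contributes an independent increment
with mean at least `∫ z`, and from time `t₀` on also `κ`; along a run of consecutive steps the
increments add up to at most `c` before the last step. -/
lemma count_le (W : Noise R P) {Q : ℕ → Set Ω} (hQ : ∀ t, MeasurableSet[W.mid (t + 1)] (Q t))
    {z : ℝ → ℝ} (hz : Measurable z) (hzi : Integrable z unif) {B κ c : ℝ} (hB : 0 ≤ B)
    (hκ : 0 ≤ κ) (hc : 0 ≤ c) (hzB : ∀ v, z v ≤ B) (t₀ : ℕ) {ℓ : ℕ → Ω → ℝ}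
    (hrun : ∀ᵐ ω ∂P, (∀ t, ω ∈ runStart Q t →
        z (W.V (t + 1) ω) + (if t₀ ≤ t then κ else 0) ≤ ℓ (t + 1) ω) ∧
      ∀ t, ω ∈ Q t → ω ∈ Q (t + 1) → ℓ (t + 1) ω ≤ c ∧
        ℓ (t + 1) ω + (z (W.V (t + 2) ω) + (if t₀ ≤ t + 1 then κ else 0)) ≤ ℓ (t + 2) ω)
    (n : ℕ) :
    (∫ v, z v ∂unif + κ) * ∑ t ∈ Finset.range n, P.real (Q t) ≤
      (c + B + κ) * ∑ t ∈ Finset.range n, P.real (runStart Q t) + κ * t₀ := by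
  have hQ' : ∀ t, MeasurableSet (Q t) := fun t => W.mid_le _ _ (hQ t)
  have hind : ∀ t, Measurable[W.mid (t + 1)] (ind (Q t)) := fun t =>
    measurable_const.indicator (hQ t)
  set κ' : ℕ → ℝ := fun t => if t₀ ≤ t then κ else 0 with hκ'
  have hκ'le : ∀ t, κ' t ≤ κ := fun t => by simp only [hκ']; split_ifs <;> simp [hκ]
  have hinti : ∀ t, Integrable (fun ω => ind (Q t) ω * (z (W.V (t + 1) ω) + κ' t)) P := by
    intro t
    have h1 : Integrable (fun ω => z (W.V (t + 1) ω) + κ' t) P := by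
      refine Integrable.add ?_ (integrable_const _)
      rw [← W.V_law (t + 1)] at hzi
      exact hzi.comp_measurable (W.V_meas (t + 1))
    refine h1.bdd_mul (c := 1) ((measurable_const.indicator (hQ' t)).aestronglyMeasurable)
      (ae_of_all _ fun ω => ?_)
    rw [Real.norm_eq_abs, abs_of_nonneg (ind_nonneg _ _)]
    exact ind_le_one _ _
  have hterm : ∀ t, ∫ ω, ind (Q t) ω * (z (W.V (t + 1) ω) + κ' t) ∂P =
      P.real (Q t) * (∫ v, z v ∂unif + κ' t) := by
    intro t
    rw [setIntegral_indep (W.mid_le _) (W.V_meas _) (W.indep_V _) (W.V_law _) (hind t)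
      (z := fun v => z v + κ' t) (hz.add_const _), integral_add hzi (integrable_const _),
      integral_const, show ∫ ω, ind (Q t) ω ∂P = P.real (Q t) from integral_indicator_one (hQ' t)]
    simp
  have hrunM : ∀ t, MeasurableSet (runStart Q t) := measurableSet_runStart hQ'
  have hmain : ∑ t ∈ Finset.range n, P.real (Q t) * (∫ v, z v ∂unif + κ' t) ≤
      (c + B + κ) * ∑ t ∈ Finset.range n, P.real (runStart Q t) := by
    have h1 : ∑ t ∈ Finset.range n, P.real (Q t) * (∫ v, z v ∂unif + κ' t) =
        ∫ ω, ∑ t ∈ Finset.range n, ind (Q t) ω * (z (W.V (t + 1) ω) + κ' t) ∂P := by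
      rw [integral_finsetSum _ fun t _ => hinti t]
      exact (Finset.sum_congr rfl fun t _ => hterm t).symm
    rw [h1, ← integral_sum_ind hrunM, ← integral_const_mul]
    refine integral_mono_ae (integrable_finsetSum _ fun t _ => hinti t)
      ((integrable_finsetSum _ fun t _ =>
        (integrable_const (1 : ℝ)).indicator (hrunM t)).const_mul _) ?_
    filter_upwards [hrun] with ω hω
    have := sum_run_le (Q := Q) (ω := ω) (inc := fun t => z (W.V (t + 1) ω) + κ' t)
      (ℓ := fun t => ℓ t ω) (B := B + κ) hc (by linarith)
      (fun t => add_le_add (hzB _) (hκ'le t)) hω.1 hω.2 n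
    rwa [← add_assoc] at this
  have hκsum : ∑ t ∈ Finset.range n, P.real (Q t) * (κ - κ' t) ≤ κ * t₀ := by
    have h1 : ∀ t, P.real (Q t) * (κ - κ' t) ≤ if t < t₀ then κ else 0 := by
      intro t
      by_cases h : t₀ ≤ t
      · simp [hκ', h, not_lt.2 h]
      · simp only [hκ', h, if_false, sub_zero, not_le.1 h, if_true]
        exact mul_le_of_le_one_left hκ measureReal_le_one
    refine (Finset.sum_le_sum fun t _ => h1 t).trans ?_
    rw [← Finset.sum_filter, Finset.sum_const, nsmul_eq_mul, mul_comm]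
    refine mul_le_mul_of_nonneg_left ?_ hκ
    have : (Finset.range n).filter (· < t₀) ⊆ Finset.range t₀ := fun t ht => by
      simpa using (Finset.mem_filter.1 ht).2
    exact_mod_cast (Finset.card_le_card this).trans (Finset.card_range t₀).le
  have e : (∫ v, z v ∂unif + κ) * ∑ t ∈ Finset.range n, P.real (Q t) =
      ∑ t ∈ Finset.range n, P.real (Q t) * (∫ v, z v ∂unif + κ' t) +
      ∑ t ∈ Finset.range n, P.real (Q t) * (κ - κ' t) := by
    rw [Finset.mul_sum, ← Finset.sum_add_distrib]
    exact Finset.sum_congr rfl fun t _ => by ring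
  linarith

/-- The change has not occurred with conditional probability at most `1 / (1 + b)` where the
posterior odds are at least `b`. -/
lemma measureReal_inter_state_zero_le (W : Noise R P) (hR : R.Regular) {π : Transition k}
    (h0 : ∀ t z, 0 ≤ π t z) (h1 : ∀ t z, π t z < 1) {X : ℕ → Ω → Fin (k + 1)}
    (hX : ∀ t, Measurable[obs W π X t] (X (t + 1))) {t : ℕ} {A : Set Ω}
    (hA : MeasurableSet[obs W π X t] A) {b : ℝ} (hb : 0 ≤ b) (hAb : ∀ ω ∈ A, b ≤ odds W π X t ω) :
    P.real (A ∩ {ω | state W π X t ω = 0}) ≤ 1 / (1 + b) * P.real A := by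
  have hle := obs_le W π hX t
  have hA' := hle _ hA
  have hm0 : MeasurableSet {ω | state W π X t ω = 0} :=
    W.mid_le t _ (measurableSet_state W π hX t 0)
  have hm1 : MeasurableSet {ω | state W π X t ω = 1} :=
    W.mid_le t _ (measurableSet_state W π hX t 1)
  have h := setLIntegral_state_one W hR h0 h1 hX t (φ := A.indicator fun _ => 1)
    (measurable_const.indicator hA)
  rw [setLIntegral_indicator hA', setLIntegral_const, one_mul] at h
  have h2 : ENNReal.ofReal b * P (A ∩ {ω | state W π X t ω = 0}) ≤
      P (A ∩ {ω | state W π X t ω = 1}) := by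
    rw [h, ← setLIntegral_const, ← setLIntegral_indicator hA']
    refine lintegral_mono_ae ?_
    filter_upwards [ae_restrict_of_ae (odds_ae_eq W hR h0 h1 hX)] with ω hω
    by_cases hωA : ω ∈ A
    · simp only [indicator_of_mem hωA, one_mul]
      exact ENNReal.ofReal_le_ofReal (hω t ▸ hAb ω hωA)
    · simp [hωA]
  have h3 : b * P.real (A ∩ {ω | state W π X t ω = 0}) ≤
      P.real (A ∩ {ω | state W π X t ω = 1}) := by
    have := ENNReal.toReal_mono (measure_ne_top P _) h2
    rwa [ENNReal.toReal_mul, ENNReal.toReal_ofReal hb] at this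
  have h4 : P.real A = P.real (A ∩ {ω | state W π X t ω = 0}) +
      P.real (A ∩ {ω | state W π X t ω = 1}) := by
    have := measureReal_inter_add_sdiff (μ := P) (s := A) hm0
    rw [← this]
    congr 2
    ext ω
    simp only [Set.mem_sdiff, mem_ofPred_eq, mem_inter_iff]
    refine and_congr_right fun _ => ?_
    omega
  rw [one_div, ← div_eq_inv_mul, le_div_iff₀ (by linarith)]
  linarith

end Increments

/-! ### Expected numbers of steps of the proposed procedure -/

section Latent

lemma latent_congr {Ω : Type*} {U q q' : ℕ → Ω → ℝ} {ω : Ω} {t : ℕ}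
    (h : ∀ s ≤ t, q s ω = q' s ω) : latent U q t ω = latent U q' t ω := by
  induction t with
  | zero => simp [latent, h 0 le_rfl]
  | succ t ih => simp [latent, h (t + 1) le_rfl, ih fun s hs => h s (by omega)]

lemma transProb_succ {k : ℕ} {Ω : Type*} (π : Transition k) (X : ℕ → Ω → Fin (k + 1)) (t : ℕ)
    (ω : Ω) : transProb π X (t + 1) ω =
      π (t + 1) (Fin.snoc (fun i : Fin t => X (i + 1) ω) (X (t + 1) ω)) := by
  unfold transProb
  congr 1
  funext i
  refine Fin.lastCases ?_ (fun i => ?_) i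
  · simp
  · simp

end Latent

/-- Bounds on the transition probabilities that enter the analysis of the proposed procedure: the
probabilities under the first treatment are at least `ζ`, and from time `t₀` on the contributions
`-log (1 - π)` of the first and of the last treatment to the drift of the log-odds are at least
`κ₁` and `κK`. -/
structure TransitionBounds {k : ℕ} (π : Transition k) (ζ κ₁ κK : ℝ) (t₀ : ℕ) : Prop where
  nonneg : ∀ t z, 0 ≤ π t z
  lt_one : ∀ t z, π t z < 1
  zeta_pos : 0 < ζ
  zeta_le : ∀ t (z : Fin t → Fin (k + 1)), ζ ≤ π (t + 1) (Fin.snoc z 0)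
  first_nonneg : 0 ≤ κ₁
  last_nonneg : 0 ≤ κK
  first_le : ∀ t ≥ t₀, ∀ z : Fin t → Fin (k + 1), κ₁ ≤ -Real.log (1 - π (t + 1) (Fin.snoc z 0))
  last_le : ∀ t ≥ t₀, ∀ z : Fin t → Fin (k + 1),
    κK ≤ -Real.log (1 - π (t + 1) (Fin.snoc z (Fin.last k)))

section Bounds

variable {k : ℕ} {Ω : Type*} {π : Transition k} {ζ κ₁ κK : ℝ} {t₀ : ℕ}

lemma transProb_bounds (H : TransitionBounds π ζ κ₁ κK t₀) (X : ℕ → Ω → Fin (k + 1)) (t : ℕ)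
    (ω : Ω) : 0 ≤ transProb π X t ω ∧ 0 < 1 - transProb π X t ω := by
  have h0 := H.nonneg t fun i => X (i + 1) ω
  have h1 := H.lt_one t fun i => X (i + 1) ω
  unfold transProb
  exact ⟨h0, by linarith⟩

lemma zeta_le_transProb (H : TransitionBounds π ζ κ₁ κK t₀) {X : ℕ → Ω → Fin (k + 1)} {t : ℕ}
    {ω : Ω} (h : X (t + 1) ω = 0) : ζ ≤ transProb π X (t + 1) ω := by
  rw [transProb_succ, h]
  exact H.zeta_le t _

lemma neg_log_transProb_nonneg (H : TransitionBounds π ζ κ₁ κK t₀) (X : ℕ → Ω → Fin (k + 1))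
    (t : ℕ) (ω : Ω) : 0 ≤ -Real.log (1 - transProb π X t ω) := by
  have h := transProb_bounds H X t ω
  have := Real.log_nonpos h.2.le (by linarith [h.1])
  linarith

end Bounds

section Counts

variable {k : ℕ} {𝕐 : Type*} [MeasurableSpace 𝕐] {R : ResponseModel k 𝕐}
  {Ω : Type*} [mΩ : MeasurableSpace Ω] {P : Measure Ω}
  {W : Noise R P} {π : Transition k} {b₁ bK d : ℝ} {ζ κ₁ κK : ℝ} {t₀ : ℕ}

/-- The log-odds after a step in state `1`. -/
lemma log_odds_step {a o q lr o' κ : ℝ} (ha : 0 < a) (hq : 0 < 1 - q) (hlr : 0 < lr)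
    (hle : a ≤ o + q) (ho' : o' = (o + q) / (1 - q) * lr) (hκ : κ ≤ -Real.log (1 - q)) :
    0 < o' ∧ Real.log a + (Real.log lr + κ) ≤ Real.log o' := by
  have hpos : 0 < o + q := ha.trans_le hle
  refine ⟨by rw [ho']; positivity, ?_⟩
  rw [ho', Real.log_mul (by positivity) hlr.ne', Real.log_div hpos.ne' hq.ne']
  have := Real.log_le_log ha hle
  linarith

variable (W π b₁ bK d) in
/-- The almost sure properties of the paths that are used in counting steps. -/
def RegularPath (ω : Ω) : Prop :=
  (∀ t, 0 ≤ odds W π (proposedRule W π b₁ bK d) t ω ∧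
    0 < likRatio W π (proposedRule W π b₁ bK d) (t + 1) ω ∧
    odds W π (proposedRule W π b₁ bK d) (t + 1) ω =
      (odds W π (proposedRule W π b₁ bK d) t ω +
        transProb π (proposedRule W π b₁ bK d) (t + 1) ω) /
        (1 - transProb π (proposedRule W π b₁ bK d) (t + 1) ω) *
        likRatio W π (proposedRule W π b₁ bK d) (t + 1) ω) ∧
  ∀ (t : ℕ) (x : Fin (k + 1)) (i : Fin 2),
    0 < R.f x (W.h x i (W.V t ω)) ∧ 0 < R.g x (W.h x i (W.V t ω))

lemma log_likRatio_of_one {X : ℕ → Ω → Fin (k + 1)} {t : ℕ} {ω : Ω} (h : state W π X t ω = 1) :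
    Real.log (likRatio W π X t ω) = W.logUp (X t ω) (W.V t ω) := by
  unfold likRatio response Noise.logUp
  rw [h]

/-- In an assessment stage the posterior odds are at least `b₁ / d`. -/
lemma odds_mul_prod_ge (H : TransitionBounds π ζ κ₁ κK t₀) (hd : 1 ≤ d) {ω : Ω}
    (hω : RegularPath W π b₁ bK d ω) (t : ℕ) (ha : ω ∈ assess W π b₁ bK d t) :
    0 < (stageAt W π b₁ bK d t ω).2 ∧ (stageAt W π b₁ bK d t ω).2 ≤ d ∧
      b₁ ≤ odds W π (proposedRule W π b₁ bK d) t ω * (stageAt W π b₁ bK d t ω).2 := by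
  induction t with
  | zero => exact absurd ha notMem_assess_zero
  | succ t ih =>
    by_cases ha' : ω ∈ assess W π b₁ bK d t
    · obtain ⟨i1, i2, i3⟩ := ih ha'
      obtain ⟨o1, o2, o3⟩ := hω.1 t
      have hq := transProb_bounds H (proposedRule W π b₁ bK d) (t + 1) ω
      have hr : ratioK W π (proposedRule W π b₁ bK d) (t + 1) ω =
          (likRatio W π (proposedRule W π b₁ bK d) (t + 1) ω)⁻¹ := by
        unfold ratioK likRatio
        rw [proposedRule_of_mem ha', inv_div]
      have hΛ := stageAt_succ_of_mem ha'
      rw [hr] at hΛ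
      refine ⟨by rw [hΛ]; positivity, ((assess_succ_of_mem ha').1 ha).2.le, i3.trans ?_⟩
      rw [hΛ, o3]
      set o := odds W π (proposedRule W π b₁ bK d) t ω
      set q := transProb π (proposedRule W π b₁ bK d) (t + 1) ω
      set lr := likRatio W π (proposedRule W π b₁ bK d) (t + 1) ω
      set Λ := (stageAt W π b₁ bK d t ω).2
      have e : (o + q) / (1 - q) * lr * (Λ * lr⁻¹) = (o + q) / (1 - q) * Λ := by
        field_simp
      rw [e]
      refine mul_le_mul_of_nonneg_right ?_ i1.le
      rw [le_div_iff₀ hq.2]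
      nlinarith [mul_nonneg o1 hq.1, hq.1]
    · rw [stageAt_succ_of_notMem ha', mul_one]
      exact ⟨one_pos, hd, (assess_succ_of_notMem ha').1 ha⟩

lemma assess_meas (t : ℕ) : MeasurableSet[obs W π (proposedRule W π b₁ bK d) t]
    (assess W π b₁ bK d t) :=
  (measurable_stageAt W π b₁ bK d t).fst (measurableSet_singleton true)

lemma obs_le_before' (t : ℕ) : obs W π (proposedRule W π b₁ bK d) t ≤ W.before (t + 1) :=
  obs_le_before W π (measurable_proposedRule W π b₁ bK d) t

lemma assess_before (t : ℕ) : MeasurableSet[W.before (t + 1)] (assess W π b₁ bK d t) :=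
  obs_le_before' t _ (assess_meas t)

lemma alive_before (t : ℕ) : MeasurableSet[W.before (t + 1)] (alive W π b₁ bK d t) :=
  obs_le_before' t _ (measurableSet_alive W π b₁ bK d t)

lemma firstStage_meas (t : ℕ) : MeasurableSet[obs W π (proposedRule W π b₁ bK d) t]
    (firstStage W π b₁ bK d t) := by
  have : firstStage W π b₁ bK d t = ⋂ s : ℕ, ⋂ _ : s ≤ t, (assess W π b₁ bK d s)ᶜ := by
    ext ω; simp [firstStage]
  rw [this]
  exact MeasurableSet.iInter fun s => MeasurableSet.iInter fun hs =>
    (obs_mono W π _ hs _ (assess_meas s)).compl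

lemma firstStage_before (t : ℕ) : MeasurableSet[W.before (t + 1)] (firstStage W π b₁ bK d t) :=
  obs_le_before' t _ (firstStage_meas t)

lemma inState_mid (i : Fin 2) (t : ℕ) : MeasurableSet[W.mid t] (inState W π b₁ bK d i t) :=
  measurableSet_state W π (measurable_proposedRule W π b₁ bK d) t i

lemma inState_before (i : Fin 2) (t : ℕ) :
    MeasurableSet[W.before (t + 1)] (inState W π b₁ bK d i t) :=
  W.mid_le_before t _ (inState_mid i t)

lemma late_before (t : ℕ) : MeasurableSet[W.before (t + 1)] (late W π b₁ bK d t) := by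
  induction t with
  | zero => exact @MeasurableSet.empty _ (W.before 1)
  | succ t ih =>
    have h := W.before_mono (Nat.le_succ (t + 1))
    exact ((h _ (assess_before t)).inter (h _ ih)).union
      ((h _ (assess_before t)).compl.inter (inState_before 1 (t + 1)))

lemma firstEnd_meas (t : ℕ) : MeasurableSet[obs W π (proposedRule W π b₁ bK d) (t + 1)]
    (firstEnd W π b₁ bK d t) :=
  (obs_mono W π _ (Nat.le_succ t) _ (firstStage_meas t)).inter
    (measurableSet_le measurable_const (measurable_odds W π _ (t + 1)))

lemma earlyEnd_meas (t : ℕ) : MeasurableSet (earlyEnd W π b₁ bK d t) :=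
  ((obs_le W π (measurable_proposedRule W π b₁ bK d) _) _ (firstEnd_meas t)).inter
    (W.mid_le _ _ (inState_mid 0 (t + 1)))

lemma laterChange_meas (t : ℕ) : MeasurableSet (laterChange W π b₁ bK d t) :=
  (W.before_le _ _ (firstStage_before t)).compl.inter
    ((W.mid_le _ _ (inState_mid 0 t)).inter (W.mid_le _ _ (inState_mid 1 (t + 1))))

lemma lateStep_before (t : ℕ) : MeasurableSet[W.before (t + 1)] (lateStep W π b₁ bK d t) :=
  ((assess_before t).inter (alive_before t)).inter (late_before t)

lemma changedTraining_mid (t : ℕ) :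
    MeasurableSet[W.mid (t + 1)] (changedTraining W π b₁ bK d t) :=
  ((W.before_le_mid _ _ (assess_before t)).compl.inter
    (W.before_le_mid _ _ (alive_before t))).inter (inState_mid 1 (t + 1))

lemma changedAssess_mid (t : ℕ) : MeasurableSet[W.mid (t + 1)] (changedAssess W π b₁ bK d t) :=
  (((W.before_le_mid _ _ (assess_before t)).inter (W.before_le_mid _ _ (alive_before t))).inter
    (W.before_le_mid _ _ (late_before t)).compl).inter (inState_mid 1 (t + 1))

lemma earlyAssess_mid (t : ℕ) : MeasurableSet[W.mid (t + 1)] (earlyAssess W π b₁ bK d t) :=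
  (W.before_le_mid _ _ (assess_before t)).inter (inState_mid 0 (t + 1))

lemma changedStageEnd_meas (t : ℕ) : MeasurableSet (changedStageEnd W π b₁ bK d t) :=
  ((W.before_le _ _ (assess_before t)).inter (W.before_le _ _ (late_before t)).compl).inter
    ((W.mid_le _ _ (inState_mid 1 (t + 1))).inter (W.before_le _ _ (assess_before (t + 1))).compl)

lemma misdetection_meas (t : ℕ) : MeasurableSet (misdetection W π b₁ bK d t) :=
  (W.before_le _ _ (lateStep_before t)).inter (measurableSet_le measurable_const
    (((measurable_stageAt W π b₁ bK d (t + 1)).snd).mono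
      (obs_le W π (measurable_proposedRule W π b₁ bK d) _) le_rfl))

lemma lateStart_meas (t : ℕ) : MeasurableSet (lateStart W π b₁ bK d t) :=
  (W.mid_le _ _ (changedTraining_mid t)).inter (W.before_le _ _ (assess_before (t + 1)))

lemma stageAt_nonneg (t : ℕ) (ω : Ω) : 0 ≤ (stageAt W π b₁ bK d t ω).2 := by
  induction t with
  | zero => simp [stageAt, stagePath]
  | succ t ih =>
    by_cases ha : ω ∈ assess W π b₁ bK d t
    · rw [stageAt_succ_of_mem ha]
      exact mul_nonneg ih (div_nonneg (R.f_nonneg _ _) (R.g_nonneg _ _))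
    · rw [stageAt_succ_of_notMem ha]
      exact zero_le_one

variable [IsProbabilityMeasure P]

/-- Almost surely, each step multiplies the posterior odds, augmented by the transition probability,
by a positive factor. -/
lemma odds_step (H : TransitionBounds π ζ κ₁ κK t₀) (hR : R.Regular) {X : ℕ → Ω → Fin (k + 1)}
    (hX : ∀ t, Measurable[obs W π X t] (X (t + 1))) :
    ∀ᵐ ω ∂P, ∀ t, 0 ≤ odds W π X t ω ∧ 0 < likRatio W π X (t + 1) ω ∧
      odds W π X (t + 1) ω = (odds W π X t ω + transProb π X (t + 1) ω) /
        (1 - transProb π X (t + 1) ω) * likRatio W π X (t + 1) ω := by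
  filter_upwards [odds_ae_eq W hR H.nonneg H.lt_one hX, ae_response_pos W hR] with ω h1 h2 t
  refine ⟨?_, ?_, ?_⟩
  · rw [h1]
    exact Finset.sum_nonneg fun s _ => changeWeight_nonneg W H.nonneg H.lt_one X s t ω
  · have := h2 (t + 1) (X (t + 1) ω) (state W π X (t + 1) ω)
    exact div_pos this.2 this.1
  · rw [h1, h1, totalWeight_succ]

lemma ae_regularPath (H : TransitionBounds π ζ κ₁ κK t₀) (hR : R.Regular) :
    ∀ᵐ ω ∂P, RegularPath W π b₁ bK d ω := by
  filter_upwards [odds_step H hR (measurable_proposedRule W π b₁ bK d),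
    ae_response_pos W hR] with ω h1 h2
  exact ⟨h1, h2⟩

/-- The first training stage ends before the change with probability at most `1 / (1 + b₁)`. -/
lemma sum_earlyEnd_le (H : TransitionBounds π ζ κ₁ κK t₀) (hR : R.Regular) (hb₁ : 0 < b₁)
    (n : ℕ) : ∑ t ∈ Finset.range n, P.real (earlyEnd W π b₁ bK d t) ≤ 1 / (1 + b₁) := by
  have h1 : ∀ t, P.real (earlyEnd W π b₁ bK d t) ≤
      1 / (1 + b₁) * P.real (firstEnd W π b₁ bK d t) := fun t =>
    measureReal_inter_state_zero_le W hR H.nonneg H.lt_one (measurable_proposedRule W π b₁ bK d)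
      (firstEnd_meas t) hb₁.le fun ω hω => hω.2
  have h2 : ∑ t ∈ Finset.range n, P.real (firstEnd W π b₁ bK d t) ≤ 1 := by
    have := sum_real_le_of_sum_ind_le (P := P) (c := 1) (m := 0) (n := n)
      (fun t => obs_le W π (measurable_proposedRule W π b₁ bK d) _ _ (firstEnd_meas t))
      (fun t => obs_le W π (measurable_proposedRule W π b₁ bK d) _ _ (firstEnd_meas t))
      (fun ω => by simpa using sum_firstEnd_le (W := W) (π := π) (ω := ω) n)
    simpa using this
  refine (Finset.sum_le_sum fun t _ => h1 t).trans ?_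
  rw [← Finset.mul_sum]
  exact mul_le_of_le_one_right (by positivity) h2

lemma sum_laterChange_real_le (H : TransitionBounds π ζ κ₁ κK t₀) (hR : R.Regular)
    (hb₁ : 0 < b₁) (n : ℕ) :
    ∑ t ∈ Finset.range n, P.real (laterChange W π b₁ bK d t) ≤ 1 / (1 + b₁) := by
  have := sum_real_le_of_sum_ind_le (P := P) (c := 0) (n := n) (m := n)
    (laterChange_meas (W := W) (π := π) (b₁ := b₁) (bK := bK) (d := d)) earlyEnd_meas
    fun ω => by simpa using sum_laterChange_le (W := W) (π := π) (ω := ω) n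
  rw [zero_add] at this
  exact this.trans (sum_earlyEnd_le H hR hb₁ n)

/-- In training stages the change occurs at each step with probability at least `ζ`. -/
lemma sum_earlyTraining_le (H : TransitionBounds π ζ κ₁ κK t₀) (hR : R.Regular) (hb₁ : 0 < b₁)
    (n : ℕ) : ∑ t ∈ Finset.range n, P.real (earlyTraining W π b₁ bK d t) ≤
      1 / (1 + b₁) / ζ := by
  have hζ1 : ζ < 1 := (H.zeta_le 0 finZeroElim).trans_lt (H.lt_one _ _)
  have h1 : ∀ t, ζ * P.real (earlyTraining W π b₁ bK d t) ≤
      P.real (laterChange W π b₁ bK d t) := by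
    intro t
    set D : Set Ω := (assess W π b₁ bK d t)ᶜ ∩ (firstStage W π b₁ bK d t)ᶜ ∩
      inState W π b₁ bK d 0 t with hD
    have hDm : MeasurableSet[W.before (t + 1)] D :=
      ((assess_before t).compl.inter (firstStage_before t).compl).inter (inState_before 0 t)
    have hind := (Indep_iff _ _ _).1 (W.indep_U (t + 1)) D (W.U (t + 1) ⁻¹' Iic ζ) hDm
      ⟨Iic ζ, measurableSet_Iic, rfl⟩
    rw [← Measure.map_apply (W.U_meas _) measurableSet_Iic, W.U_law, unif_Iic hζ1] at hind
    have e1 : P.real (D ∩ W.U (t + 1) ⁻¹' Iic ζ) = P.real D * ζ := by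
      rw [measureReal_def, hind, ENNReal.toReal_mul, ENNReal.toReal_ofReal H.zeta_pos.le]
      rfl
    have e2 : P.real (earlyTraining W π b₁ bK d t) ≤ P.real D :=
      measureReal_mono fun ω hω => ⟨hω.1, inState_zero_of_succ hω.2⟩
    have e3 : P.real (D ∩ W.U (t + 1) ⁻¹' Iic ζ) ≤ P.real (laterChange W π b₁ bK d t) := by
      refine measureReal_mono ?_
      rintro ω ⟨⟨⟨ha, hf⟩, h0⟩, hU⟩
      refine ⟨hf, h0, ?_⟩
      rw [inState_one_iff]
      intro hc
      have := (latent_succ_eq_zero.1 hc).2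
      have h2 := zeta_le_transProb H (proposedRule_of_notMem ha)
      exact absurd (hU.trans h2) (not_le.2 this)
    have := mul_le_mul_of_nonneg_left e2 H.zeta_pos.le
    linarith
  rw [le_div_iff₀ H.zeta_pos, mul_comm, Finset.mul_sum]
  exact (Finset.sum_le_sum fun t _ => h1 t).trans (sum_laterChange_real_le H hR hb₁ n)

/-- In an assessment stage that begins after the change, the product of the likelihood ratios is a
nonnegative martingale that starts at `1`, and reaches `d` with probability at most `1 / d`. -/
lemma sum_misdetection_le (hR : R.Regular) (hd : 0 ≤ d) (n : ℕ) :
    d * ∑ t ∈ Finset.range n, P.real (misdetection W π b₁ bK d t) ≤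
      ∑ t ∈ Finset.range n, P.real (lateStart W π b₁ bK d t) := by
  have hΛm : ∀ t, Measurable[W.before (t + 1)] fun ω => (stageAt W π b₁ bK d t ω).2 := fun t =>
    ((measurable_stageAt W π b₁ bK d t).snd).mono (obs_le_before' t) le_rfl
  have hΛm' : ∀ t, Measurable fun ω => ENNReal.ofReal (stageAt W π b₁ bK d t ω).2 := fun t =>
    ((hΛm t).mono (W.before_le _) le_rfl).ennreal_ofReal
  have hmart : ∀ t, ∫⁻ ω in lateStep W π b₁ bK d t,
      ENNReal.ofReal (stageAt W π b₁ bK d (t + 1) ω).2 ∂P =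
      ∫⁻ ω in lateStep W π b₁ bK d t, ENNReal.ofReal (stageAt W π b₁ bK d t ω).2 ∂P := by
    intro t
    have hm := W.before_le_mid (t + 1)
    have hfr := setLIntegral_freeze (W.mid_le (t + 1)) (W.V_meas (t + 1)) (W.indep_V (t + 1))
      (W.V_law (t + 1)) (hm _ (lateStep_before (π := π) (b₁ := b₁) (bK := bK) (d := d) t))
      ((hΛm t).mono hm le_rfl)
      (F := fun p => ENNReal.ofReal p.1 * ENNReal.ofReal (R.f (Fin.last k)
        (W.h (Fin.last k) 1 p.2) / R.g (Fin.last k) (W.h (Fin.last k) 1 p.2)))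
      (measurable_fst.ennreal_ofReal.mul (((((R.f_meas _).div (R.g_meas _)).comp
        (W.h_meas _ 1)).comp measurable_snd).ennreal_ofReal))
    have h2 : ∀ a : ℝ, ∫⁻ v, ENNReal.ofReal a * ENNReal.ofReal (R.f (Fin.last k)
        (W.h (Fin.last k) 1 v) / R.g (Fin.last k) (W.h (Fin.last k) 1 v)) ∂unif =
        ENNReal.ofReal a := by
      intro a
      have hm : Measurable fun v => ENNReal.ofReal (R.f (Fin.last k)
          (W.h (Fin.last k) 1 v) / R.g (Fin.last k) (W.h (Fin.last k) 1 v)) :=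
        (((R.f_meas _).div (R.g_meas _)).comp (W.h_meas _ 1)).ennreal_ofReal
      rw [lintegral_const_mul _ hm, W.lintegral_inv_ratio hR, mul_one]
    simp only [h2] at hfr
    rw [← hfr]
    refine setLIntegral_congr_fun (W.before_le _ _ (lateStep_before t)) fun ω hω => ?_
    have hs : state W π (proposedRule W π b₁ bK d) (t + 1) ω = 1 :=
      inState_one_succ (inState_of_late hω.2)
    have hr : ratioK W π (proposedRule W π b₁ bK d) (t + 1) ω = R.f (Fin.last k)
        (W.h (Fin.last k) 1 (W.V (t + 1) ω)) / R.g (Fin.last k)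
        (W.h (Fin.last k) 1 (W.V (t + 1) ω)) := by
      unfold ratioK response
      rw [hs, proposedRule_of_mem hω.1.1]
    rw [stageAt_succ_of_mem hω.1.1, hr, ENNReal.ofReal_mul (stageAt_nonneg t ω)]
  have key : ∀ n, ENNReal.ofReal d * ∑ t ∈ Finset.range n, P (misdetection W π b₁ bK d t) +
      ∫⁻ ω in lateStep W π b₁ bK d n, ENNReal.ofReal (stageAt W π b₁ bK d n ω).2 ∂P ≤
      ∑ t ∈ Finset.range n, P (lateStart W π b₁ bK d t) := by
    intro n
    induction n with
    | zero =>
      have : lateStep W π b₁ bK d 0 = ∅ := by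
        ext ω
        exact iff_of_false (fun h => notMem_assess_zero h.1.1) (notMem_empty ω)
      simp [this]
    | succ n ih =>
      rw [Finset.sum_range_succ, Finset.sum_range_succ, mul_add]
      have hmA := W.before_le _ _ (lateStep_before (W := W) (π := π) (b₁ := b₁) (bK := bK)
        (d := d) n)
      have hsub : lateStep W π b₁ bK d (n + 1) ⊆
          (lateStep W π b₁ bK d n \ misdetection W π b₁ bK d n) ∪ lateStart W π b₁ bK d n := by
        intro ω hω
        by_cases ha : ω ∈ assess W π b₁ bK d n
        · refine Or.inl ⟨⟨⟨ha, alive_of_succ hω.1.2⟩, (late_succ_of_mem ha).1 hω.2⟩, fun h => ?_⟩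
          exact absurd ((assess_succ_of_mem ha).1 hω.1.1).2 (not_lt.2 h.2)
        · exact Or.inr ⟨⟨⟨ha, alive_of_succ hω.1.2⟩, (late_succ_of_notMem ha).1 hω.2⟩, hω.1.1⟩
      have h1 : ∫⁻ ω in lateStep W π b₁ bK d (n + 1),
          ENNReal.ofReal (stageAt W π b₁ bK d (n + 1) ω).2 ∂P ≤
          ∫⁻ ω in lateStep W π b₁ bK d n \ misdetection W π b₁ bK d n,
            ENNReal.ofReal (stageAt W π b₁ bK d (n + 1) ω).2 ∂P +
          P (lateStart W π b₁ bK d n) := by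
        refine (lintegral_mono_set hsub).trans ((lintegral_union_le _ _ _).trans ?_)
        refine add_le_add le_rfl ?_
        rw [setLIntegral_congr_fun (g := fun _ => 1) (lateStart_meas n) fun ω hω => ?_]
        · simp
        · simp only
          rw [stageAt_succ_of_notMem hω.1.1.1, ENNReal.ofReal_one]
      have h2 : ENNReal.ofReal d * P (misdetection W π b₁ bK d n) ≤
          ∫⁻ ω in misdetection W π b₁ bK d n,
            ENNReal.ofReal (stageAt W π b₁ bK d (n + 1) ω).2 ∂P := by
        rw [← setLIntegral_const]
        exact setLIntegral_mono (hΛm' _) fun ω hω => ENNReal.ofReal_le_ofReal hω.2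
      have h3 : ∫⁻ ω in misdetection W π b₁ bK d n,
            ENNReal.ofReal (stageAt W π b₁ bK d (n + 1) ω).2 ∂P +
          ∫⁻ ω in lateStep W π b₁ bK d n \ misdetection W π b₁ bK d n,
            ENNReal.ofReal (stageAt W π b₁ bK d (n + 1) ω).2 ∂P =
          ∫⁻ ω in lateStep W π b₁ bK d n, ENNReal.ofReal (stageAt W π b₁ bK d n ω).2 ∂P := by
        rw [← hmart n, ← lintegral_inter_add_sdiff (fun ω =>
          ENNReal.ofReal (stageAt W π b₁ bK d (n + 1) ω).2) (lateStep W π b₁ bK d n)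
          (misdetection_meas (W := W) (π := π) (b₁ := b₁) (bK := bK) (d := d) n),
          inter_eq_self_of_subset_right (fun ω hω => hω.1)]
      calc ENNReal.ofReal d * ∑ t ∈ Finset.range n, P (misdetection W π b₁ bK d t) +
            ENNReal.ofReal d * P (misdetection W π b₁ bK d n) +
            ∫⁻ ω in lateStep W π b₁ bK d (n + 1),
              ENNReal.ofReal (stageAt W π b₁ bK d (n + 1) ω).2 ∂P
          ≤ ENNReal.ofReal d * ∑ t ∈ Finset.range n, P (misdetection W π b₁ bK d t) +
            ∫⁻ ω in misdetection W π b₁ bK d n,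
              ENNReal.ofReal (stageAt W π b₁ bK d (n + 1) ω).2 ∂P +
            (∫⁻ ω in lateStep W π b₁ bK d n \ misdetection W π b₁ bK d n,
              ENNReal.ofReal (stageAt W π b₁ bK d (n + 1) ω).2 ∂P +
            P (lateStart W π b₁ bK d n)) := add_le_add (add_le_add le_rfl h2) h1
        _ = (ENNReal.ofReal d * ∑ t ∈ Finset.range n, P (misdetection W π b₁ bK d t) +
            ∫⁻ ω in lateStep W π b₁ bK d n, ENNReal.ofReal (stageAt W π b₁ bK d n ω).2 ∂P) +
            P (lateStart W π b₁ bK d n) := by rw [← h3]; ring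
        _ ≤ _ := add_le_add ih le_rfl
  have h := le_self_add.trans (key n)
  have hfin : ∑ t ∈ Finset.range n, P (lateStart W π b₁ bK d t) ≠ ⊤ :=
    ENNReal.sum_ne_top.2 fun t _ => measure_ne_top _ _
  have h' := ENNReal.toReal_mono hfin h
  rw [ENNReal.toReal_mul, ENNReal.toReal_ofReal hd, ENNReal.toReal_sum fun t _ =>
    measure_ne_top _ _, ENNReal.toReal_sum fun t _ => measure_ne_top _ _] at h'
  exact h'

end Counts

section Renewal

variable {k : ℕ} {𝕐 : Type*} [MeasurableSpace 𝕐] {R : ResponseModel k 𝕐}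
  {Ω : Type*} [mΩ : MeasurableSpace Ω] {P : Measure Ω}
  {W : Noise R P} {π : Transition k} {b₁ bK d : ℝ} {ζ κ₁ κK : ℝ} {t₀ : ℕ}

/-- The log-odds after a step in state `1` of a training stage. -/
lemma log_odds_training (H : TransitionBounds π ζ κ₁ κK t₀) {ω : Ω}
    (hω : RegularPath W π b₁ bK d ω) {t : ℕ} (ha : ω ∉ assess W π b₁ bK d t)
    (h1 : ω ∈ inState W π b₁ bK d 1 (t + 1)) {a : ℝ} (hpos : 0 < a)
    (hle : a ≤ odds W π (proposedRule W π b₁ bK d) t ω +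
      transProb π (proposedRule W π b₁ bK d) (t + 1) ω) :
    0 < odds W π (proposedRule W π b₁ bK d) (t + 1) ω ∧
    Real.log a + (W.logUp 0 (W.V (t + 1) ω) + if t₀ ≤ t then κ₁ else 0) ≤
      Real.log (odds W π (proposedRule W π b₁ bK d) (t + 1) ω) := by
  have hX : proposedRule W π b₁ bK d (t + 1) ω = 0 := proposedRule_of_notMem ha
  have hκ : (if t₀ ≤ t then κ₁ else 0) ≤
      -Real.log (1 - transProb π (proposedRule W π b₁ bK d) (t + 1) ω) := by
    split_ifs with h
    · rw [transProb_succ, hX]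
      exact H.first_le t h _
    · exact neg_log_transProb_nonneg H _ _ _
  have hl := log_likRatio_of_one (W := W) (π := π) h1
  rw [hX] at hl
  rw [← hl]
  exact log_odds_step hpos (transProb_bounds H _ _ ω).2 (hω.1 t).2.1 hle (hω.1 t).2.2 hκ

/-- The log-odds after a step in state `1` of an assessment stage. -/
lemma log_odds_assess (H : TransitionBounds π ζ κ₁ κK t₀) {ω : Ω}
    (hω : RegularPath W π b₁ bK d ω) {t : ℕ} (ha : ω ∈ assess W π b₁ bK d t)
    (h1 : ω ∈ inState W π b₁ bK d 1 (t + 1)) {a : ℝ} (hpos : 0 < a)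
    (hle : a ≤ odds W π (proposedRule W π b₁ bK d) t ω) :
    0 < odds W π (proposedRule W π b₁ bK d) (t + 1) ω ∧
    Real.log a + (W.logUp (Fin.last k) (W.V (t + 1) ω) + if t₀ ≤ t then κK else 0) ≤
      Real.log (odds W π (proposedRule W π b₁ bK d) (t + 1) ω) := by
  have hX : proposedRule W π b₁ bK d (t + 1) ω = Fin.last k := proposedRule_of_mem ha
  have hκ : (if t₀ ≤ t then κK else 0) ≤
      -Real.log (1 - transProb π (proposedRule W π b₁ bK d) (t + 1) ω) := by
    split_ifs with h
    · rw [transProb_succ, hX]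
      exact H.last_le t h _
    · exact neg_log_transProb_nonneg H _ _ _
  have hl := log_likRatio_of_one (W := W) (π := π) h1
  rw [hX] at hl
  rw [← hl]
  have hq := transProb_bounds H (proposedRule W π b₁ bK d) (t + 1) ω
  exact log_odds_step hpos hq.2 (hω.1 t).2.1 (by linarith [hq.1]) (hω.1 t).2.2 hκ

lemma measurableSet_constState (W : Noise R P) (π : Transition k) (x : Fin (k + 1)) (t : ℕ) :
    MeasurableSet {ω | state W π (fun _ _ => x) t ω = 0} :=
  W.mid_le _ _ (measurableSet_state W π (fun _ => measurable_const) t 0)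

lemma lam_eq_tsum (W : Noise R P) (π : Transition k) (x : Fin (k + 1)) :
    lam W π x = ∑' t : ℕ, P {ω | state W π (fun _ _ => x) t ω = 0} := by
  have e : ∀ t : ℕ, {ω | (t : ℕ∞) < changePoint W π (fun _ _ => x) ω} =
      {ω | state W π (fun _ _ => x) t ω = 0} := fun t => by
    ext ω; exact lt_firstOne_latent
  unfold lam
  rw [expTime_eq_tsum fun t => by rw [e]; exact measurableSet_constState W π x t]
  exact tsum_congr fun t => by rw [e]

variable [IsProbabilityMeasure P]

lemma measurable_trunc {f : ℝ → ℝ} (hf : Measurable f) (B : ℝ) :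
    Measurable fun v => min (f v) B := hf.min measurable_const

lemma integrable_trunc {f : ℝ → ℝ} (hf : MemLp f 2 unif) (B : ℝ) :
    Integrable (fun v => min (f v) B) unif :=
  (hf.integrable (by norm_num)).inf (integrable_const B)

/-- The expected number of training steps after the change. -/
lemma sum_changedTraining_le (H : TransitionBounds π ζ κ₁ κK t₀) (hR : R.Regular) (hb₁ : ζ ≤ b₁)
    {B : ℝ} (hB : 0 ≤ B) (n : ℕ) :
    (∫ v, min (W.logUp 0 v) B ∂unif + κ₁) *
        ∑ t ∈ Finset.range n, P.real (changedTraining W π b₁ bK d t) ≤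
      (Real.log b₁ - Real.log ζ + B + κ₁) *
        ∑ t ∈ Finset.range n, P.real (runStart (changedTraining W π b₁ bK d) t) + κ₁ * t₀ := by
  refine count_le W changedTraining_mid (measurable_trunc (W.measurable_logUp 0) B)
    (integrable_trunc (W.memLp_logUp hR 0) B) hB H.first_nonneg
    (sub_nonneg.2 (Real.log_le_log H.zeta_pos hb₁)) (fun v => min_le_right _ _) t₀
    (ℓ := fun t ω => Real.log (odds W π (proposedRule W π b₁ bK d) t ω) - Real.log ζ) ?_ n
  filter_upwards [ae_regularPath H hR] with ω hω
  have hstep : ∀ t, ω ∈ changedTraining W π b₁ bK d t →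
      ζ ≤ transProb π (proposedRule W π b₁ bK d) (t + 1) ω := fun t h =>
    zeta_le_transProb H (proposedRule_of_notMem h.1.1)
  have hmin : ∀ t, min (W.logUp 0 (W.V t ω)) B ≤ W.logUp 0 (W.V t ω) := fun t => min_le_left _ _
  constructor
  · intro t ht
    have ht' : ω ∈ changedTraining W π b₁ bK d t := by
      rcases t with _ | t
      · exact ht
      · exact ht.1
    have := (log_odds_training H hω ht'.1.1 ht'.2 H.zeta_pos
      (by linarith [hstep t ht', (hω.1 t).1])).2
    linarith [hmin (t + 1)]
  · intro t h1 h2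
    have hpos := (log_odds_training H hω h1.1.1 h1.2 H.zeta_pos
      (by linarith [hstep t h1, (hω.1 t).1])).1
    have hlt := not_le.1 fun h => h2.1.1 ((assess_succ_of_notMem h1.1.1).2 h)
    refine ⟨sub_le_sub_right (Real.log_le_log hpos hlt.le) _, ?_⟩
    have := (log_odds_training H hω h2.1.1 h2.2 hpos
      (by linarith [hstep (t + 1) h2, H.zeta_pos])).2
    linarith [hmin (t + 2)]

/-- The expected number of steps in assessment stages that began after the change. -/
lemma sum_lateStep_le (H : TransitionBounds π ζ κ₁ κK t₀) (hR : R.Regular) (hb₁ : 0 < b₁)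
    (hbK : b₁ ≤ bK) {B : ℝ} (hB : 0 ≤ B) (n : ℕ) :
    (∫ v, min (W.logUp (Fin.last k) v) B ∂unif + κK) *
        ∑ t ∈ Finset.range n, P.real (lateStep W π b₁ bK d t) ≤
      (Real.log bK - Real.log b₁ + B + κK) *
        ∑ t ∈ Finset.range n, P.real (runStart (lateStep W π b₁ bK d) t) + κK * t₀ := by
  refine count_le W (fun t => W.before_le_mid _ _ (lateStep_before t))
    (measurable_trunc (W.measurable_logUp _) B) (integrable_trunc (W.memLp_logUp hR _) B) hB
    H.last_nonneg (sub_nonneg.2 (Real.log_le_log hb₁ hbK)) (fun v => min_le_right _ _) t₀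
    (ℓ := fun t ω => Real.log (odds W π (proposedRule W π b₁ bK d) t ω) - Real.log b₁) ?_ n
  filter_upwards [ae_regularPath H hR] with ω hω
  have hmin : ∀ t, min (W.logUp (Fin.last k) (W.V t ω)) B ≤ W.logUp (Fin.last k) (W.V t ω) :=
    fun t => min_le_left _ _
  have hs : ∀ t, ω ∈ lateStep W π b₁ bK d t → ω ∈ inState W π b₁ bK d 1 (t + 1) := fun t h =>
    inState_one_succ (inState_of_late h.2)
  have hpos : ∀ t, ω ∈ assess W π b₁ bK d t → ω ∈ inState W π b₁ bK d 1 (t + 1) →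
      0 < odds W π (proposedRule W π b₁ bK d) t ω →
      0 < odds W π (proposedRule W π b₁ bK d) (t + 1) ω := fun t ha h1 h =>
    (log_odds_assess H hω ha h1 h le_rfl).1
  constructor
  · intro t ht
    rcases t with _ | t
    · exact absurd ht runStart_lateStep_zero
    · have hst := runStart_lateStep ht
      have hb := (assess_succ_of_notMem hst.1.1.1).1 hst.2
      have := (log_odds_assess H hω ht.1.1.1 (hs _ ht.1) hb₁ hb).2
      linarith [hmin (t + 2)]
  · intro t h1 h2
    have hlt := ((assess_succ_of_mem h1.1.1).1 h2.1.1).1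
    have hop : 0 < odds W π (proposedRule W π b₁ bK d) (t + 1) ω := by
      -- the odds are positive throughout the stage, because they are at least `b₁` when it begins
      have hstart : ∀ s, ω ∈ assess W π b₁ bK d s → ω ∈ late W π b₁ bK d s →
          0 < odds W π (proposedRule W π b₁ bK d) s ω := by
        intro s
        induction s with
        | zero => exact fun h => absurd h notMem_assess_zero
        | succ s ih =>
          intro ha hl
          by_cases ha' : ω ∈ assess W π b₁ bK d s
          · have hl' := (late_succ_of_mem ha').1 hl
            exact hpos s ha' (inState_one_succ (inState_of_late hl')) (ih ha' hl')
          · exact hb₁.trans_le ((assess_succ_of_notMem ha').1 ha)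
      exact hstart (t + 1) h2.1.1 h2.2
    refine ⟨sub_le_sub_right (Real.log_le_log hop hlt.le) _, ?_⟩
    have := (log_odds_assess H hω h2.1.1 (hs _ h2) hop le_rfl).2
    linarith [hmin (t + 2)]

/-- The expected number of steps after the change, in the assessment stage in which it occurs. -/
lemma sum_changedAssess_le (H : TransitionBounds π ζ κ₁ κK t₀) (hR : R.Regular) (hb₁ : 0 < b₁)
    (hbK : b₁ ≤ bK) (hd : 1 ≤ d) {B : ℝ} (hB : 0 ≤ B) (n : ℕ) :
    (∫ v, min (W.logUp (Fin.last k) v) B ∂unif + κK) *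
        ∑ t ∈ Finset.range n, P.real (changedAssess W π b₁ bK d t) ≤
      (Real.log bK - Real.log b₁ + Real.log d + B + κK) *
        ∑ t ∈ Finset.range n, P.real (runStart (changedAssess W π b₁ bK d) t) + κK * t₀ := by
  have hd0 : 0 < d := by linarith
  refine count_le W changedAssess_mid
    (measurable_trunc (W.measurable_logUp _) B) (integrable_trunc (W.memLp_logUp hR _) B) hB
    H.last_nonneg (add_nonneg (sub_nonneg.2 (Real.log_le_log hb₁ hbK)) (Real.log_nonneg hd))
    (fun v => min_le_right _ _) t₀
    (ℓ := fun t ω => Real.log (odds W π (proposedRule W π b₁ bK d) t ω) - Real.log (b₁ / d)) ?_ n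
  filter_upwards [ae_regularPath H hR] with ω hω
  have hmin : ∀ t, min (W.logUp (Fin.last k) (W.V t ω)) B ≤ W.logUp (Fin.last k) (W.V t ω) :=
    fun t => min_le_left _ _
  have hlow : ∀ t, ω ∈ assess W π b₁ bK d t →
      b₁ / d ≤ odds W π (proposedRule W π b₁ bK d) t ω := by
    intro t ha
    obtain ⟨h1, h2, h3⟩ := odds_mul_prod_ge H hd hω t ha
    rw [div_le_iff₀ hd0]
    exact h3.trans (mul_le_mul_of_nonneg_left h2 (hω.1 t).1)
  constructor
  · intro t ht
    have ht' : ω ∈ changedAssess W π b₁ bK d t := by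
      rcases t with _ | t
      · exact ht
      · exact ht.1
    have := (log_odds_assess H hω ht'.1.1.1 ht'.2 (div_pos hb₁ hd0) (hlow t ht'.1.1.1)).2
    linarith [hmin (t + 1)]
  · intro t h1 h2
    have hlt := ((assess_succ_of_mem h1.1.1.1).1 h2.1.1.1).1
    have hop := (div_pos hb₁ hd0).trans_le (hlow (t + 1) h2.1.1.1)
    constructor
    · have := Real.log_le_log hop hlt.le
      rw [Real.log_div hb₁.ne' hd0.ne']
      linarith
    · have := (log_odds_assess H hω h2.1.1.1 h2.2 hop le_rfl).2
      linarith [hmin (t + 2)]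

/-- The expected number of assessment steps before the change. -/
lemma sum_earlyAssess_le (H : TransitionBounds π ζ κ₁ κK t₀) (hR : R.Regular)
    (hd : 1 ≤ d) {B : ℝ} (hB : 0 ≤ B) (n : ℕ) :
    (∫ v, min (W.logDown (Fin.last k) v) B ∂unif) *
        ∑ t ∈ Finset.range n, P.real (earlyAssess W π b₁ bK d t) ≤
      (Real.log d + B) *
        ∑ t ∈ Finset.range n, P.real (runStart (earlyAssess W π b₁ bK d) t) := by
  have key := count_le W (P := P) (earlyAssess_mid (W := W) (π := π) (b₁ := b₁) (bK := bK)
    (d := d)) (measurable_trunc (W.measurable_logDown (Fin.last k)) B)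
    (integrable_trunc (W.memLp_logDown hR _) B) hB le_rfl (Real.log_nonneg hd)
    (fun v => min_le_right _ _) 0
    (ℓ := fun t ω => Real.log (stageAt W π b₁ bK d t ω).2) ?_ n
  · simpa using key
  filter_upwards [ae_regularPath H hR] with ω hω
  have hmin : ∀ t, min (W.logDown (Fin.last k) (W.V t ω)) B ≤ W.logDown (Fin.last k) (W.V t ω) :=
    fun t => min_le_left _ _
  have hstep : ∀ t, ω ∈ earlyAssess W π b₁ bK d t →
      0 < (stageAt W π b₁ bK d t ω).2 ∧ Real.log (stageAt W π b₁ bK d (t + 1) ω).2 =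
        Real.log (stageAt W π b₁ bK d t ω).2 + W.logDown (Fin.last k) (W.V (t + 1) ω) := by
    intro t ht
    have hΛ := (odds_mul_prod_ge H hd hω t ht.1).1
    have hp := hω.2 (t + 1) (Fin.last k) 0
    refine ⟨hΛ, ?_⟩
    have hs : state W π (proposedRule W π b₁ bK d) (t + 1) ω = 0 := ht.2
    have hr : ratioK W π (proposedRule W π b₁ bK d) (t + 1) ω = R.f (Fin.last k)
        (W.h (Fin.last k) 0 (W.V (t + 1) ω)) / R.g (Fin.last k)
        (W.h (Fin.last k) 0 (W.V (t + 1) ω)) := by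
      unfold ratioK response
      rw [hs, proposedRule_of_mem ht.1]
    rw [stageAt_succ_of_mem ht.1, hr, Real.log_mul hΛ.ne' (div_pos hp.1 hp.2).ne']
    rfl
  constructor
  · intro t ht
    rcases t with _ | t
    · exact absurd ht runStart_earlyAssess_zero
    · have h1 := (hstep _ ht.1).2
      rw [stageAt_succ_of_notMem (notMem_assess_of_runStart ht), Real.log_one] at h1
      have := hmin (t + 2)
      simp only [ite_self, add_zero]
      linarith
  · intro t h1 h2
    have h3 := hstep _ h2
    have hlt := ((assess_succ_of_mem h1.1).1 h2.1).2
    have := hmin (t + 2)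
    refine ⟨Real.log_le_log h3.1 hlt.le, ?_⟩
    simp only [ite_self, add_zero]
    linarith [h3.2]

/-- Before the change, an assessment stage starts right after the end of the first training stage or
after a step of a later training stage. -/
lemma sum_runStart_earlyAssess_le (H : TransitionBounds π ζ κ₁ κK t₀) (hR : R.Regular)
    (hb₁ : 0 < b₁) (n : ℕ) :
    ∑ t ∈ Finset.range n, P.real (runStart (earlyAssess W π b₁ bK d) t) ≤
      1 / (1 + b₁) + 1 / (1 + b₁) / ζ := by
  have h1 : ∑ t ∈ Finset.range n, P.real (runStart (earlyAssess W π b₁ bK d) t) ≤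
      ∑ t ∈ Finset.range n, (P.real (earlyEnd W π b₁ bK d t) +
        P.real (earlyTraining W π b₁ bK d t)) := by
    rcases n with _ | n
    · simp
    · rw [Finset.sum_range_succ']
      have h0 : runStart (earlyAssess W π b₁ bK d) 0 = ∅ := by
        ext ω
        exact iff_of_false runStart_earlyAssess_zero (notMem_empty ω)
      rw [h0, measureReal_empty, add_zero, Finset.sum_range_succ]
      have h2 : ∀ t, P.real (runStart (earlyAssess W π b₁ bK d) (t + 1)) ≤
          P.real (earlyEnd W π b₁ bK d t) + P.real (earlyTraining W π b₁ bK d t) := fun t =>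
        (measureReal_mono fun ω hω => runStart_earlyAssess hω).trans (measureReal_union_le _ _)
      have h3 := Finset.sum_le_sum fun t (_ : t ∈ Finset.range n) => h2 t
      have h4 : 0 ≤ P.real (earlyEnd W π b₁ bK d n) := measureReal_nonneg
      have h5 : 0 ≤ P.real (earlyTraining W π b₁ bK d n) := measureReal_nonneg
      linarith
  rw [Finset.sum_add_distrib] at h1
  exact h1.trans (add_le_add (sum_earlyEnd_le H hR hb₁ n) (sum_earlyTraining_le H hR hb₁ n))

/-- The change occurs in at most one assessment stage, and only if the first stage ended before
it. -/
lemma sum_runStart_changedAssess_le (H : TransitionBounds π ζ κ₁ κK t₀) (hR : R.Regular)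
    (hb₁ : 0 < b₁) (n : ℕ) :
    ∑ t ∈ Finset.range n, P.real (runStart (changedAssess W π b₁ bK d) t) ≤ 1 / (1 + b₁) :=
  (Finset.sum_le_sum fun _ _ => measureReal_mono fun _ hω => runStart_changedAssess hω).trans
    (sum_laterChange_real_le H hR hb₁ n)

/-- The expected number of runs of training steps after the change is close to one. -/
lemma sum_runStart_changedTraining_real_le (H : TransitionBounds π ζ κ₁ κK t₀) (hR : R.Regular)
    (hb₁ : 0 < b₁) (hd : 1 < d) (n : ℕ) :
    ∑ t ∈ Finset.range n, P.real (runStart (changedTraining W π b₁ bK d) t) ≤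
      (1 + 1 / (1 + b₁)) / (1 - 1 / d) := by
  have hm : ∀ t, MeasurableSet (runStart (changedTraining W π b₁ bK d) t) :=
    measurableSet_runStart fun t => W.mid_le _ _ (changedTraining_mid t)
  have hi : ∀ {A : ℕ → Set Ω} (_ : ∀ t, MeasurableSet (A t)) (n : ℕ),
      Integrable (fun ω => ∑ t ∈ Finset.range n, ind (A t) ω) P := fun hA n =>
    integrable_finsetSum _ fun t _ => (integrable_const (1 : ℝ)).indicator (hA t)
  set K := ∑ t ∈ Finset.range n, P.real (runStart (changedTraining W π b₁ bK d) t) with hK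
  have h1 : K ≤ 1 + ∑ t ∈ Finset.range n, P.real (changedStageEnd W π b₁ bK d t) +
      ∑ t ∈ Finset.range n, P.real (misdetection W π b₁ bK d t) := by
    rw [hK, ← integral_sum_ind hm, ← integral_sum_ind changedStageEnd_meas,
      ← integral_sum_ind misdetection_meas]
    calc _ ≤ ∫ ω, (1 + ∑ t ∈ Finset.range n, ind (changedStageEnd W π b₁ bK d t) ω +
        ∑ t ∈ Finset.range n, ind (misdetection W π b₁ bK d t) ω) ∂P :=
          integral_mono (hi hm n) (((integrable_const 1).add (hi changedStageEnd_meas n)).add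
            (hi misdetection_meas n)) fun ω => sum_runStart_changedTraining_le n
      _ = _ := by
          have hA : Integrable (fun ω => 1 + ∑ t ∈ Finset.range n,
              ind (changedStageEnd W π b₁ bK d t) ω) P :=
            (integrable_const 1).add (hi changedStageEnd_meas n)
          rw [integral_add hA (hi misdetection_meas n), integral_add (integrable_const 1)
            (hi changedStageEnd_meas n)]
          simp
  have h2 : ∑ t ∈ Finset.range n, P.real (changedStageEnd W π b₁ bK d t) ≤ 1 / (1 + b₁) := by
    have := sum_real_le_of_sum_ind_le (P := P) (c := 0) (n := n) (m := n)
      (changedStageEnd_meas (W := W) (π := π) (b₁ := b₁) (bK := bK) (d := d)) laterChange_meas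
      fun ω => by simpa using sum_changedStageEnd_le (W := W) (π := π) (ω := ω) n
    rw [zero_add] at this
    exact this.trans (sum_laterChange_real_le H hR hb₁ n)
  have h3 : d * ∑ t ∈ Finset.range n, P.real (misdetection W π b₁ bK d t) ≤ K := by
    refine (sum_misdetection_le hR (by linarith) n).trans ?_
    have := sum_real_le_of_sum_ind_le (P := P) (c := 0) (n := n) (m := n)
      (lateStart_meas (W := W) (π := π) (b₁ := b₁) (bK := bK) (d := d)) hm
      fun ω => by simpa using sum_lateStart_le (W := W) (π := π) (ω := ω) n
    rwa [zero_add] at this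
  have hd0 : 0 < d := by linarith
  have h4 : ∑ t ∈ Finset.range n, P.real (misdetection W π b₁ bK d t) ≤ 1 / d * K := by
    rw [one_div, ← div_eq_inv_mul, le_div_iff₀ hd0]
    linarith
  have h5 : 0 < 1 - 1 / d := by
    rw [sub_pos, div_lt_one hd0]
    exact hd
  rw [le_div_iff₀ h5]
  linarith

/-- An assessment stage that begins after the change follows a run of training steps after it. -/
lemma sum_runStart_lateStep_le (H : TransitionBounds π ζ κ₁ κK t₀) (hR : R.Regular)
    (hb₁ : 0 < b₁) (hd : 1 < d) (n : ℕ) :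
    ∑ t ∈ Finset.range n, P.real (runStart (lateStep W π b₁ bK d) t) ≤
      (1 + 1 / (1 + b₁)) / (1 - 1 / d) := by
  have hm : ∀ t, MeasurableSet (runStart (changedTraining W π b₁ bK d) t) :=
    measurableSet_runStart fun t => W.mid_le _ _ (changedTraining_mid t)
  have h1 : ∑ t ∈ Finset.range n, P.real (runStart (lateStep W π b₁ bK d) t) ≤
      ∑ t ∈ Finset.range n, P.real (lateStart W π b₁ bK d t) := by
    rcases n with _ | n
    · simp
    · rw [Finset.sum_range_succ']
      have h0 : runStart (lateStep W π b₁ bK d) 0 = ∅ := by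
        ext ω
        exact iff_of_false runStart_lateStep_zero (notMem_empty ω)
      rw [h0, measureReal_empty, add_zero, Finset.sum_range_succ]
      have h3 := Finset.sum_le_sum fun t (_ : t ∈ Finset.range n) =>
        measureReal_mono (μ := P) (fun ω hω => runStart_lateStep (W := W) (π := π) (b₁ := b₁)
          (bK := bK) (d := d) (t := t) hω)
      have h4 : 0 ≤ P.real (lateStart W π b₁ bK d n) := measureReal_nonneg
      linarith
  have h2 := sum_real_le_of_sum_ind_le (P := P) (c := 0) (n := n) (m := n)
      (lateStart_meas (W := W) (π := π) (b₁ := b₁) (bK := bK) (d := d)) hm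
      fun ω => by simpa using sum_lateStart_le (W := W) (π := π) (ω := ω) n
  rw [zero_add] at h2
  exact h1.trans (h2.trans (sum_runStart_changedTraining_real_le H hR hb₁ hd n))

/-- In the first stage the latent state is that under constant assignment of the first treatment. -/
lemma sum_firstTraining_le (hlam : lam W π 0 ≠ ⊤) (n : ℕ) :
    ∑ t ∈ Finset.range n, P.real (firstTraining W π b₁ bK d t) ≤ (lam W π 0).toReal := by
  have h1 : ∀ t, firstTraining W π b₁ bK d t ⊆
      {ω | state W π (fun _ _ => 0) (t + 1) ω = 0} := by
    rintro t ω ⟨hf, hs⟩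
    change state W π (fun _ _ => 0) (t + 1) ω = 0
    rw [← show state W π (proposedRule W π b₁ bK d) (t + 1) ω = 0 from hs]
    refine latent_congr fun s hs' => ?_
    unfold transProb
    congr 1
    funext i
    exact (proposedRule_of_notMem (hf i (by omega))).symm
  have h2 : ∑ t ∈ Finset.range n, P (firstTraining W π b₁ bK d t) ≤ lam W π 0 := by
    rw [lam_eq_tsum, tsum_eq_zero_add' ENNReal.summable]
    refine (Finset.sum_le_sum fun t _ => measure_mono (h1 t)).trans ?_
    exact (ENNReal.sum_le_tsum _).trans le_add_self
  have := ENNReal.toReal_mono hlam h2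
  rwa [ENNReal.toReal_sum fun _ _ => measure_ne_top _ _] at this

/-- The expected number of steps before the change. -/
lemma sum_inState_zero_le (H : TransitionBounds π ζ κ₁ κK t₀) (hR : R.Regular)
    (hlam : lam W π 0 ≠ ⊤) (hb₁ : 0 < b₁) (hd : 1 ≤ d) {B : ℝ} (hB : 0 ≤ B)
    (hJ : 0 < ∫ v, min (W.logDown (Fin.last k) v) B ∂unif) (n : ℕ) :
    ∑ t ∈ Finset.range n, P.real (inState W π b₁ bK d 0 (t + 1)) ≤
      (lam W π 0).toReal + 1 / (1 + b₁) / ζ +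
        (Real.log d + B) * (1 / (1 + b₁) + 1 / (1 + b₁) / ζ) /
          ∫ v, min (W.logDown (Fin.last k) v) B ∂unif := by
  have h1 : ∀ t, P.real (inState W π b₁ bK d 0 (t + 1)) ≤ P.real (firstTraining W π b₁ bK d t) +
      P.real (earlyTraining W π b₁ bK d t) + P.real (earlyAssess W π b₁ bK d t) := fun t =>
    (measureReal_mono fun ω hω => inState_zero_cover hω).trans ((measureReal_union_le _ _).trans
      (add_le_add_left (measureReal_union_le _ _) _))
  refine (Finset.sum_le_sum fun t _ => h1 t).trans ?_
  rw [Finset.sum_add_distrib, Finset.sum_add_distrib]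
  refine add_le_add (add_le_add (sum_firstTraining_le hlam n) (sum_earlyTraining_le H hR hb₁ n)) ?_
  rw [le_div_iff₀ hJ, mul_comm]
  exact (sum_earlyAssess_le H hR hd hB n).trans (mul_le_mul_of_nonneg_left
    (sum_runStart_earlyAssess_le H hR hb₁ n) (add_nonneg (Real.log_nonneg hd) hB))

/-- The expected stopping time, truncated at time `n`. -/
theorem sum_alive_le (H : TransitionBounds π ζ κ₁ κK t₀) (hR : R.Regular)
    (hlam : lam W π 0 ≠ ⊤) (hb₁ : 0 < b₁) (hζ : ζ ≤ b₁) (hbK : b₁ ≤ bK) (hd : 1 < d) {B : ℝ}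
    (hB : 0 ≤ B) (hJ : 0 < ∫ v, min (W.logDown (Fin.last k) v) B ∂unif)
    (hI₁ : 0 < ∫ v, min (W.logUp 0 v) B ∂unif + κ₁)
    (hIK : 0 < ∫ v, min (W.logUp (Fin.last k) v) B ∂unif + κK) (n : ℕ) :
    ∑ t ∈ Finset.range n, P.real (alive W π b₁ bK d t) ≤
      (lam W π 0).toReal + 1 / (1 + b₁) / ζ +
        (Real.log d + B) * (1 / (1 + b₁) + 1 / (1 + b₁) / ζ) /
          ∫ v, min (W.logDown (Fin.last k) v) B ∂unif +
      ((Real.log b₁ - Real.log ζ + B + κ₁) * ((1 + 1 / (1 + b₁)) / (1 - 1 / d)) + κ₁ * t₀) /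
        (∫ v, min (W.logUp 0 v) B ∂unif + κ₁) +
      ((Real.log bK - Real.log b₁ + B + κK) * ((1 + 1 / (1 + b₁)) / (1 - 1 / d)) + κK * t₀) /
        (∫ v, min (W.logUp (Fin.last k) v) B ∂unif + κK) +
      ((Real.log bK - Real.log b₁ + Real.log d + B + κK) * (1 / (1 + b₁)) + κK * t₀) /
        (∫ v, min (W.logUp (Fin.last k) v) B ∂unif + κK) := by
  have h1 : ∀ t, P.real (alive W π b₁ bK d t) ≤ P.real (inState W π b₁ bK d 0 (t + 1)) +
      P.real (changedTraining W π b₁ bK d t) + P.real (lateStep W π b₁ bK d t) +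
      P.real (changedAssess W π b₁ bK d t) := fun t =>
    (measureReal_mono fun ω hω => alive_cover hω).trans ((measureReal_union_le _ _).trans
      (add_le_add_left ((measureReal_union_le _ _).trans
        (add_le_add_left (measureReal_union_le _ _) _)) _))
  refine (Finset.sum_le_sum fun t _ => h1 t).trans ?_
  rw [Finset.sum_add_distrib, Finset.sum_add_distrib, Finset.sum_add_distrib]
  have hl1 : 0 ≤ Real.log b₁ - Real.log ζ := sub_nonneg.2 (Real.log_le_log H.zeta_pos hζ)
  have hl2 : 0 ≤ Real.log bK - Real.log b₁ := sub_nonneg.2 (Real.log_le_log hb₁ hbK)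
  have hl3 : 0 ≤ Real.log d := Real.log_nonneg hd.le
  have hκ₁ := H.first_nonneg
  have hκK := H.last_nonneg
  refine add_le_add (add_le_add (add_le_add
    (sum_inState_zero_le H hR hlam hb₁ hd.le hB hJ n) ?_) ?_) ?_
  · rw [le_div_iff₀ hI₁, mul_comm]
    refine (sum_changedTraining_le H hR hζ hB n).trans ?_
    gcongr
    exact sum_runStart_changedTraining_real_le H hR hb₁ hd n
  · rw [le_div_iff₀ hIK, mul_comm]
    refine (sum_lateStep_le H hR hb₁ hbK hB n).trans ?_
    gcongr
    exact sum_runStart_lateStep_le H hR hb₁ hd n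
  · rw [le_div_iff₀ hIK, mul_comm]
    refine (sum_changedAssess_le H hR hb₁ hbK hd.le hB n).trans ?_
    gcongr
    exact sum_runStart_changedAssess_le H hR hb₁ n

end Renewal

/-! ### The change-point under constant and under maximal transition probabilities -/

/-- A change is the earlier, the larger the transition probabilities are. -/
lemma latent_eq_zero_of_le {Ω : Type*} {U q q' : ℕ → Ω → ℝ} {ω : Ω} (h : ∀ t, q t ω ≤ q' t ω)
    {t : ℕ} (h0 : latent U q' t ω = 0) : latent U q t ω = 0 := by
  induction t with
  | zero => rw [latent_zero_eq_zero] at *; exact (h 0).trans_lt h0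
  | succ t ih =>
    rw [latent_succ_eq_zero] at *
    exact ⟨ih h0.1, (h _).trans_lt h0.2⟩

section ConstantTreatment

variable {k : ℕ} {𝕐 : Type*} [MeasurableSpace 𝕐] {R : ResponseModel k 𝕐}
  {Ω : Type*} [mΩ : MeasurableSpace Ω] {P : Measure Ω}

lemma piStar_ge (π : Transition k) (t : ℕ) (z : Fin t → Fin (k + 1)) : π t z ≤ piStar π t :=
  le_ciSup (Set.finite_range (π t)).bddAbove z

/-- The latent state at time `t` under the maximal transition probabilities. -/
def maxState (W : Noise R P) (π : Transition k) : ℕ → Ω → Fin 2 :=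
  latent W.U fun t _ => piStar π t

lemma state_eq_zero_of_maxState {W : Noise R P} {π : Transition k} (X : ℕ → Ω → Fin (k + 1)) {t : ℕ}
    {ω : Ω} (h : maxState W π t ω = 0) : state W π X t ω = 0 :=
  latent_eq_zero_of_le (fun t => piStar_ge π t _) h

lemma measurableSet_maxState (W : Noise R P) (π : Transition k) (t : ℕ) :
    MeasurableSet {ω | maxState W π t ω = 0} :=
  W.mid_le _ _ (measurable_latent W (q := fun t _ => piStar π t) t (fun _ _ => measurable_const)
    (measurableSet_singleton 0))

lemma firstOne_maxState_le (W : Noise R P) (π : Transition k) (X : ℕ → Ω → Fin (k + 1)) (ω : Ω) :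
    firstOne (maxState W π) ω ≤ changePoint W π X ω := by
  refine le_of_forall_lt fun c hc => ?_
  lift c to ℕ using ne_top_of_lt hc
  exact lt_firstOne_latent.2 (state_eq_zero_of_maxState X (lt_firstOne_latent.1 hc))

variable [IsProbabilityMeasure P]

/-- With transition probabilities at least `ζ`, the change-point under the first treatment has
geometric tails. -/
lemma measure_constState_le (W : Noise R P) {π : Transition k} {ζ : ℝ} (h0 : 0 ≤ ζ) (h1 : ζ < 1)
    (hζ : ∀ t (z : Fin t → Fin (k + 1)), ζ ≤ π (t + 1) (Fin.snoc z 0)) (t : ℕ) :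
    P {ω | state W π (fun _ _ => 0) t ω = 0} ≤ ENNReal.ofReal (1 - ζ) ^ t := by
  induction t with
  | zero => simpa using prob_le_one
  | succ t ih =>
    have hsub : {ω | state W π (fun _ _ => 0) (t + 1) ω = 0} ⊆
        {ω | state W π (fun _ _ => 0) t ω = 0} ∩ W.U (t + 1) ⁻¹' Ioi ζ := by
      intro ω hω
      have h := latent_succ_eq_zero.1 hω
      refine ⟨h.1, lt_of_le_of_lt ?_ h.2⟩
      rw [transProb_succ]
      exact hζ t _
    have hind : P ({ω | state W π (fun _ _ => 0) t ω = 0} ∩ W.U (t + 1) ⁻¹' Ioi ζ) =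
        P {ω | state W π (fun _ _ => 0) t ω = 0} * P (W.U (t + 1) ⁻¹' Ioi ζ) :=
      Indep_iff _ _ P |>.1 (W.indep_U (t + 1)) _ _
        (W.mid_le_before t _ (measurableSet_state W π (fun _ => measurable_const) t 0))
        ⟨_, measurableSet_Ioi, rfl⟩
    calc _ ≤ _ := measure_mono hsub
      _ = _ := hind
      _ ≤ ENNReal.ofReal (1 - ζ) ^ t * ENNReal.ofReal (1 - ζ) := by
        refine mul_le_mul' ih (le_of_eq ?_)
        rw [← Measure.map_apply (W.U_meas _) measurableSet_Ioi, W.U_law, unif_Ioi h0 h1]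
      _ = _ := (pow_succ _ _).symm

lemma lam_ne_top (W : Noise R P) {π : Transition k} {ζ : ℝ} (h0 : 0 < ζ) (h1 : ζ < 1)
    (hζ : ∀ t (z : Fin t → Fin (k + 1)), ζ ≤ π (t + 1) (Fin.snoc z 0)) : lam W π 0 ≠ ⊤ := by
  rw [lam_eq_tsum]
  refine ne_top_of_le_ne_top ?_ (ENNReal.tsum_le_tsum (measure_constState_le W h0.le h1 hζ))
  rw [ENNReal.tsum_geometric, ENNReal.inv_ne_top, Ne, tsub_eq_zero_iff_le, not_le,
    ENNReal.ofReal_lt_one]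
  linarith

/-- An event of small probability contributes little to the expected change-point under the maximal
transition probabilities. -/
lemma tsum_inter_maxState_le (W : Noise R P) {π : Transition k} {ζ a : ℝ} (h0 : 0 < ζ) (h1 : ζ < 1)
    (hζ : ∀ t (z : Fin t → Fin (k + 1)), ζ ≤ π (t + 1) (Fin.snoc z 0)) {A : Set Ω} (ha : 0 ≤ a)
    (hA : P A ≤ ENNReal.ofReal a) :
    ∑' t, P (A ∩ {ω | maxState W π t ω = 0}) ≤ ENNReal.ofReal (2 * √a / ζ) := by
  set r := √(1 - ζ) with hr
  have hr1 : r ≤ 1 - ζ / 2 := by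
    rw [hr, Real.sqrt_le_left (by linarith)]
    nlinarith [sq_nonneg ζ]
  have hr0 : 0 ≤ r := Real.sqrt_nonneg _
  have key : ∀ t, P (A ∩ {ω | maxState W π t ω = 0}) ≤ ENNReal.ofReal (√a * r ^ t) := by
    intro t
    have e1 : P (A ∩ {ω | maxState W π t ω = 0}) ≤ ENNReal.ofReal a :=
      (measure_mono inter_subset_left).trans hA
    have e2 : P (A ∩ {ω | maxState W π t ω = 0}) ≤ ENNReal.ofReal ((1 - ζ) ^ t) := by
      rw [ENNReal.ofReal_pow (by linarith)]
      exact (measure_mono (inter_subset_right.trans fun ω hω =>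
        state_eq_zero_of_maxState _ hω)).trans (measure_constState_le W h0.le h1 hζ t)
    refine (le_min e1 e2).trans ?_
    rw [← ENNReal.ofReal_min]
    refine ENNReal.ofReal_le_ofReal ?_
    have hb : 0 ≤ (1 - ζ) ^ t := pow_nonneg (by linarith) _
    have e3 : √a * r ^ t = √(a * (1 - ζ) ^ t) := by
      rw [Real.sqrt_mul ha, hr, Real.sqrt_eq_rpow (1 - ζ), Real.sqrt_eq_rpow ((1 - ζ) ^ t),
        ← Real.rpow_natCast, ← Real.rpow_natCast, ← Real.rpow_mul (by linarith),
        ← Real.rpow_mul (by linarith), mul_comm (1 / 2 : ℝ)]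
    rw [e3]
    refine Real.le_sqrt_of_sq_le ?_
    rw [sq]
    exact mul_le_mul (min_le_left _ _) (min_le_right _ _) (le_min ha hb) ha
  have hs : HasSum (fun t : ℕ => √a * r ^ t) (√a * (1 - r)⁻¹) :=
    (hasSum_geometric_of_lt_one hr0 (by linarith)).mul_left _
  calc _ ≤ ∑' t, ENNReal.ofReal (√a * r ^ t) := ENNReal.tsum_le_tsum key
    _ = ENNReal.ofReal (√a * (1 - r)⁻¹) := by
      rw [← hs.tsum_eq, ENNReal.ofReal_tsum_of_nonneg (fun t => by positivity) hs.summable]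
    _ ≤ _ := by
      refine ENNReal.ofReal_le_ofReal ?_
      rw [div_eq_mul_inv, mul_comm 2 √a, mul_assoc]
      refine mul_le_mul_of_nonneg_left ?_ (Real.sqrt_nonneg a)
      rw [inv_le_comm₀ (by linarith) (by positivity), mul_inv, inv_inv]
      linarith

end ConstantTreatment

/-! ### The second moment of a sum of selected centred increments -/

section SecondMoment

variable {k : ℕ} {𝕐 : Type*} [MeasurableSpace 𝕐] {R : ResponseModel k 𝕐}
  {Ω : Type*} [mΩ : MeasurableSpace Ω] {P : Measure Ω}

/-- The increments `z x (V (t + 1))`, where the event `A t x` is known before `V (t + 1)` and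
selects the increment, are orthogonal if they are centred. -/
lemma integral_sum_sq_le (W : Noise R P) {ι : Type*} [Fintype ι] {A : ℕ → ι → Set Ω}
    (hA : ∀ t x, MeasurableSet[W.mid (t + 1)] (A t x))
    (hdis : ∀ t, Pairwise fun x y => Disjoint (A t x) (A t y)) {z : ι → ℝ → ℝ}
    (hz : ∀ x, Measurable (z x)) (hz2 : ∀ x, MemLp (z x) 2 unif) (hz0 : ∀ x, ∫ v, z x v ∂unif = 0)
    {σ : ℝ} (hσ : ∀ x, ∫ v, z x v ^ 2 ∂unif ≤ σ) (n : ℕ) :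
    Integrable (fun ω => (∑ t ∈ Finset.range n, ∑ x, ind (A t x) ω * z x (W.V (t + 1) ω)) ^ 2) P ∧
    ∫ ω, (∑ t ∈ Finset.range n, ∑ x, ind (A t x) ω * z x (W.V (t + 1) ω)) ^ 2 ∂P ≤
      σ * ∑ t ∈ Finset.range n, ∑ x, P.real (A t x) := by
  have hA' : ∀ t x, MeasurableSet (A t x) := fun t x => W.mid_le _ _ (hA t x)
  have hind : ∀ t x, Measurable[W.mid (t + 1)] (ind (A t x)) := fun t x =>
    measurable_const.indicator (hA t x)
  set ξ : ℕ → Ω → ℝ := fun t ω => ∑ x, ind (A t x) ω * z x (W.V (t + 1) ω) with hξ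
  set S : ℕ → Ω → ℝ := fun n ω => ∑ t ∈ Finset.range n, ξ t ω with hS
  have hVz : ∀ t x, MemLp (fun ω => z x (W.V t ω)) 2 P := fun t x => by
    have : MemLp (z x) 2 (P.map (W.V t)) := by rw [W.V_law]; exact hz2 x
    exact this.comp_of_map (W.V_meas t).aemeasurable
  have hterm : ∀ t x, MemLp (fun ω => ind (A t x) ω * z x (W.V (t + 1) ω)) 2 P := fun t x => by
    have : (fun ω => ind (A t x) ω * z x (W.V (t + 1) ω)) =
        (A t x).indicator (fun ω => z x (W.V (t + 1) ω)) := by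
      funext ω
      by_cases h : ω ∈ A t x <;> simp [ind, h]
    rw [this]
    exact (hVz _ x).indicator (hA' t x)
  have hξ2 : ∀ t, MemLp (ξ t) 2 P := fun t => memLp_finsetSum _ fun x _ => hterm t x
  have hS2 : ∀ n, MemLp (S n) 2 P := fun n => memLp_finsetSum _ fun t _ => hξ2 t
  have hξm : ∀ t, Measurable[W.before (t + 2)] (ξ t) := fun t =>
    Finset.measurable_fun_sum _ fun x _ =>
      ((hind t x).mono (W.mid_le_before _) le_rfl).mul ((hz x).comp (W.V_before (t + 1)))
  have hSm : ∀ n, Measurable[W.mid (n + 1)] (S n) := fun n =>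
    Finset.measurable_fun_sum _ fun t ht => (hξm t).mono ((W.before_mono (by
      rw [Finset.mem_range] at ht; omega)).trans (W.before_le_mid _)) le_rfl
  have hcross : ∀ n, ∫ ω, S n ω * ξ n ω ∂P = 0 := fun n => by
    have e : ∀ ω, S n ω * ξ n ω = ∑ x, (S n ω * ind (A n x) ω) * z x (W.V (n + 1) ω) := fun ω => by
      simp only [hξ, Finset.mul_sum, mul_assoc]
    simp_rw [e]
    rw [integral_finsetSum _ fun x _ => ?_]
    · refine Finset.sum_eq_zero fun x _ => ?_
      rw [setIntegral_indep (W.mid_le (n + 1)) (W.V_meas _) (W.indep_V _) (W.V_law _)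
        (f := fun ω => S n ω * ind (A n x) ω) ((hSm n).mul (hind n x)) (hz x), hz0, mul_zero]
    · simp_rw [mul_assoc]
      exact (hS2 n).integrable_mul (hterm n x)
  have hsq : ∀ n, ∫ ω, ξ n ω ^ 2 ∂P ≤ σ * ∑ x, P.real (A n x) := fun n => by
    have e : ∀ ω, ξ n ω ^ 2 = ∑ x, ind (A n x) ω * z x (W.V (n + 1) ω) ^ 2 := fun ω => by
      by_cases h : ∃ x, ω ∈ A n x
      · obtain ⟨x, hx⟩ := h
        have h' : ∀ y, y ≠ x → ω ∉ A n y := fun y hy hy' =>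
          Set.disjoint_left.1 (hdis n hy) hy' hx
        simp only [hξ]
        rw [Finset.sum_eq_single x (fun y _ hy => by simp [ind, h' y hy]) (by simp),
          Finset.sum_eq_single x (fun y _ hy => by simp [ind, h' y hy]) (by simp)]
        simp [ind, hx]
      · push Not at h
        simp [hξ, ind, h]
    simp_rw [e]
    rw [integral_finsetSum _ fun x _ => ?_, Finset.mul_sum]
    · refine Finset.sum_le_sum fun x _ => ?_
      rw [setIntegral_indep (z := fun v => z x v ^ 2) (W.mid_le (n + 1)) (W.V_meas _)
        (W.indep_V _) (W.V_law _) (hind n x) ((hz x).pow_const 2), mul_comm]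
      refine mul_le_mul (hσ x) (le_of_eq (integral_indicator_one (hA' n x)))
        (integral_nonneg fun ω => indicator_nonneg (fun _ _ => zero_le_one) ω) ?_
      exact (integral_nonneg fun v => sq_nonneg _).trans (hσ x)
    · refine (hterm n x).integrable_sq.congr (ae_of_all _ fun ω => ?_)
      by_cases h : ω ∈ A n x <;> simp [ind, h]
  refine ⟨(hS2 n).integrable_sq, ?_⟩
  change ∫ ω, S n ω ^ 2 ∂P ≤ _
  induction n with
  | zero => simp [hS]
  | succ n ih =>
    have e : ∀ ω, S (n + 1) ω ^ 2 = S n ω ^ 2 + 2 * (S n ω * ξ n ω) + ξ n ω ^ 2 := fun ω => by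
      simp only [hS, Finset.sum_range_succ]; ring
    have i1 : Integrable (fun ω => 2 * (S n ω * ξ n ω)) P :=
      ((hS2 n).integrable_mul (hξ2 n)).const_mul 2
    have i2 : Integrable (fun ω => S n ω ^ 2 + 2 * (S n ω * ξ n ω)) P :=
      (hS2 n).integrable_sq.add i1
    simp_rw [e]
    rw [integral_add i2 (hξ2 n).integrable_sq, integral_add (hS2 n).integrable_sq i1,
      integral_const_mul, hcross, Finset.sum_range_succ, mul_add]
    linarith [hsq n]

end SecondMoment

/-! ### No procedure detects much faster -/

lemma ind_of_mem {Ω : Type*} {A : Set Ω} {ω : Ω} (h : ω ∈ A) : ind A ω = 1 := indicator_of_mem h _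

lemma ind_of_notMem {Ω : Type*} {A : Set Ω} {ω : Ω} (h : ω ∉ A) : ind A ω = 0 :=
  indicator_of_notMem h _

lemma measurableSet_lt_of_eq {Ω : Type*} {T : Ω → ℕ∞} {m : ℕ → MeasurableSpace Ω} (hm : Monotone m)
    (hT : ∀ t : ℕ, MeasurableSet[m t] {ω | T ω = t}) (j : ℕ) :
    MeasurableSet[m j] {ω | (j : ℕ∞) < T ω} := by
  have : {ω | (j : ℕ∞) < T ω} = (⋃ t : ℕ, ⋃ _ : t ≤ j, {ω | T ω = t})ᶜ := by
    ext ω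
    simp only [mem_ofPred_eq, mem_compl_iff, mem_iUnion, exists_prop, not_exists, not_and]
    constructor
    · rintro h t ht e
      rw [e, Nat.cast_lt] at h
      omega
    · intro h
      by_contra hc
      rw [not_lt] at hc
      generalize hT : T ω = c at *
      lift c to ℕ using ne_top_of_le_ne_top (ENat.natCast_ne_top j) hc
      exact h c (by exact_mod_cast hc) rfl
  rw [this]
  exact (MeasurableSet.iUnion fun t => MeasurableSet.iUnion fun ht => hm ht _ (hT t)).compl

section LowerBound

variable {k : ℕ} {𝕐 : Type*} [MeasurableSpace 𝕐] {R : ResponseModel k 𝕐}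
  {Ω : Type*} [mΩ : MeasurableSpace Ω] {P : Measure Ω}
  {W : Noise R P} {π : Transition k} {X : ℕ → Ω → Fin (k + 1)} {T : Ω → ℕ∞}

lemma changePoint_eq_iff {s : ℕ} {ω : Ω} :
    changePoint W π X ω = s ↔ ω ∈ changedAt W π X s := by
  have key : ∀ t : ℕ, (t : ℕ∞) < changePoint W π X ω ↔ state W π X t ω = 0 :=
    fun t => lt_firstOne_latent
  constructor
  · intro h
    simp only [h, Nat.cast_lt] at key
    exact ⟨by have := (key s).not; simp at this; omega, fun u hu => (key u).1 hu⟩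
  · rintro ⟨h1, h2⟩
    refine le_antisymm (not_lt.1 fun h => ?_) (le_of_forall_lt fun c hc => ?_)
    · have := (key s).1 h; omega
    · lift c to ℕ using ne_top_of_lt hc
      exact (key c).2 (h2 c (by exact_mod_cast hc))

/-- After a change at time `s`, each response contributes to the log-likelihood ratio of the change
at most the detection rate `D` plus a centred increment; the times before `t₀`, at which the
transition probabilities need not be close to their limits, contribute up to `C` in addition. -/
lemma changeWeight_le_exp {C D : ℝ} {t₀ : ℕ} (h0 : ∀ t z, 0 ≤ π t z) (h1 : ∀ t z, π t z < 1)
    (hC0 : 0 ≤ C) (hC : ∀ t z, -Real.log (1 - π t z) ≤ C) (hI : ∀ x, R.I x ≤ D)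
    (hD : ∀ t ≥ t₀, ∀ (z : Fin t → Fin (k + 1)) x,
      R.I x - Real.log (1 - π (t + 1) (Fin.snoc z x)) ≤ D) {ω : Ω}
    (hω : ∀ (t : ℕ) (x : Fin (k + 1)) (i : Fin 2),
      0 < R.f x (W.h x i (W.V t ω)) ∧ 0 < R.g x (W.h x i (W.V t ω))) {s : ℕ}
    (hs : state W π X s ω = 1) (t : ℕ) (hst : s ≤ t) :
    changeWeight W π X s t ω ≤ Real.exp (C + ∑ j ∈ Finset.range t, if s ≤ j + 1 then
      ((if j < t₀ then C else 0) + D +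
        (W.logUp (X (j + 1) ω) (W.V (j + 1) ω) - R.I (X (j + 1) ω))) else 0) := by
  have hq : ∀ t, 0 ≤ transProb π X t ω ∧ 0 < 1 - transProb π X t ω ∧
      1 / (1 - transProb π X t ω) ≤ Real.exp C := fun t => by
    have hlt : 0 < 1 - transProb π X t ω := by
      have := h1 t fun i => X (i + 1) ω
      unfold transProb; linarith
    refine ⟨h0 _ _, hlt, ?_⟩
    have h : -Real.log (1 - transProb π X t ω) ≤ C := hC t _
    rw [one_div, ← Real.log_le_iff_le_exp (inv_pos.2 hlt), Real.log_inv]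
    exact h
  induction t with
  | zero =>
    obtain rfl : s = 0 := by omega
    obtain ⟨a, b, c⟩ := hq 0
    simp only [changeWeight, if_true, Finset.range_zero, Finset.sum_empty, add_zero]
    refine le_trans ?_ c
    rw [div_le_div_iff_of_pos_right b]
    linarith
  | succ t ih =>
    obtain ⟨a, b, c⟩ := hq (t + 1)
    set E := C + ∑ j ∈ Finset.range t, if s ≤ j + 1 then
      ((if j < t₀ then C else 0) + D +
        (W.logUp (X (j + 1) ω) (W.V (j + 1) ω) - R.I (X (j + 1) ω))) else 0 with hE
    have hprev : (if s = t + 1 then transProb π X (t + 1) ω else changeWeight W π X s t ω) ≤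
        Real.exp E := by
      split_ifs with h
      · have : E = C := by
          rw [hE, Finset.sum_eq_zero fun j hj => ?_, add_zero]
          rw [Finset.mem_range] at hj
          rw [if_neg (by omega)]
        rw [this]
        have := Real.one_le_exp hC0
        linarith
      · exact ih (by omega)
    have hstate : state W π X (t + 1) ω = 1 := state_mono W π X hst hs
    have hlr : likRatio W π X (t + 1) ω =
        Real.exp (W.logUp (X (t + 1) ω) (W.V (t + 1) ω)) := by
      obtain ⟨hf, hg⟩ := hω (t + 1) (X (t + 1) ω) 1
      unfold likRatio response Noise.logUp
      rw [hstate, Real.exp_log (div_pos hg hf)]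
    have hfac : 1 / (1 - transProb π X (t + 1) ω) ≤
        Real.exp ((if t < t₀ then C else 0) + D - R.I (X (t + 1) ω)) := by
      have hIx := hI (X (t + 1) ω)
      split_ifs with ht
      · exact c.trans (Real.exp_le_exp.2 (by linarith))
      · have := hD t (by omega) (fun i : Fin t => X (i + 1) ω) (X (t + 1) ω)
        rw [← transProb_succ π X t ω] at this
        rw [one_div, ← Real.log_le_iff_le_exp (inv_pos.2 b), Real.log_inv]
        linarith
    rw [Finset.sum_range_succ, if_pos hst, ← add_assoc, ← hE]
    simp only [changeWeight]
    rw [hlr]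
    calc _ ≤ Real.exp E * Real.exp ((if t < t₀ then C else 0) + D - R.I (X (t + 1) ω)) *
          Real.exp (W.logUp (X (t + 1) ω) (W.V (t + 1) ω)) := by
          gcongr
      _ = _ := by
          rw [← Real.exp_add, ← Real.exp_add]
          congr 1
          ring

variable (W π X T) in
/-- Step `j + 1` assigns treatment `x`, precedes the stopping time, and is one of the first `m`
steps in the changed state. -/
def freshStep (m j : ℕ) (x : Fin (k + 1)) : Set Ω :=
  {ω | X (j + 1) ω = x ∧ state W π X (j + 1) ω = 1 ∧
    (m ≤ j + 1 → state W π X (j + 1 - m) ω = 0) ∧ (j : ℕ∞) < T ω}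

lemma measurableSet_freshStep (hX : ∀ t, Measurable[obs W π X t] (X (t + 1)))
    (hT : ∀ t : ℕ, MeasurableSet[obs W π X t] {ω | T ω = t}) (m j : ℕ) (x : Fin (k + 1)) :
    MeasurableSet[W.mid (j + 1)] (freshStep W π X T m j x) := by
  have hle : obs W π X j ≤ W.mid (j + 1) := (obs_le_before W π hX j).trans (W.before_le_mid _)
  refine MeasurableSet.inter (hle _ (hX j (measurableSet_singleton x)))
    (MeasurableSet.inter (measurableSet_state W π hX (j + 1) 1) (MeasurableSet.inter ?_
      (hle _ (measurableSet_lt_of_eq (fun s t h => obs_mono W π X h) hT j))))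
  by_cases hm : m ≤ j + 1
  · have : {ω | m ≤ j + 1 → state W π X (j + 1 - m) ω = 0} =
        {ω | state W π X (j + 1 - m) ω = 0} := by ext ω; simp [hm]
    change MeasurableSet[W.mid (j + 1)] {ω | m ≤ j + 1 → state W π X (j + 1 - m) ω = 0}
    rw [this]
    exact W.mid_mono (by omega) _ (measurableSet_state W π hX _ 0)
  · have : {ω : Ω | m ≤ j + 1 → state W π X (j + 1 - m) ω = 0} = univ := by ext ω; simp [hm]
    change MeasurableSet[W.mid (j + 1)] {ω | m ≤ j + 1 → state W π X (j + 1 - m) ω = 0}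
    rw [this]
    exact MeasurableSet.univ

lemma sum_freshStep_le (m n : ℕ) (ω : Ω) :
    ∑ j ∈ Finset.range n, ∑ x, ind (freshStep W π X T m j x) ω ≤ m := by
  classical
  set F := (Finset.range n).filter fun j => state W π X (j + 1) ω = 1 ∧
    (m ≤ j + 1 → state W π X (j + 1 - m) ω = 0) with hF
  have h1 : ∀ j, ∑ x, ind (freshStep W π X T m j x) ω ≤
      if state W π X (j + 1) ω = 1 ∧ (m ≤ j + 1 → state W π X (j + 1 - m) ω = 0) then 1 else 0 := by
    intro j
    rw [Finset.sum_eq_single (X (j + 1) ω) (fun x _ hx => indicator_of_notMem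
      (fun h => hx h.1.symm) _) (by simp)]
    split_ifs with h
    · exact ind_le_one _ _
    · exact le_of_eq (indicator_of_notMem (fun h' => h ⟨h'.2.1, h'.2.2.1⟩) _)
  refine (Finset.sum_le_sum fun j _ => h1 j).trans ?_
  rw [← Finset.sum_filter, ← hF, Finset.sum_const, nsmul_eq_mul, mul_one, Nat.cast_le]
  rcases F.eq_empty_or_nonempty with he | he
  · simp [he]
  · set j₀ := F.min' he with hj₀
    have hj : state W π X (j₀ + 1) ω = 1 := (Finset.mem_filter.1 (F.min'_mem he)).2.1
    have hsub : F ⊆ Finset.Ico j₀ (j₀ + m) := fun j hjF => by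
      rw [Finset.mem_Ico]
      refine ⟨F.min'_le j hjF, ?_⟩
      by_contra hc
      have h2 := (Finset.mem_filter.1 hjF).2.2 (by omega)
      have h3 := state_mono W π X (show j₀ + 1 ≤ j + 1 - m by omega) hj
      omega
    simpa using Finset.card_le_card hsub

/-- If the procedure stops fewer than `m` steps after the change, then a large likelihood ratio
forces the sum of the selected centred increments to be large. -/
lemma le_sum_freshStep {C D a c : ℝ} {t₀ m : ℕ} (h0 : ∀ t z, 0 ≤ π t z) (h1 : ∀ t z, π t z < 1)
    (hC0 : 0 ≤ C) (hC : ∀ t z, -Real.log (1 - π t z) ≤ C) (hD0 : 0 ≤ D) (hI : ∀ x, R.I x ≤ D)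
    (hD : ∀ t ≥ t₀, ∀ (z : Fin t → Fin (k + 1)) x,
      R.I x - Real.log (1 - π (t + 1) (Fin.snoc z x)) ≤ D)
    (hc : C + C * t₀ + m * D + a ≤ c) {ω : Ω}
    (hω : ∀ (t : ℕ) (x : Fin (k + 1)) (i : Fin 2),
      0 < R.f x (W.h x i (W.V t ω)) ∧ 0 < R.g x (W.h x i (W.V t ω))) {s t n : ℕ}
    (hs : ω ∈ changedAt W π X s) (hT : T ω = t) (hst : s ≤ t) (htm : t < s + m) (htn : t ≤ n)
    (hw : Real.exp c < changeWeight W π X s t ω) :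
    a ≤ ∑ j ∈ Finset.range n, ∑ x, ind (freshStep W π X T m j x) ω *
      (W.logUp x (W.V (j + 1) ω) - R.I x) := by
  have h := hw.trans_le (changeWeight_le_exp h0 h1 hC0 hC hI hD hω hs.1 t hst)
  rw [Real.exp_lt_exp] at h
  have hsplit : ∀ j ∈ Finset.range t, (if s ≤ j + 1 then ((if j < t₀ then C else 0) + D +
      (W.logUp (X (j + 1) ω) (W.V (j + 1) ω) - R.I (X (j + 1) ω))) else 0) ≤
      (if j < t₀ then C else 0) + (if s ≤ j + 1 then D else 0) +
      ∑ x, ind (freshStep W π X T m j x) ω * (W.logUp x (W.V (j + 1) ω) - R.I x) := by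
    intro j hj
    rw [Finset.mem_range] at hj
    have hCj : 0 ≤ if j < t₀ then C else 0 := by split_ifs <;> simp [hC0]
    by_cases hsj : s ≤ j + 1
    · have hmem : ω ∈ freshStep W π X T m j (X (j + 1) ω) :=
        ⟨rfl, state_mono W π X hsj hs.1, fun _ => hs.2 _ (by omega), by rw [hT]; exact_mod_cast hj⟩
      rw [Finset.sum_eq_single (X (j + 1) ω) (fun x _ hx => by
        rw [ind_of_notMem fun h => hx h.1.symm, zero_mul]) (by simp),
        ind_of_mem hmem, if_pos hsj, if_pos hsj, one_mul]
    · have hne : ∀ x, ω ∉ freshStep W π X T m j x := fun x hx => by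
        have h1 := hx.2.1
        have h2 := hs.2 (j + 1) (by omega)
        omega
      rw [Finset.sum_eq_zero fun x _ => by rw [ind_of_notMem (hne x), zero_mul],
        if_neg hsj, if_neg hsj]
      linarith
  have hsum := Finset.sum_le_sum hsplit
  rw [Finset.sum_add_distrib, Finset.sum_add_distrib] at hsum
  have hs1 : ∑ j ∈ Finset.range t, (if j < t₀ then C else 0) ≤ C * t₀ := by
    rw [← Finset.sum_filter, Finset.sum_const, nsmul_eq_mul, mul_comm]
    refine mul_le_mul_of_nonneg_left ?_ hC0
    have : (Finset.range t).filter (· < t₀) ⊆ Finset.range t₀ := fun j hj => by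
      simp only [Finset.mem_filter, Finset.mem_range] at *; omega
    simpa using Finset.card_le_card this
  have hs2 : ∑ j ∈ Finset.range t, (if s ≤ j + 1 then D else 0) ≤ m * D := by
    rw [← Finset.sum_filter, Finset.sum_const, nsmul_eq_mul]
    refine mul_le_mul_of_nonneg_right ?_ hD0
    have : (Finset.range t).filter (s ≤ · + 1) ⊆ Finset.Ico (s - 1) t := fun j hj => by
      simp only [Finset.mem_filter, Finset.mem_range, Finset.mem_Ico] at *; omega
    have h2 := Finset.card_le_card this
    rw [Nat.card_Ico] at h2
    exact_mod_cast h2.trans (by omega)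
  have htail : ∑ j ∈ Finset.range n, ∑ x, ind (freshStep W π X T m j x) ω *
      (W.logUp x (W.V (j + 1) ω) - R.I x) = ∑ j ∈ Finset.range t, ∑ x,
      ind (freshStep W π X T m j x) ω * (W.logUp x (W.V (j + 1) ω) - R.I x) := by
    refine (Finset.sum_subset (Finset.range_subset_range.2 htn) fun j _ hj => ?_).symm
    rw [Finset.mem_range, not_lt] at hj
    refine Finset.sum_eq_zero fun x _ => ?_
    rw [ind_of_notMem fun h => ?_, zero_mul]
    have h2 := h.2.2.2
    rw [hT, Nat.cast_lt] at h2
    omega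
  rw [htail]
  linarith

end LowerBound

section EarlyDetection

variable {k : ℕ} {𝕐 : Type*} [MeasurableSpace 𝕐] {R : ResponseModel k 𝕐}
  {Ω : Type*} [mΩ : MeasurableSpace Ω] {P : Measure Ω}
  {W : Noise R P} {π : Transition k} {X : ℕ → Ω → Fin (k + 1)} {T : Ω → ℕ∞}

lemma measurableSet_lt_changePoint (hX : ∀ t, Measurable[obs W π X t] (X (t + 1)))
    (hT : ∀ t : ℕ, MeasurableSet[obs W π X t] {ω | T ω = t}) (t : ℕ) :
    MeasurableSet ({ω | state W π X t ω = 0} ∩ {ω | T ω = t}) :=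
  (W.mid_le _ _ (measurableSet_state W π hX t 0)).inter (obs_le W π hX t _ (hT t))

variable [IsProbabilityMeasure P]

/-- Stopping fewer than `m` steps after the change while the likelihood ratio is at most `b`: by
the change of measure each pair of a change time and a stopping time costs at most `b` times the
probability of a false alarm. -/
lemma measure_early_small_le (hR : R.Regular) (h0 : ∀ t z, 0 ≤ π t z) (h1 : ∀ t z, π t z < 1)
    (hX : ∀ t, Measurable[obs W π X t] (X (t + 1)))
    (hT : ∀ t : ℕ, MeasurableSet[obs W π X t] {ω | T ω = t}) (m : ℕ) (b : ℝ) :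
    P {ω | ∃ t s : ℕ, s ≤ t ∧ t < s + m ∧ ω ∈ changedAt W π X s ∧ T ω = t ∧
        changeWeight W π X s t ω ≤ b} ≤
      m * ENNReal.ofReal b * P {ω | T ω < changePoint W π X ω} := by
  classical
  have hG : ∀ t s : ℕ, s ≤ t → P (changedAt W π X s ∩ ({ω | T ω = t} ∩
      {ω | changeWeight W π X s t ω ≤ b})) ≤
      ENNReal.ofReal b * P ({ω | state W π X t ω = 0} ∩ {ω | T ω = t}) := by
    intro t s hst
    have hle := obs_le W π hX t
    set B : Set Ω := {ω | T ω = t} ∩ {ω | changeWeight W π X s t ω ≤ b} with hB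
    have hBm : MeasurableSet[obs W π X t] B := (hT t).inter
      (measurable_changeWeight W π hX s t measurableSet_Iic)
    have h := setLIntegral_changedAt W hR h0 h1 hX t s hst (B.indicator fun _ => 1)
      (measurable_const.indicator hBm)
    rw [lintegral_indicator (hle _ hBm), Measure.restrict_restrict (hle _ hBm), inter_comm,
      setLIntegral_one] at h
    rw [h]
    calc _ ≤ ∫⁻ ω in {ω | state W π X t ω = 0}, {ω | T ω = t}.indicator
          (fun _ => ENNReal.ofReal b) ω ∂P := by
          refine lintegral_mono fun ω => ?_
          by_cases hω : ω ∈ B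
          · simp only [indicator_of_mem hω, one_mul, indicator_of_mem (hω.1 : ω ∈ {ω | T ω = t})]
            exact ENNReal.ofReal_le_ofReal hω.2
          · simp [indicator_of_notMem hω]
      _ = _ := by
          rw [lintegral_indicator (hle _ (hT t)), Measure.restrict_restrict (hle _ (hT t)),
            setLIntegral_const, inter_comm]
  have hsub : {ω | ∃ t s : ℕ, s ≤ t ∧ t < s + m ∧ ω ∈ changedAt W π X s ∧ T ω = t ∧
        changeWeight W π X s t ω ≤ b} ⊆
      ⋃ t : ℕ, ⋃ s ∈ (Finset.range (t + 1)).filter (t < · + m), changedAt W π X s ∩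
        ({ω | T ω = t} ∩ {ω | changeWeight W π X s t ω ≤ b}) := by
    rintro ω ⟨t, s, h1, h2, h3, h4, h5⟩
    refine mem_iUnion.2 ⟨t, mem_iUnion₂.2 ⟨s, ?_, h3, h4, h5⟩⟩
    simp only [Finset.mem_filter, Finset.mem_range]
    omega
  have hcard : ∀ t, ((Finset.range (t + 1)).filter (t < · + m)).card ≤ m := fun t => by
    have h2 : (Finset.range (t + 1)).filter (t < · + m) ⊆ Finset.Ico (t + 1 - m) (t + 1) :=
      fun j hj => by
        simp only [Finset.mem_filter, Finset.mem_range, Finset.mem_Ico] at *; omega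
    have h3 := Finset.card_le_card h2
    rw [Nat.card_Ico] at h3
    omega
  calc _ ≤ ∑' t : ℕ, ∑ s ∈ (Finset.range (t + 1)).filter (t < · + m), P (changedAt W π X s ∩
        ({ω | T ω = t} ∩ {ω | changeWeight W π X s t ω ≤ b})) :=
        (measure_mono hsub).trans ((measure_iUnion_le _).trans
          (ENNReal.tsum_le_tsum fun t => measure_biUnion_finset_le _ _))
    _ ≤ ∑' t : ℕ, m * ENNReal.ofReal b * P ({ω | state W π X t ω = 0} ∩ {ω | T ω = t}) := by
        refine ENNReal.tsum_le_tsum fun t => ?_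
        refine (Finset.sum_le_sum fun s hs => hG t s ?_).trans ?_
        · simp only [Finset.mem_filter, Finset.mem_range] at hs; omega
        · rw [Finset.sum_const, nsmul_eq_mul, ← mul_assoc]
          gcongr
          exact hcard t
    _ = m * ENNReal.ofReal b * P (⋃ t : ℕ, {ω | state W π X t ω = 0} ∩ {ω | T ω = t}) := by
        rw [ENNReal.tsum_mul_left, measure_iUnion _ (measurableSet_lt_changePoint hX hT)]
        intro s t hst
        refine Set.disjoint_left.2 fun ω h h' => hst ?_
        have h2 : ((s : ℕ) : ℕ∞) = t := h.2.symm.trans h'.2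
        exact_mod_cast h2
    _ ≤ _ := by
        gcongr
        refine iUnion_subset fun t ω hω => ?_
        have h2 : T ω = t := hω.2
        change T ω < changePoint W π X ω
        rw [h2]
        exact lt_firstOne_latent.2 hω.1

/-- Stopping fewer than `m` steps after the change while the likelihood ratio is large is unlikely,
by Chebyshev's inequality. -/
lemma measure_early_large_le (hR : R.Regular) {C D a c σ : ℝ} {t₀ m : ℕ} (h0 : ∀ t z, 0 ≤ π t z)
    (h1 : ∀ t z, π t z < 1) (hC0 : 0 ≤ C) (hC : ∀ t z, -Real.log (1 - π t z) ≤ C) (hD0 : 0 ≤ D)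
    (hI : ∀ x, R.I x ≤ D) (hD : ∀ t ≥ t₀, ∀ (z : Fin t → Fin (k + 1)) x,
      R.I x - Real.log (1 - π (t + 1) (Fin.snoc z x)) ≤ D)
    (hc : C + C * t₀ + m * D + a ≤ c) (ha : 0 < a) (hσ0 : 0 ≤ σ)
    (hσ : ∀ x, ∫ v, (W.logUp x v - R.I x) ^ 2 ∂unif ≤ σ)
    (hX : ∀ t, Measurable[obs W π X t] (X (t + 1)))
    (hT : ∀ t : ℕ, MeasurableSet[obs W π X t] {ω | T ω = t}) :
    P {ω | ∃ t s : ℕ, s ≤ t ∧ t < s + m ∧ ω ∈ changedAt W π X s ∧ T ω = t ∧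
        Real.exp c < changeWeight W π X s t ω} ≤ ENNReal.ofReal (m * σ / a ^ 2) := by
  set S : ℕ → Ω → ℝ := fun n ω => ∑ j ∈ Finset.range n, ∑ x, ind (freshStep W π X T m j x) ω *
      (W.logUp x (W.V (j + 1) ω) - R.I x) with hS
  have hfm := measurableSet_freshStep (W := W) (π := π) hX hT m
  have hmoment : ∀ n, Integrable (fun ω => S n ω ^ 2) P ∧ ∫ ω, S n ω ^ 2 ∂P ≤ m * σ := fun n => by
    have h := integral_sum_sq_le W hfm
      (fun j x y hxy => Set.disjoint_left.2 fun ω h h' => hxy (h.1.symm.trans h'.1))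
      (z := fun x v => W.logUp x v - R.I x) (fun x => (W.measurable_logUp x).sub_const _)
      (fun x => (W.memLp_logUp hR x).sub (memLp_const _)) (fun x => by
        rw [integral_sub ((W.memLp_logUp hR x).integrable (by norm_num)) (integrable_const _),
          W.integral_logUp]
        simp) hσ n
    refine ⟨h.1, h.2.trans ?_⟩
    rw [mul_comm (m : ℝ)]
    refine mul_le_mul_of_nonneg_left ?_ hσ0
    have hi : ∀ j x, Integrable (fun ω => ind (freshStep W π X T m j x) ω) P := fun j x =>
      (integrable_const (1 : ℝ)).indicator (W.mid_le _ _ (hfm j x))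
    calc _ = ∫ ω, ∑ j ∈ Finset.range n, ∑ x, ind (freshStep W π X T m j x) ω ∂P := by
          rw [integral_finsetSum _ fun j _ => integrable_finsetSum _ fun x _ => hi j x]
          refine Finset.sum_congr rfl fun j _ => ?_
          rw [integral_finsetSum _ fun x _ => hi j x]
          exact Finset.sum_congr rfl fun x _ =>
            (integral_indicator_one (W.mid_le _ _ (hfm j x))).symm
      _ ≤ ∫ ω, (m : ℝ) ∂P := integral_mono (integrable_finsetSum _ fun j _ =>
          integrable_finsetSum _ fun x _ => hi j x) (integrable_const _)
          fun ω => sum_freshStep_le m n ω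
      _ = m := by simp
  set B : ℕ → Set Ω := fun n => {ω | ∃ t s : ℕ, t ≤ n ∧ s ≤ t ∧ t < s + m ∧
    ω ∈ changedAt W π X s ∧ T ω = t ∧ Real.exp c < changeWeight W π X s t ω} with hB
  have hBn : ∀ n, P (B n) ≤ ENNReal.ofReal (m * σ / a ^ 2) := by
    intro n
    have hsub : B n ≤ᵐ[P] {ω | a ^ 2 ≤ S n ω ^ 2} := by
      filter_upwards [ae_response_pos W hR] with ω hω
      rintro ⟨t, s, h3, h4, h5, h6, h7, h8⟩
      exact pow_le_pow_left₀ ha.le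
        (le_sum_freshStep h0 h1 hC0 hC hD0 hI hD hc hω h6 h7 h4 h5 h3 h8) 2
    have hmarkov := mul_meas_ge_le_integral_of_nonneg
      (ae_of_all P fun ω => sq_nonneg (S n ω)) (hmoment n).1 (a ^ 2)
    refine (measure_mono_ae hsub).trans ?_
    rw [← ofReal_measureReal]
    refine ENNReal.ofReal_le_ofReal ?_
    rw [le_div_iff₀ (by positivity), mul_comm]
    exact hmarkov.trans (hmoment n).2
  have hU : {ω | ∃ t s : ℕ, s ≤ t ∧ t < s + m ∧ ω ∈ changedAt W π X s ∧ T ω = t ∧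
      Real.exp c < changeWeight W π X s t ω} ⊆ ⋃ n, B n := by
    rintro ω ⟨t, s, h⟩
    exact mem_iUnion.2 ⟨t, t, s, le_rfl, h⟩
  have hmono : Monotone B := fun n n' hn ω ⟨t, s, h, h'⟩ => ⟨t, s, h.trans hn, h'⟩
  refine (measure_mono hU).trans ?_
  rw [hmono.measure_iUnion]
  exact iSup_le hBn

/-- No admissible procedure with false alarm probability at most `α` is much faster than the
change-point under the maximal transition probabilities plus `m` steps. -/
lemma lamStar_add_le (hR : R.Regular) {C D a c σ ζ α : ℝ} {t₀ m : ℕ} (h0 : ∀ t z, 0 ≤ π t z)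
    (h1 : ∀ t z, π t z < 1) (hζ0 : 0 < ζ) (hζ1 : ζ < 1)
    (hζ : ∀ t (z : Fin t → Fin (k + 1)), ζ ≤ π (t + 1) (Fin.snoc z 0))
    (hC0 : 0 ≤ C) (hC : ∀ t z, -Real.log (1 - π t z) ≤ C) (hD0 : 0 ≤ D)
    (hI : ∀ x, R.I x ≤ D) (hD : ∀ t ≥ t₀, ∀ (z : Fin t → Fin (k + 1)) x,
      R.I x - Real.log (1 - π (t + 1) (Fin.snoc z x)) ≤ D)
    (hc : C + C * t₀ + m * D + a ≤ c) (ha : 0 < a) (hσ0 : 0 ≤ σ)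
    (hσ : ∀ x, ∫ v, (W.logUp x v - R.I x) ^ 2 ∂unif ≤ σ) (hα : 0 ≤ α)
    (hTX : (T, X) ∈ procedures W π α) :
    lamStar W π + m ≤ expTime P T + ENNReal.ofReal
      (2 * √α / ζ + m * (α + m * Real.exp c * α + m * σ / a ^ 2)) := by
  obtain ⟨⟨hT, hX⟩, hfa, -⟩ := hTX
  simp only at hT hX hfa
  set A := {ω | T ω < changePoint W π X ω} with hA
  set G := {ω | ∃ t s : ℕ, s ≤ t ∧ t < s + m ∧ ω ∈ changedAt W π X s ∧ T ω = t ∧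
        changeWeight W π X s t ω ≤ Real.exp c} with hG
  set B := {ω | ∃ t s : ℕ, s ≤ t ∧ t < s + m ∧ ω ∈ changedAt W π X s ∧ T ω = t ∧
        Real.exp c < changeWeight W π X s t ω} with hB
  set A' := toMeasurable P A with hA'
  have hA'm : MeasurableSet A' := measurableSet_toMeasurable _ _
  set E := toMeasurable P (A ∪ G ∪ B) with hE
  have hEm : MeasurableSet E := measurableSet_toMeasurable _ _
  have hEP : P E ≤ ENNReal.ofReal (α + m * Real.exp c * α + m * σ / a ^ 2) := by
    rw [hE, measure_toMeasurable, ENNReal.ofReal_add (by positivity) (by positivity),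
      ENNReal.ofReal_add (by positivity) (by positivity)]
    refine (measure_union_le _ _).trans (add_le_add ((measure_union_le _ _).trans
      (add_le_add hfa ?_)) (measure_early_large_le hR h0 h1 hC0 hC hD0 hI hD hc ha hσ0 hσ hX hT))
    refine (measure_early_small_le hR h0 h1 hX hT m _).trans ?_
    rw [ENNReal.ofReal_mul (by positivity), ENNReal.ofReal_mul (by positivity),
      ENNReal.ofReal_natCast]
    gcongr
  set Θ := firstOne (maxState W π) with hΘ
  have hpt : ∀ ω, (Θ ω : ℝ≥0∞) + m ≤ (T ω : ℝ≥0∞) +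
      ((∑' t : ℕ, (A' ∩ {ω | maxState W π t ω = 0}).indicator (fun _ => (1 : ℝ≥0∞)) ω) +
        E.indicator (fun _ => (m : ℝ≥0∞)) ω) := by
    intro ω
    have hle := firstOne_maxState_le W π X ω
    by_cases hωE : ω ∈ A ∪ G ∪ B
    · rw [indicator_of_mem (subset_toMeasurable P _ hωE), ← add_assoc]
      refine add_le_add ?_ le_rfl
      by_cases hωA : ω ∈ A
      · refine le_trans (le_of_eq ?_) le_add_self
        rw [toENNReal_eq_tsum (Θ ω)]
        refine tsum_congr fun t => ?_
        have hωA' : ω ∈ A' := subset_toMeasurable P _ hωA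
        have hiff : (t : ℕ∞) < Θ ω ↔ maxState W π t ω = 0 := lt_firstOne_latent
        by_cases ht : (t : ℕ∞) < Θ ω
        · rw [indicator_of_mem (show t ∈ {t : ℕ | (t : ℕ∞) < Θ ω} from ht),
            indicator_of_mem (show ω ∈ A' ∩ {ω | maxState W π t ω = 0} from ⟨hωA', hiff.1 ht⟩)]
        · rw [indicator_of_notMem (show t ∉ {t : ℕ | (t : ℕ∞) < Θ ω} from ht),
            indicator_of_notMem fun h => ht (hiff.2 h.2)]
      · exact (ENat.toENNReal_le.2 (hle.trans (not_lt.1 hωA))).trans le_self_add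
    · have hωA : changePoint W π X ω ≤ T ω := not_lt.1 fun h => hωE (Or.inl (Or.inl h))
      have hm : changePoint W π X ω + m ≤ T ω := by
        by_contra hc
        rw [not_le] at hc
        obtain ⟨t, ht⟩ := ENat.ne_top_iff_exists.1 (ne_top_of_lt hc)
        obtain ⟨s, hs⟩ := ENat.ne_top_iff_exists.1
          (ne_top_of_le_ne_top (ne_top_of_lt hc) hωA)
        rw [← ht, ← hs] at hc hωA
        have h2 : s ≤ t := by exact_mod_cast hωA
        have h3 : t < s + m := by exact_mod_cast hc
        have h4 := changePoint_eq_iff.1 hs.symm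
        rcases le_or_gt (changeWeight W π X s t ω) (Real.exp c) with h5 | h5
        · exact hωE (Or.inl (Or.inr ⟨t, s, h2, h3, h4, ht.symm, h5⟩))
        · exact hωE (Or.inr ⟨t, s, h2, h3, h4, ht.symm, h5⟩)
      have h6 := ENat.toENNReal_le.2 ((add_le_add hle (le_refl (m : ℕ∞))).trans hm)
      rw [ENat.toENNReal_add, ENat.toENNReal_coe] at h6
      exact h6.trans le_self_add
  have hi : ∀ t, Measurable ((A' ∩ {ω | maxState W π t ω = 0}).indicator
      (fun _ => (1 : ℝ≥0∞))) := fun t =>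
    measurable_const.indicator (hA'm.inter (measurableSet_maxState W π t))
  have hsum : Measurable fun ω => ∑' t : ℕ,
      (A' ∩ {ω | maxState W π t ω = 0}).indicator (fun _ => (1 : ℝ≥0∞)) ω :=
    Measurable.tsum hi
  have hE' : Measurable (E.indicator fun _ => (m : ℝ≥0∞)) := measurable_const.indicator hEm
  have hr : Measurable fun ω => (∑' t : ℕ, (A' ∩ {ω | maxState W π t ω = 0}).indicator
      (fun _ => (1 : ℝ≥0∞)) ω) + E.indicator (fun _ => (m : ℝ≥0∞)) ω := hsum.add hE'
  have hmain := lintegral_mono (μ := P) hpt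
  rw [lintegral_add_right _ measurable_const, lintegral_const, measure_univ, mul_one,
    lintegral_add_right _ hr,
    lintegral_add_right _ hE', lintegral_indicator hEm,
    setLIntegral_const, lintegral_tsum fun t => (hi t).aemeasurable] at hmain
  refine hmain.trans (add_le_add le_rfl ?_)
  rw [ENNReal.ofReal_add (by positivity) (by positivity), ENNReal.ofReal_mul (by positivity),
    ENNReal.ofReal_natCast]
  refine add_le_add (le_trans (le_of_eq (tsum_congr fun t => ?_))
    (tsum_inter_maxState_le W hζ0 hζ1 hζ hα ((measure_toMeasurable A).le.trans hfa))) (by gcongr)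
  rw [lintegral_indicator (hA'm.inter (measurableSet_maxState W π t)), setLIntegral_one]

end EarlyDetection

/-! ### The proposed procedure controls false alarms -/

section Membership

variable {k : ℕ} {𝕐 : Type*} [MeasurableSpace 𝕐] {R : ResponseModel k 𝕐}
  {Ω : Type*} [mΩ : MeasurableSpace Ω] {P : Measure Ω}
  {W : Noise R P} {π : Transition k} {b₁ bK d : ℝ} {ζ κ₁ κK : ℝ} {t₀ : ℕ}

lemma measure_eq_zero_of_tsum {A : Set Ω} {B : ℕ → Set Ω} (hAB : ∀ t, A ⊆ B t)
    (h : ∑' t, P (B t) ≠ ⊤) : P A = 0 := by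
  by_contra hA
  refine h (top_unique ?_)
  rw [← ENNReal.tsum_const_eq_top_of_ne_zero (α := ℕ) hA]
  exact ENNReal.tsum_le_tsum fun t => measure_mono (hAB t)

lemma tsum_measure_le [IsFiniteMeasure P] {A : ℕ → Set Ω} {c : ℝ}
    (h : ∀ n, ∑ t ∈ Finset.range n, P.real (A t) ≤ c) : ∑' t, P (A t) ≤ ENNReal.ofReal c := by
  rw [ENNReal.tsum_eq_iSup_nat]
  refine iSup_le fun n => ?_
  rw [← ENNReal.ofReal_toReal (ENNReal.sum_ne_top.2 fun t _ => measure_ne_top P (A t)),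
    ENNReal.toReal_sum fun t _ => measure_ne_top P (A t)]
  exact ENNReal.ofReal_le_ofReal (h n)

lemma expTime_proposedTime :
    expTime P (proposedTime W π b₁ bK d) = ∑' t, P (alive W π b₁ bK d t) :=
  expTime_eq_tsum fun t => obs_le W π (measurable_proposedRule W π b₁ bK d) t _
    (measurableSet_alive W π b₁ bK d t)

variable [IsProbabilityMeasure P]

/-- At the stopping time the posterior odds are at least `bK`, so that the change has not occurred
with conditional probability at most `1 / (1 + bK)`. -/
lemma measure_proposedTime_lt_le (hR : R.Regular) (h0 : ∀ t z, 0 ≤ π t z) (h1 : ∀ t z, π t z < 1)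
    (hbK : 0 ≤ bK) :
    P {ω | proposedTime W π b₁ bK d ω < changePoint W π (proposedRule W π b₁ bK d) ω} ≤
      ENNReal.ofReal (1 / (1 + bK)) := by
  have hX := measurable_proposedRule W π b₁ bK d
  set E : ℕ → Set Ω := fun t => {ω | proposedTime W π b₁ bK d ω = (t + 1 : ℕ)} with hE
  have hEm : ∀ t, MeasurableSet[obs W π (proposedRule W π b₁ bK d) (t + 1)] (E t) := fun t =>
    measurableSet_proposedTime_eq W π b₁ bK d (t + 1)
  have hEm' : ∀ t, MeasurableSet (E t) := fun t => obs_le W π hX _ _ (hEm t)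
  have hodds : ∀ t, ∀ ω ∈ E t, bK ≤ odds W π (proposedRule W π b₁ bK d) (t + 1) ω := by
    intro t ω hω
    obtain ⟨h2, h3⟩ := eq_nat_iff_lt.1 hω
    have h2' := (mem_alive_iff W π b₁ bK d).1 (show ω ∈ alive W π b₁ bK d t from h2)
    have h3' := (mem_alive_iff W π b₁ bK d).not.1 (show ω ∉ alive W π b₁ bK d (t + 1) from h3)
    push Not at h3'
    obtain ⟨s, hs, h4, h5⟩ := h3'
    rcases Nat.lt_succ_iff_lt_or_eq.1 hs with h | rfl
    · exact absurd ⟨h4, h5⟩ (h2' s h)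
    · exact h5
  have hsub : {ω | proposedTime W π b₁ bK d ω < changePoint W π (proposedRule W π b₁ bK d) ω} ⊆
      ⋃ t, E t ∩ {ω | state W π (proposedRule W π b₁ bK d) (t + 1) ω = 0} := by
    intro ω hω
    obtain ⟨n, hn⟩ := ENat.ne_top_iff_exists.1 (ne_top_of_lt hω)
    have h2 : (0 : ℕ) < proposedTime W π b₁ bK d ω :=
      (mem_alive_iff W π b₁ bK d).2 fun s hs => absurd hs (Nat.not_lt_zero s)
    rw [← hn, Nat.cast_lt] at h2
    obtain ⟨t, rfl⟩ := Nat.exists_eq_succ_of_ne_zero h2.ne'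
    refine mem_iUnion.2 ⟨t, hn.symm, lt_firstOne_latent.1 (?_ : ((t + 1 : ℕ) : ℕ∞) <
      changePoint W π (proposedRule W π b₁ bK d) ω)⟩
    rw [Nat.succ_eq_add_one] at hn
    rw [hn]
    exact hω
  calc _ ≤ ∑' t, P (E t ∩ {ω | state W π (proposedRule W π b₁ bK d) (t + 1) ω = 0}) :=
        (measure_mono hsub).trans (measure_iUnion_le _)
    _ ≤ ∑' t, ENNReal.ofReal (1 / (1 + bK)) * P (E t) := by
        refine ENNReal.tsum_le_tsum fun t => ?_
        have h := measureReal_inter_state_zero_le W hR h0 h1 hX (hEm t) hbK (hodds t)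
        rw [← ofReal_measureReal (s := E t), ← ENNReal.ofReal_mul (by positivity),
          ← ofReal_measureReal]
        exact ENNReal.ofReal_le_ofReal h
    _ = ENNReal.ofReal (1 / (1 + bK)) * P (⋃ t, E t) := by
        rw [ENNReal.tsum_mul_left, measure_iUnion _ hEm']
        intro s t hst
        refine Set.disjoint_left.2 fun ω h h' => hst ?_
        have h2 : ((s + 1 : ℕ) : ℕ∞) = (t + 1 : ℕ) := h.symm.trans h'
        have h3 : s + 1 = t + 1 := by exact_mod_cast h2
        omega
    _ ≤ _ := mul_le_of_le_one_right' prob_le_one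

/-- The proposed procedure is admissible, and its false alarm probability is at most
`1 / (1 + bK)`. -/
theorem proposed_mem_procedures (H : TransitionBounds π ζ κ₁ κK t₀) (hR : R.Regular)
    (hlam : lam W π 0 ≠ ⊤) (hb₁ : 0 < b₁) (hbK : 0 ≤ bK) (hd : 1 ≤ d) {B : ℝ} (hB : 0 ≤ B)
    (hJ : 0 < ∫ v, min (W.logDown (Fin.last k) v) B ∂unif)
    (hT : expTime P (proposedTime W π b₁ bK d) ≠ ⊤) :
    (proposedTime W π b₁ bK d, proposedRule W π b₁ bK d) ∈ procedures W π (1 / (1 + bK)) := by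
  refine ⟨⟨measurableSet_proposedTime_eq W π b₁ bK d, measurable_proposedRule W π b₁ bK d⟩,
    measure_proposedTime_lt_le hR H.nonneg H.lt_one hbK, ?_⟩
  have h1 : P {ω | proposedTime W π b₁ bK d ω = ⊤} = 0 := by
    rw [expTime_proposedTime] at hT
    refine measure_eq_zero_of_tsum (fun t ω hω => ?_) hT
    rw [mem_ofPred_eq] at hω
    change (t : ℕ∞) < proposedTime W π b₁ bK d ω
    rw [hω]
    exact ENat.natCast_lt_top t
  have h2 : P {ω | changePoint W π (proposedRule W π b₁ bK d) ω = ⊤} = 0 := by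
    refine measure_eq_zero_of_tsum (B := fun t => inState W π b₁ bK d 0 (t + 1)) (fun t ω hω => ?_)
      (ne_top_of_le_ne_top ENNReal.ofReal_ne_top
        (tsum_measure_le (sum_inState_zero_le H hR hlam hb₁ hd hB hJ)))
    rw [mem_ofPred_eq] at hω
    refine lt_firstOne_latent.1 (?_ : ((t + 1 : ℕ) : ℕ∞) <
      changePoint W π (proposedRule W π b₁ bK d) ω)
    rw [hω]
    exact ENat.natCast_lt_top _
  have h3 : ∀ᵐ ω ∂P, proposedTime W π b₁ bK d ω < ⊤ ∧
      changePoint W π (proposedRule W π b₁ bK d) ω < ⊤ := by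
    have h1' : ∀ᵐ ω ∂P, proposedTime W π b₁ bK d ω ≠ ⊤ := by
      rw [ae_iff]; simpa using h1
    have h2' : ∀ᵐ ω ∂P, changePoint W π (proposedRule W π b₁ bK d) ω ≠ ⊤ := by
      rw [ae_iff]; simpa using h2
    filter_upwards [h1', h2'] with ω h4 h5
    exact ⟨h4.lt_top, h5.lt_top⟩
  exact (measure_congr (eventuallyEq_univ.2 h3)).trans measure_univ

end Membership

/-! ### Bounds that hold uniformly in the tolerance level -/

section Uniform

variable {k : ℕ} {𝕐 : Type*} [MeasurableSpace 𝕐] {R : ResponseModel k 𝕐} {M : ChangeModel k}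
  {p : Fin (k + 1) → ℝ → ℝ}

lemma zeta_le_transition {α : ℝ} (hα : α ∈ Ioo (0 : ℝ) 1) (x : Fin (k + 1)) (t : ℕ)
    (z : Fin t → Fin (k + 1)) : zeta (M.π α) x ≤ M.π α (t + 1) (Fin.snoc z x) := by
  have h0 : ∀ s (z : Fin s → Fin (k + 1)), 0 ≤ M.π α (s + 1) (Fin.snoc z x) := fun s z =>
    (M.mem_Icc α hα _ _).1
  refine (ciInf_le ⟨0, ?_⟩ t).trans (ciInf_le ⟨0, ?_⟩ z)
  · rintro _ ⟨s, rfl⟩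
    exact Real.iInf_nonneg (h0 s)
  · rintro _ ⟨z, rfl⟩
    exact h0 t z

/-- The limiting transition probabilities inherit the bounds of the transition probabilities. -/
lemma limit_mem_Icc (hMarkov : AsympMarkov M p) {δ : ℝ}
    (hδ : ∀ α ∈ Ioo (0 : ℝ) 1, ∀ t, piStar (M.π α) t ≤ 1 - δ) {α : ℝ} (hα : α ∈ Ioo (0 : ℝ) 1)
    (x : Fin (k + 1)) : 0 ≤ p x α ∧ p x α ≤ 1 - δ := by
  have key : ∀ ε > 0, ∃ q, 0 ≤ q ∧ q ≤ 1 - δ ∧ |q - p x α| ≤ ε := fun ε hε => by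
    obtain ⟨t, ht⟩ := hMarkov x ε hε
    exact ⟨_, (M.mem_Icc α hα _ _).1, (piStar_ge _ _ _).trans (hδ α hα _),
      ht t le_rfl α hα fun _ => 0⟩
  constructor <;> refine le_of_forall_pos_le_add fun ε hε => ?_ <;>
  · obtain ⟨q, h0, h1, h2⟩ := key ε hε
    have := abs_le.1 h2
    linarith

lemma abs_log_sub_log_le {δ a b : ℝ} (hδ : 0 < δ) (ha : δ ≤ a) (hb : δ ≤ b) :
    |Real.log a - Real.log b| ≤ |a - b| / δ := by
  have key : ∀ a b : ℝ, δ ≤ a → δ ≤ b → Real.log a - Real.log b ≤ |a - b| / δ := by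
    intro a b ha hb
    have ha0 : 0 < a := hδ.trans_le ha
    have hb0 : 0 < b := hδ.trans_le hb
    rw [← Real.log_div ha0.ne' hb0.ne']
    refine (Real.log_le_sub_one_of_pos (div_pos ha0 hb0)).trans ?_
    rw [div_sub_one hb0.ne']
    exact (div_le_div_of_nonneg_right (le_abs_self _) hb0.le).trans
      (div_le_div_of_nonneg_left (abs_nonneg _) hδ hb)
  rw [abs_le]
  have h1 := key a b ha hb
  have h2 := key b a hb ha
  rw [abs_sub_comm] at h2
  exact ⟨by linarith, h1⟩

/-- From some time on, uniformly in the tolerance level, the contribution of a step to the drift of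
the log-odds through the transition probabilities is close to its limit. -/
lemma exists_drift_close (hMarkov : AsympMarkov M p) {δ : ℝ} (hδ0 : 0 < δ)
    (hδ : ∀ α ∈ Ioo (0 : ℝ) 1, ∀ t, piStar (M.π α) t ≤ 1 - δ) {ε : ℝ} (hε : 0 < ε) :
    ∃ t₀ : ℕ, ∀ t ≥ t₀, ∀ α ∈ Ioo (0 : ℝ) 1, ∀ (z : Fin t → Fin (k + 1)) (x : Fin (k + 1)),
      |-Real.log (1 - M.π α (t + 1) (Fin.snoc z x)) - (|Real.log (1 - p x α)|)| ≤ ε := by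
  choose t₀ ht₀ using fun x => hMarkov x (ε * δ) (mul_pos hε hδ0)
  refine ⟨Finset.univ.sup t₀, fun t ht α hα z x => ?_⟩
  have h1 := ht₀ x t ((Finset.le_sup (Finset.mem_univ x)).trans ht) α hα z
  obtain ⟨h2, h3⟩ := limit_mem_Icc hMarkov hδ hα x
  have h4 : M.π α (t + 1) (Fin.snoc z x) ≤ 1 - δ := (piStar_ge _ _ _).trans (hδ α hα _)
  have h5 := abs_log_sub_log_le hδ0 (a := 1 - p x α)
    (b := 1 - M.π α (t + 1) (Fin.snoc z x)) (by linarith) (by linarith)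
  rw [abs_of_nonpos (Real.log_nonpos (by linarith) (by linarith))]
  calc _ = |Real.log (1 - p x α) - Real.log (1 - M.π α (t + 1) (Fin.snoc z x))| := by
        congr 1; ring
    _ ≤ _ := h5
    _ ≤ _ := by
        rw [div_le_iff₀ hδ0]
        refine le_trans (le_of_eq ?_) h1
        congr 1; ring

/-- Bounds for the information numbers, the drift, and the detection rates that do not depend on
the tolerance level. -/
lemma exists_uniform_bounds (hR : R.Regular) (hMarkov : AsympMarkov M p) (hB : BoundedAway M) :
    ∃ i C D : ℝ, 0 < i ∧ 0 ≤ C ∧ 0 < D ∧ ∀ α ∈ Ioo (0 : ℝ) 1,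
      (∀ t z, 0 ≤ M.π α t z ∧ M.π α t z < 1 ∧ -Real.log (1 - M.π α t z) ≤ C) ∧
      zeta (M.π α) 0 < 1 ∧
      ∀ x, R.I x ≤ detRate R p x α ∧ i ≤ detRate R p x α ∧ detRate R p x α ≤ D ∧
        |Real.log (1 - p x α)| ≤ C := by
  obtain ⟨δ, ⟨hδ0, hδ1⟩, hδ⟩ := hB
  obtain ⟨x₀, hx₀⟩ := Finite.exists_min R.I
  obtain ⟨x₁, hx₁⟩ := Finite.exists_max R.I
  have hC : 0 ≤ -Real.log δ := by
    have := Real.log_nonpos hδ0.le hδ1.le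
    linarith
  have hIpos : ∀ x, 0 < R.I x := fun x => (hR x).2.2.1
  refine ⟨R.I x₀, -Real.log δ, R.I x₁ + -Real.log δ, hIpos x₀, hC, by linarith [hIpos x₁],
    fun α hα => ⟨fun t z => ?_, ?_, fun x => ?_⟩⟩
  · have h4 : M.π α t z ≤ 1 - δ := (piStar_ge _ _ _).trans (hδ α hα _)
    refine ⟨(M.mem_Icc α hα _ _).1, by linarith, ?_⟩
    have := Real.log_le_log hδ0 (show δ ≤ 1 - M.π α t z by linarith)
    linarith
  · exact ((zeta_le_transition hα 0 0 Fin.elim0).trans ((piStar_ge _ _ _).trans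
      (hδ α hα (0 + 1)))).trans_lt (by linarith)
  · obtain ⟨h2, h3⟩ := limit_mem_Icc hMarkov hδ hα x
    have h5 : |Real.log (1 - p x α)| ≤ -Real.log δ := by
      rw [abs_of_nonpos (Real.log_nonpos (by linarith) (by linarith))]
      have := Real.log_le_log hδ0 (show δ ≤ 1 - p x α by linarith)
      linarith
    have h6 := abs_nonneg (Real.log (1 - p x α))
    unfold detRate
    exact ⟨by linarith, by linarith [hx₀ x], by linarith [hx₁ x], h5⟩

lemma tendsto_abs_log : Tendsto (fun α : ℝ => |Real.log α|) (𝓝[>] 0) atTop :=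
  tendsto_abs_atBot_atTop.comp Real.tendsto_log_nhdsGT_zero

lemma eventually_mem_Ioo : ∀ᶠ α : ℝ in 𝓝[>] 0, α ∈ Ioo (0 : ℝ) 1 :=
  Ioo_mem_nhdsGT one_pos

lemma eventually_zeta (hZeta : ZetaRate M) {ε : ℝ} (hε : 0 < ε) :
    ∀ᶠ α in 𝓝[>] (0 : ℝ), 0 < zeta (M.π α) 0 ∧
      |Real.log (zeta (M.π α) 0)| ≤ ε * |Real.log α| := by
  filter_upwards [hZeta.1, hZeta.2.eventually (gt_mem_nhds hε),
    tendsto_abs_log.eventually_gt_atTop 0] with α h1 h2 h3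
  exact ⟨h1, by rw [div_lt_iff₀ h3] at h2; exact h2.le⟩

end Uniform

/-! ### The lower bound as the tolerance level vanishes -/

section Lower

variable {k : ℕ} {𝕐 : Type*} [MeasurableSpace 𝕐] {R : ResponseModel k 𝕐}
  {Ω : Type*} [MeasurableSpace Ω] {P : Measure Ω} [IsProbabilityMeasure P]
  {W : Noise R P} {M : ChangeModel k} {p : Fin (k + 1) → ℝ → ℝ}

/-- The non-asymptotic lower bound is applied with `m` steps for which the drift accounts for the
fraction `1 - η` of `|log α|`. A deviation of order `η * |log α|` then separates the likelihood
ratio from the level `α ^ (η / 4 - 1)`, up to which the change of measure is effective. -/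
theorem eventually_lamStar_le (hR : R.Regular) (hMarkov : AsympMarkov M p) (hZeta : ZetaRate M)
    (hB : BoundedAway M) (hLast : ∀ α ∈ Ioo (0 : ℝ) 1, ∀ x,
      detRate R p x α ≤ detRate R p (Fin.last k) α) {η : ℝ} (hη : 0 < η) (hη1 : η ≤ 1) :
    ∃ K : ℝ, ∀ᶠ α in 𝓝[>] (0 : ℝ), ∀ q ∈ procedures W (M.π α) α,
      lamStar W (M.π α) + ENNReal.ofReal ((1 - η) * |Real.log α| / detRate R p (Fin.last k) α) ≤
        expTime P q.1 + ENNReal.ofReal K := by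
  obtain ⟨i, C, D, hi, hC, hD, hunif⟩ := exists_uniform_bounds hR hMarkov hB
  obtain ⟨δ, ⟨hδ0, hδ1⟩, hδ⟩ := hB
  obtain ⟨t₀, ht₀⟩ := exists_drift_close hMarkov hδ0 hδ (ε := i * η / 4) (by positivity)
  obtain ⟨σ, hσ0, hσ⟩ : ∃ σ : ℝ, 0 ≤ σ ∧ ∀ x, ∫ v, (W.logUp x v - R.I x) ^ 2 ∂unif ≤ σ := by
    have h0 : ∀ x, 0 ≤ ∫ v, (W.logUp x v - R.I x) ^ 2 ∂unif := fun x =>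
      integral_nonneg fun v => sq_nonneg _
    exact ⟨∑ x, ∫ v, (W.logUp x v - R.I x) ^ 2 ∂unif, Finset.sum_nonneg fun x _ => h0 x,
      fun x => Finset.single_le_sum (f := fun x => ∫ v, (W.logUp x v - R.I x) ^ 2 ∂unif)
        (fun y _ => h0 y) (Finset.mem_univ x)⟩
  refine ⟨1 + (2 + 1 / i + 32 / (i ^ 2 * η ^ 2) + 16 * σ / (i ^ 2 * η ^ 2)), ?_⟩
  filter_upwards [eventually_mem_Ioo, eventually_zeta hZeta (show (0 : ℝ) < 1 / 4 by norm_num),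
    tendsto_abs_log.eventually_ge_atTop (4 * (C + C * t₀) / η),
    tendsto_abs_log.eventually_ge_atTop 1] with α hα hζ hL hL1 q hq
  obtain ⟨hζ0, hζlog⟩ := hζ
  obtain ⟨hπ, hζ1, hdet⟩ := hunif α hα
  set L := |Real.log α| with hLdef
  set ζ := zeta (M.π α) 0 with hζdef
  have hlogα : Real.log α = -L := by
    rw [hLdef, abs_of_nonpos (Real.log_nonpos hα.1.le hα.2.le), neg_neg]
  have hαexp : α = Real.exp (-L) := by rw [← hlogα, Real.exp_log hα.1]
  set DK := detRate R p (Fin.last k) α with hDK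
  have hDKi : i ≤ DK := (hdet _).2.1
  have hDK0 : 0 < DK := hi.trans_le hDKi
  set m := ⌊(1 - η) * L / DK⌋₊ with hm
  have hm0 : 0 ≤ (1 - η) * L / DK := div_nonneg (mul_nonneg (by linarith) (by linarith)) hDK0.le
  have hmle : (m : ℝ) ≤ (1 - η) * L / DK := Nat.floor_le hm0
  have hmD : (m : ℝ) * DK ≤ (1 - η) * L := (le_div_iff₀ hDK0).1 hmle
  have hmi : (m : ℝ) * i ≤ L := (mul_le_mul_of_nonneg_left hDKi (Nat.cast_nonneg m)).trans
    (hmD.trans (by nlinarith))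
  have hmL : (m : ℝ) ≤ L / i := (le_div_iff₀ hi).2 hmi
  have hmain := lamStar_add_le (W := W) (T := q.1) (X := q.2) hR (m := m) (t₀ := t₀)
    (C := C) (D := DK + i * η / 4) (a := η / 4 * L) (c := (1 - η / 4) * L) (σ := σ) (ζ := ζ)
    (fun t z => (hπ t z).1) (fun t z => (hπ t z).2.1) hζ0 hζ1 (zeta_le_transition hα 0) hC
    (fun t z => (hπ t z).2.2) (by positivity)
    (fun x => (hdet x).1.trans ((hLast α hα x).trans (by linarith [mul_pos hi hη])))
    (fun t ht z x => by
      have h1 := (abs_le.1 (ht₀ t ht α hα z x)).2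
      have h2 := hLast α hα x
      rw [← hDK] at h2
      unfold detRate at h2
      linarith)
    (by
      rw [div_le_iff₀ hη] at hL
      nlinarith) (by positivity) hσ0 hσ hα.1.le hq
  have hsqrt : 2 * √α / ζ ≤ 2 := by
    rw [div_le_iff₀ hζ0]
    refine mul_le_mul_of_nonneg_left ?_ zero_le_two
    rw [Real.sqrt_le_left hζ0.le, ← Real.log_le_log_iff hα.1 (by positivity), Real.log_pow, hlogα]
    have := (abs_le.1 hζlog).1
    push_cast
    linarith
  have hexp1 : m * α ≤ 1 / i := by
    have h1 : L * α ≤ 1 := by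
      rw [hαexp, Real.exp_neg, ← div_eq_mul_inv, div_le_one (Real.exp_pos _)]
      linarith [Real.add_one_le_exp L]
    calc m * α ≤ L / i * α := mul_le_mul_of_nonneg_right hmL hα.1.le
      _ = L * α / i := by ring
      _ ≤ _ := div_le_div_of_nonneg_right h1 hi.le
  have hexp2 : m * (m * Real.exp ((1 - η / 4) * L) * α) ≤ 32 / (i ^ 2 * η ^ 2) := by
    have h1 : Real.exp ((1 - η / 4) * L) * α = Real.exp (-(η / 4 * L)) := by
      rw [hαexp, ← Real.exp_add]; congr 1; ring
    have h2 : (η / 4 * L) ^ 2 / 2 ≤ Real.exp (η / 4 * L) := by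
      have hη4 : 0 ≤ η / 4 * L := by positivity
      linarith [Real.quadratic_le_exp_of_nonneg hη4]
    have h3 : (m : ℝ) ^ 2 ≤ (L / i) ^ 2 := pow_le_pow_left₀ (Nat.cast_nonneg m) hmL 2
    calc _ = (m : ℝ) ^ 2 * Real.exp (-(η / 4 * L)) := by rw [← h1]; ring
      _ ≤ (L / i) ^ 2 * Real.exp (-(η / 4 * L)) := by gcongr
      _ ≤ _ := by
        rw [Real.exp_neg, ← div_eq_mul_inv, div_pow, div_div, div_le_div_iff₀
          (by positivity) (by positivity)]
        have : 0 ≤ i ^ 2 := sq_nonneg i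
        nlinarith [mul_le_mul_of_nonneg_left h2 this]
  have hvar : m * (m * σ / (η / 4 * L) ^ 2) ≤ 16 * σ / (i ^ 2 * η ^ 2) := by
    have hL0 : 0 < L := by linarith
    have h3 : (m * i : ℝ) ^ 2 ≤ L ^ 2 := pow_le_pow_left₀ (by positivity) hmi 2
    rw [← mul_div_assoc, div_le_div_iff₀ (by positivity) (by positivity)]
    have h4 : 0 ≤ σ * η ^ 2 := by positivity
    nlinarith [mul_le_mul_of_nonneg_left h3 h4]
  have hfloor : (1 - η) * L / DK ≤ m + 1 := (Nat.lt_floor_add_one _).le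
  calc _ ≤ lamStar W (M.π α) + (m + ENNReal.ofReal 1) := by
        refine add_le_add le_rfl ((ENNReal.ofReal_le_ofReal hfloor).trans (le_of_eq ?_))
        rw [ENNReal.ofReal_add (Nat.cast_nonneg m) zero_le_one, ENNReal.ofReal_natCast]
    _ ≤ expTime P q.1 + ENNReal.ofReal (2 + 1 / i + 32 / (i ^ 2 * η ^ 2) +
        16 * σ / (i ^ 2 * η ^ 2)) + ENNReal.ofReal 1 := by
        rw [← add_assoc]
        refine add_le_add (hmain.trans (add_le_add le_rfl (ENNReal.ofReal_le_ofReal ?_))) le_rfl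
        rw [mul_add, mul_add]
        linarith
    _ = _ := by
        rw [ENNReal.ofReal_add zero_le_one (by positivity)]
        ring

end Lower

/-! ### The upper bound as the tolerance level vanishes -/

section Arithmetic

/-- The number of steps `y / r` at a drift `r` slightly below `D`. -/
lemma div_le_div_add {i θ D r y z L : ℝ} (hi : 0 < i) (hθ : 0 < θ) (hθi : θ ≤ i / 4) (hD : i ≤ D)
    (hr : D - 2 * θ ≤ r) (hy : 0 ≤ y) (hyL : y ≤ L) (hz : 0 ≤ z) :
    (y + z) / r ≤ y / D + 4 * θ * L / i ^ 2 + 2 * z / i := by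
  have hr2 : i / 2 ≤ r := by linarith
  have hr0 : 0 < r := by linarith
  have hD0 : 0 < D := by linarith
  have h1 : z / r ≤ 2 * z / i := by
    rw [div_le_div_iff₀ hr0 hi]
    nlinarith
  have h2 : y / r ≤ y / D + 4 * θ * L / i ^ 2 := by
    have h3 : y / r - y / D ≤ 4 * θ * L / i ^ 2 := by
      have h4 : y / r - y / D = y * (D - r) / (r * D) := by
        field_simp
      rw [h4, div_le_div_iff₀ (by positivity) (by positivity)]
      have h5 : i ^ 2 ≤ 2 * (r * D) := by nlinarith
      have h6 : y * (D - r) ≤ 2 * θ * L := by nlinarith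
      have h7 : 0 ≤ 2 * θ * L := by nlinarith
      nlinarith [mul_le_mul_of_nonneg_right h6 (sq_nonneg i), mul_le_mul_of_nonneg_left h5 h7]
    linarith
  rw [add_div]
  linarith

/-- The bound for the expected stopping time is `L / DK` up to a small multiple of `L`: the
logarithm of the threshold `b₁` is traded at the rates `D₁` and `DK`, at a cost of `log b₁ * x`, and
`x` and `b₁ = A / x` balance so that this cost is small. -/
lemma stopping_bound_le {i j C θ L D₁ DK I₁ IK J B κ₁ κK ζ A s b₁ bK d : ℝ} {t₀ : ℕ}
    (hi : 0 < i) (hj : 0 < j) (hθ : 0 < θ) (hθi : θ ≤ i / 4) (hθ1 : θ ≤ 1)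
    (hD₁ : i ≤ D₁) (hD : D₁ < DK) (hI₁ : D₁ - 2 * θ ≤ I₁) (hIK : DK - 2 * θ ≤ IK) (hJ : j ≤ J)
    (hBL : B ≤ θ * L) (hκ₁C : κ₁ ≤ C) (hκK : 0 ≤ κK) (hκKC : κK ≤ C)
    (hCL : C ≤ θ * L) (hCt : C * t₀ ≤ θ * L) (hζ : 0 < ζ) (hζ1 : ζ ≤ 1)
    (hζL : -Real.log ζ ≤ θ * L) (hζA : 1 / ζ ≤ A) (hAL : Real.log A ≤ θ * L)
    (hs : 0 < s) (hsL : |Real.log s| ≤ θ * L) (hbKL : Real.log bK ≤ L)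
    (hb : b₁ = A / (1 / D₁ - 1 / DK)) (hdd : d = b₁ * (A / s)) (hbK : b₁ ≤ bK)
    (hb₁θ : 4 / θ ≤ b₁) (hdb : b₁ ≤ d) (h1L : 1 ≤ θ * L) :
    1 / (1 + b₁) / ζ +
        (Real.log d + B) * (1 / (1 + b₁) + 1 / (1 + b₁) / ζ) / J +
      ((Real.log b₁ - Real.log ζ + B + κ₁) * ((1 + 1 / (1 + b₁)) / (1 - 1 / d)) + κ₁ * t₀) / I₁ +
      ((Real.log bK - Real.log b₁ + B + κK) * ((1 + 1 / (1 + b₁)) / (1 - 1 / d)) + κK * t₀) / IK +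
      ((Real.log bK - Real.log b₁ + Real.log d + B + κK) * (1 / (1 + b₁)) + κK * t₀) / IK ≤
    L / DK + (42 / i + 8 / i ^ 2 + 8 / (i * j) + 2 / j + 1) * (θ * L) := by
  set x := 1 / D₁ - 1 / DK with hx
  set y := Real.log b₁ with hy
  set q := 1 / (1 + b₁) with hq
  have hD₁0 : 0 < D₁ := hi.trans_le hD₁
  have hDK0 : 0 < DK := hD₁0.trans hD
  have hL0 : 0 < L := (mul_pos_iff_of_pos_left hθ).1 (by linarith only [h1L])
  have hA1 : 1 ≤ A := le_trans (by rw [le_div_iff₀ hζ]; linarith) hζA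
  have hA0 : 0 < A := by linarith
  have hx0 : 0 < x := by
    rw [hx, sub_pos]
    exact one_div_lt_one_div_of_lt hD₁0 hD
  have hxi : x ≤ 1 / i := by
    have h1 : 1 / D₁ ≤ 1 / i := one_div_le_one_div_of_le hi hD₁
    have h2 : 0 < 1 / DK := by positivity
    linarith
  have h4θ : 4 ≤ 4 / θ := by rw [le_div_iff₀ hθ]; linarith
  have hb₁4 : 4 ≤ b₁ := h4θ.trans hb₁θ
  have hb₁0 : 0 < b₁ := by linarith
  have hd0 : 0 < d := by linarith
  have hy0 : 0 ≤ y := Real.log_nonneg (by linarith)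
  have hybK : y ≤ Real.log bK := Real.log_le_log hb₁0 hbK
  have hyL : y ≤ L := hybK.trans hbKL
  have hylog : y = Real.log A - Real.log x := by rw [hy, hb, Real.log_div hA0.ne' hx0.ne']
  -- The cost of the first threshold: `-x log x` is bounded.
  have hyx : y * x ≤ θ * L * (1 / i) + 1 := by
    have h1 : Real.log A * x ≤ θ * L * (1 / i) :=
      mul_le_mul hAL hxi hx0.le (by linarith)
    have h2 : -Real.log x * x ≤ 1 := by
      have h3 := Real.log_le_sub_one_of_pos (inv_pos.2 hx0)
      rw [Real.log_inv] at h3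
      have h4 := mul_le_mul_of_nonneg_right h3 hx0.le
      rw [sub_mul, inv_mul_cancel₀ hx0.ne'] at h4
      linarith only [h4, hx0]
    rw [hylog]
    linarith only [h1, h2]
  have hq0 : 0 < q := by positivity
  have hqb : q ≤ 1 / b₁ := one_div_le_one_div_of_le hb₁0 (by linarith)
  have hqθ : q ≤ θ / 4 := hqb.trans (by
    rw [one_div_le hb₁0 (by positivity), one_div_div]; exact hb₁θ)
  have hdθ : 1 / d ≤ θ / 4 := by
    rw [one_div_le hd0 (by positivity), one_div_div]; exact hb₁θ.trans hdb
  have hqζ : q / ζ ≤ x := by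
    calc q / ζ ≤ (1 / b₁) * A := by
          rw [div_eq_mul_one_div]
          exact mul_le_mul hqb hζA (by positivity) (by positivity)
      _ = x := by rw [hb]; field_simp
  have hqqζ : q ≤ q / ζ := le_div_self hq0.le hζ hζ1
  have hlogd : Real.log d ≤ y + 2 * (θ * L) := by
    rw [hdd, Real.log_mul hb₁0.ne' (by positivity), Real.log_div hA0.ne' hs.ne']
    have := (abs_le.1 hsL).1
    linarith
  have hlogd0 : 0 ≤ Real.log d := Real.log_nonneg (by linarith)
  have hK : (1 + q) / (1 - 1 / d) ≤ 1 + θ := by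
    have h1 : (1 + θ) * (1 / d) ≤ 2 * (θ / 4) :=
      mul_le_mul (by linarith only [hθ1]) hdθ (by positivity) zero_le_two
    rw [div_le_iff₀ (by linarith only [hdθ, hθ1])]
    linarith only [h1, hqθ, hθ]
  have hK0 : 0 ≤ (1 + q) / (1 - 1 / d) := div_nonneg (by linarith) (by linarith)
  have hI₁0 : 0 < I₁ := by linarith only [hD₁, hI₁, hθi, hi]
  have hIK0 : 0 < IK := by linarith only [hD₁, hD, hIK, hθi, hi]
  have hJ0 : 0 < J := hj.trans_le hJ
  have hlogζ : 0 ≤ -Real.log ζ := by linarith [Real.log_nonpos hζ.le hζ1]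
  have hθL : 0 ≤ θ * L := by linarith
  have hκ₁t : κ₁ * t₀ ≤ θ * L := (mul_le_mul_of_nonneg_right hκ₁C (Nat.cast_nonneg _)).trans hCt
  have hκKt : κK * t₀ ≤ θ * L := (mul_le_mul_of_nonneg_right hκKC (Nat.cast_nonneg _)).trans hCt
  have hκKt0 : 0 ≤ κK * t₀ := by positivity
  have t2 : q / ζ ≤ θ * L / i := hqζ.trans (hxi.trans (div_le_div_of_nonneg_right h1L hi.le))
  have t3 : (Real.log d + B) * (q + q / ζ) / J ≤ 8 / (i * j) * (θ * L) + 2 / j * (θ * L) := by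
    have h1 : (Real.log d + B) * (q + q / ζ) ≤ (y + 3 * (θ * L)) * (2 * x) :=
      mul_le_mul (by linarith only [hlogd, hBL]) (by linarith only [hqζ, hqqζ]) (by positivity)
        (by linarith only [hy0, hθL])
    have h2 : 3 * (θ * L) * x ≤ 3 * (θ * L) * (1 / i) :=
      mul_le_mul_of_nonneg_left hxi (by linarith)
    have h3 : (Real.log d + B) * (q + q / ζ) ≤ 8 / i * (θ * L) + 2 * (θ * L) := by
      have h4 : 8 / i * (θ * L) = 2 * (θ * L * (1 / i)) + 2 * (3 * (θ * L) * (1 / i)) := by ring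
      rw [h4]
      linarith only [h1, h2, hyx, h1L]
    have h5 : 0 ≤ 8 / i * (θ * L) + 2 * (θ * L) := by positivity
    calc _ ≤ (8 / i * (θ * L) + 2 * (θ * L)) / J := div_le_div_of_nonneg_right h3 hJ0.le
      _ ≤ (8 / i * (θ * L) + 2 * (θ * L)) / j := div_le_div_of_nonneg_left h5 hj hJ
      _ = _ := by field_simp
  have t4 : ((y - Real.log ζ + B + κ₁) * ((1 + q) / (1 - 1 / d)) + κ₁ * t₀) / I₁ ≤
      y / D₁ + 4 * θ * L / i ^ 2 + 2 * (8 * (θ * L)) / i := by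
    refine le_trans ?_ (div_le_div_add hi hθ hθi hD₁ hI₁ hy0 hyL (by linarith : 0 ≤ 8 * (θ * L)))
    refine div_le_div_of_nonneg_right ?_ hI₁0.le
    have h1 : (y - Real.log ζ + B + κ₁) * ((1 + q) / (1 - 1 / d)) ≤
        (y + 3 * (θ * L)) * (1 + θ) :=
      mul_le_mul (by linarith only [hζL, hBL, hκ₁C, hCL]) hK hK0 (by linarith only [hy0, hθL])
    have h2 : y * θ ≤ L * θ := mul_le_mul_of_nonneg_right hyL hθ.le
    have h3 : 3 * (θ * L) * θ ≤ 3 * (θ * L) * 1 :=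
      mul_le_mul_of_nonneg_left hθ1 (by linarith only [hθL])
    linarith only [h1, h2, h3, hκ₁t]
  have t5 : ((Real.log bK - y + B + κK) * ((1 + q) / (1 - 1 / d)) + κK * t₀) / IK ≤
      (L - y) / DK + 4 * θ * L / i ^ 2 + 2 * (6 * (θ * L)) / i := by
    refine le_trans ?_ (div_le_div_add hi hθ hθi (hD₁.trans hD.le) hIK (by linarith : 0 ≤ L - y)
      (by linarith : L - y ≤ L) (by linarith : 0 ≤ 6 * (θ * L)))
    refine div_le_div_of_nonneg_right ?_ hIK0.le
    have h1 : (Real.log bK - y + B + κK) * ((1 + q) / (1 - 1 / d)) ≤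
        (L - y + 2 * (θ * L)) * (1 + θ) :=
      mul_le_mul (by linarith only [hbKL, hBL, hκKC, hCL]) hK hK0
        (by linarith only [hyL, hθL])
    have h2 : (L - y) * θ ≤ L * θ := mul_le_mul_of_nonneg_right (by linarith) hθ.le
    have h3 : 2 * (θ * L) * θ ≤ 2 * (θ * L) * 1 :=
      mul_le_mul_of_nonneg_left hθ1 (by linarith only [hθL])
    have h4 := mul_nonneg hθ.le hy0
    linarith only [h1, h2, h3, h4, hκKt]
  have t6 : ((Real.log bK - y + Real.log d + B + κK) * q + κK * t₀) / IK ≤ 12 * (θ * L) / i := by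
    have h1 : (Real.log bK - y + Real.log d + B + κK) * q ≤ (L + 4 * (θ * L)) * (θ / 4) :=
      mul_le_mul (by linarith only [hbKL, hlogd, hBL, hκKC, hCL]) hqθ hq0.le
        (by linarith only [hL0, hθL])
    have h2 : 4 * (θ * L) * (θ / 4) ≤ θ * L := by
      have := mul_le_mul_of_nonneg_left hθ1 hθL
      linarith only [this]
    have h3 : (Real.log bK - y + Real.log d + B + κK) * q + κK * t₀ ≤ 6 * (θ * L) := by
      linarith only [h1, h2, hκKt, hθL]
    rw [div_le_div_iff₀ hIK0 hi]
    have h4 : i / 2 ≤ IK := by linarith only [hD₁, hD, hIK, hθi]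
    have h5 := mul_le_mul_of_nonneg_right h3 hi.le
    have h6 := mul_le_mul_of_nonneg_left h4 hθL
    linarith only [h5, h6]
  have hsplit : y / D₁ + (L - y) / DK = L / DK + y * x := by rw [hx]; ring
  have hfin : (42 / i + 8 / i ^ 2 + 8 / (i * j) + 2 / j + 1) * (θ * L) =
      θ * L / i + (8 / (i * j) * (θ * L) + 2 / j * (θ * L)) +
      (4 * θ * L / i ^ 2 + 2 * (8 * (θ * L)) / i) + (4 * θ * L / i ^ 2 + 2 * (6 * (θ * L)) / i) +
      12 * (θ * L) / i + (θ * L * (1 / i) + θ * L) := by ring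
  rw [hfin]
  linarith only [t2, t3, t4, t5, t6, hsplit, hyx, h1L]

end Arithmetic

section Upper

variable {k : ℕ} {𝕐 : Type*} [MeasurableSpace 𝕐] {R : ResponseModel k 𝕐}
  {Ω : Type*} [MeasurableSpace Ω] {P : Measure Ω} [IsProbabilityMeasure P]
  {M : ChangeModel k} {p : Fin (k + 1) → ℝ → ℝ}

/-- For small tolerance levels the proposed procedure is admissible and controls false alarms, and
its expected stopping time exceeds the first-order approximation by little. -/
theorem eventually_proposed (W : Noise R P) (hR : R.Regular) (hMarkov : AsympMarkov M p)
    (hZeta : ZetaRate M) (hB : BoundedAway M)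
    (hThresholds : ∀ᶠ α in 𝓝[>] (0 : ℝ),
      detRate R p 0 α < detRate R p (Fin.last k) α ∧ thr1 R M p α < thrK α)
    {η : ℝ} (hη : 0 < η) : ∀ᶠ α in 𝓝[>] (0 : ℝ),
      lam W (M.π α) 0 ≠ ⊤ ∧ (tildeT W M p α, tildeX W M p α) ∈ procedures W (M.π α) α ∧
      expTime P (tildeT W M p α) ≤
        approxTime W M p α + ENNReal.ofReal (η * |Real.log α|) := by
  obtain ⟨i, C, D, hi, hC, hD, hunif⟩ := exists_uniform_bounds hR hMarkov hB
  obtain ⟨δ, ⟨hδ0, hδ1⟩, hδ⟩ := hB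
  have hIK : 0 < R.I (Fin.last k) := (hR _).2.2.1
  have hJK : 0 < R.J (Fin.last k) := (hR _).2.2.2.2
  set s := 1 / R.I (Fin.last k) + 1 / R.J (Fin.last k) with hs
  have hs0 : 0 < s := by positivity
  set j := R.J (Fin.last k) / 2 with hj
  have hj0 : 0 < j := by positivity
  set c := 42 / i + 8 / i ^ 2 + 8 / (i * j) + 2 / j + 1 with hc
  have hc0 : 0 < c := by positivity
  set θ := min (min (i / 4) 1) (η / c) with hθ
  have hθ0 : 0 < θ := by positivity
  have hθi : θ ≤ i / 4 := (min_le_left _ _).trans (min_le_left _ _)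
  have hθ1 : θ ≤ 1 := (min_le_left _ _).trans (min_le_right _ _)
  have hθc : c * θ ≤ η := by
    have h1 : θ ≤ η / c := min_le_right _ _
    rw [le_div_iff₀ hc0] at h1
    linarith
  obtain ⟨t₀, ht₀⟩ := exists_drift_close hMarkov hδ0 hδ hθ0
  obtain ⟨B₁, hB₁⟩ := exists_truncation ((W.memLp_logUp hR 0).integrable (by norm_num)) hθ0
  obtain ⟨B₂, hB₂⟩ :=
    exists_truncation ((W.memLp_logUp hR (Fin.last k)).integrable (by norm_num)) hθ0
  obtain ⟨B₃, hB₃⟩ :=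
    exists_truncation ((W.memLp_logDown hR (Fin.last k)).integrable (by norm_num)) hj0
  set B := max (max B₁ B₂) (max B₃ 0) with hB
  have hB0 : 0 ≤ B := (le_max_right _ _).trans (le_max_right _ _)
  have hI₁' := hB₁ B ((le_max_left _ _).trans (le_max_left _ _))
  have hIK' := hB₂ B ((le_max_right _ _).trans (le_max_left _ _))
  have hJ' := hB₃ B ((le_max_left _ _).trans (le_max_right _ _))
  rw [W.integral_logUp] at hI₁' hIK'
  rw [W.integral_logDown] at hJ'
  have hJ'' : j ≤ ∫ v, min (W.logDown (Fin.last k) v) B ∂unif := by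
    rw [hj] at hJ' ⊢; linarith
  have hlarge : ∀ a : ℝ, ∀ᶠ α in 𝓝[>] (0 : ℝ), a ≤ θ * |Real.log α| := fun a => by
    filter_upwards [tendsto_abs_log.eventually_ge_atTop (a / θ)] with α hα
    rw [div_le_iff₀ hθ0] at hα
    linarith
  have hlog : ∀ᶠ α in 𝓝[>] (0 : ℝ), Real.log (1 + |Real.log α| / i) ≤
      θ / 2 * |Real.log α| := by
    have h1 : Tendsto (fun α : ℝ => 1 + |Real.log α| / i) (𝓝[>] 0) atTop :=
      tendsto_atTop_add_const_left _ _ (tendsto_abs_log.atTop_div_const hi)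
    have h2 := h1.eventually (Real.isLittleO_log_id_atTop.bound
      (show (0 : ℝ) < θ * i / 4 by positivity))
    filter_upwards [h2, tendsto_abs_log.eventually_ge_atTop i] with α h3 h4
    refine (le_abs_self _).trans (h3.trans ?_)
    have h5 : 1 ≤ |Real.log α| / i := by rw [le_div_iff₀ hi]; linarith
    rw [id, Real.norm_of_nonneg (by linarith)]
    calc _ ≤ θ * i / 4 * (2 * (|Real.log α| / i)) := by gcongr; linarith
      _ = _ := by field_simp; ring
  filter_upwards [eventually_mem_Ioo, eventually_zeta hZeta (half_pos hθ0), hThresholds, hlog,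
    hlarge B, hlarge C, hlarge (C * t₀), hlarge |Real.log s|, hlarge 1,
    tendsto_abs_log.eventually_ge_atTop (D * (4 / θ / i) + Real.log 2),
    tendsto_abs_log.eventually_ge_atTop (D * s + Real.log 2),
    Ioo_mem_nhdsGT (show (0 : ℝ) < 1 / 2 by norm_num)]
    with α hα ⟨hζ0, hζL⟩ ⟨hD1K, hb1K⟩ hlogL hBL hCL hCt hsL h1L hLb hLs hαhalf
  obtain ⟨hπ, hζ1, hdet⟩ := hunif α hα
  set L := |Real.log α| with hL
  set ζ := zeta (M.π α) 0 with hζ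
  set D₁ := detRate R p 0 α with hD₁
  set DK := detRate R p (Fin.last k) α with hDK
  set bK := thrK α with hbK
  set b₁ := thr1 R M p α with hb₁
  set d := thrD R M p α with hd
  set A := 1 / ζ + Real.log bK / DK with hA
  have hb₁A : b₁ = A / (1 / D₁ - 1 / DK) := rfl
  have hdA : d = b₁ * (A / s) := rfl
  have hlogα : Real.log α = -L := by
    rw [hL, abs_of_nonpos (Real.log_nonpos hα.1.le hα.2.le), neg_neg]
  have hbK0 : 0 < bK := div_pos (by linarith [hα.2]) hα.1
  have hlogbK : Real.log bK = Real.log (1 - α) + L := by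
    rw [hbK, thrK, Real.log_div (by linarith [hα.2]) hα.1.ne', hlogα]; ring
  have hbKL : Real.log bK ≤ L := by
    have := Real.log_nonpos (show 0 ≤ 1 - α by linarith [hα.2]) (by linarith [hα.1])
    linarith
  have hbKL' : L - Real.log 2 ≤ Real.log bK := by
    have := Real.log_le_log (show (0 : ℝ) < 1 / 2 by norm_num)
      (show 1 / 2 ≤ 1 - α by linarith [hαhalf.2])
    rw [one_div, Real.log_inv] at this
    linarith
  have hD₁i : i ≤ D₁ := (hdet 0).2.1
  have hDKi : i ≤ DK := (hdet _).2.1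
  have hD₁0 : 0 < D₁ := hi.trans_le hD₁i
  have hDK0 : 0 < DK := hi.trans_le hDKi
  have hDKD : DK ≤ D := (hdet _).2.2.1
  have hx0 : 0 < 1 / D₁ - 1 / DK := sub_pos.2 (one_div_lt_one_div_of_lt hD₁0 hD1K)
  have hxi : 1 / D₁ - 1 / DK ≤ 1 / i := by
    have h1 : 1 / D₁ ≤ 1 / i := one_div_le_one_div_of_le hi hD₁i
    have h2 : 0 < 1 / DK := by positivity
    linarith
  have hlogbK0 : 0 ≤ Real.log bK := by
    have h1 : 0 ≤ D * s := by positivity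
    linarith
  have hζinv : 1 ≤ 1 / ζ := by rw [le_div_iff₀ hζ0]; linarith
  have hζA : 1 / ζ ≤ A := le_add_of_nonneg_right (div_nonneg hlogbK0 hDK0.le)
  have hA0 : 0 < A := by linarith
  have hALD : (L - Real.log 2) / D ≤ A := by
    calc _ ≤ Real.log bK / D := div_le_div_of_nonneg_right hbKL' hD.le
      _ ≤ Real.log bK / DK := div_le_div_of_nonneg_left hlogbK0 hDK0 hDKD
      _ ≤ A := le_add_of_nonneg_left (by linarith)
  have hAs : s ≤ A := le_trans (by rw [le_div_iff₀ hD]; linarith) hALD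
  have hAb : 4 / θ / i ≤ A := le_trans (by rw [le_div_iff₀ hD]; linarith) hALD
  have hb₁θ : 4 / θ ≤ b₁ := by
    rw [hb₁A, le_div_iff₀ hx0]
    calc 4 / θ * (1 / D₁ - 1 / DK) ≤ 4 / θ * (1 / i) := by gcongr
      _ = 4 / θ / i := by ring
      _ ≤ A := hAb
  have h4θ : 4 ≤ 4 / θ := by rw [le_div_iff₀ hθ0]; linarith
  have hb₁4 : 4 ≤ b₁ := h4θ.trans hb₁θ
  have hdb : b₁ ≤ d := by
    rw [hdA]
    exact le_mul_of_one_le_right (by linarith) ((one_le_div hs0).2 hAs)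
  have hζlog : -Real.log ζ ≤ θ / 2 * L := by linarith [(abs_le.1 hζL).1]
  have hAL : Real.log A ≤ θ * L := by
    have h1 : A ≤ 1 / ζ * (1 + L / i) := by
      have h2 : Real.log bK / DK ≤ L / i :=
        div_le_div₀ (abs_nonneg _) hbKL hi hDKi
      have h3 : 0 ≤ L / i := div_nonneg (abs_nonneg _) hi.le
      have h4 := mul_le_mul_of_nonneg_right hζinv h3
      rw [hA, mul_add, mul_one]
      linarith
    have h5 := Real.log_le_log hA0 h1
    have h6 : 0 < 1 + L / i := by positivity
    rw [Real.log_mul (by positivity) h6.ne', one_div, Real.log_inv] at h5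
    linarith
  set κ : Fin (k + 1) → ℝ := fun x => max 0 (|Real.log (1 - p x α)| - θ) with hκ
  have hκ0 : ∀ x, 0 ≤ κ x := fun x => le_max_left _ _
  have hκC : ∀ x, κ x ≤ C := fun x => max_le hC (by linarith [(hdet x).2.2.2])
  have hκdrift : ∀ x, ∀ t ≥ t₀, ∀ z : Fin t → Fin (k + 1),
      κ x ≤ -Real.log (1 - M.π α (t + 1) (Fin.snoc z x)) := fun x t ht z => by
    refine max_le ?_ ?_
    · have h1 := hπ (t + 1) (Fin.snoc z x)
      have := Real.log_nonpos (show 0 ≤ 1 - M.π α (t + 1) (Fin.snoc z x) by linarith)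
        (by linarith)
      linarith
    · have := (abs_le.1 (ht₀ t ht α hα z x)).1
      linarith
  have H : TransitionBounds (M.π α) ζ (κ 0) (κ (Fin.last k)) t₀ :=
    { nonneg := fun t z => (hπ t z).1
      lt_one := fun t z => (hπ t z).2.1
      zeta_pos := hζ0
      zeta_le := zeta_le_transition hα 0
      first_nonneg := hκ0 0
      last_nonneg := hκ0 _
      first_le := hκdrift 0
      last_le := hκdrift _ }
  have hlam : lam W (M.π α) 0 ≠ ⊤ := lam_ne_top W hζ0 hζ1 (zeta_le_transition hα 0)
  have hI₁ : D₁ - 2 * θ ≤ ∫ v, min (W.logUp 0 v) B ∂unif + κ 0 := by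
    have h1 : |Real.log (1 - p 0 α)| - θ ≤ κ 0 := le_max_right _ _
    have h2 : D₁ = R.I 0 + |Real.log (1 - p 0 α)| := rfl
    linarith
  have hIKd : DK - 2 * θ ≤ ∫ v, min (W.logUp (Fin.last k) v) B ∂unif + κ (Fin.last k) := by
    have h1 : |Real.log (1 - p (Fin.last k) α)| - θ ≤ κ (Fin.last k) := le_max_right _ _
    have h2 : DK = R.I (Fin.last k) + |Real.log (1 - p (Fin.last k) α)| := rfl
    linarith
  have hsum := fun n => (sum_alive_le (W := W) (bK := bK) (d := d) H hR hlam
    (by linarith : 0 < b₁) (by linarith : ζ ≤ b₁) hb1K.le (by linarith) hB0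
    (by linarith) (by linarith) (by linarith) n)
  have harith := stopping_bound_le hi hj0 hθ0 hθi hθ1 hD₁i hD1K hI₁ hIKd hJ'' hBL (hκC 0)
    (hκ0 (Fin.last k)) (hκC (Fin.last k)) hCL hCt hζ0 hζ1.le
    (by linarith [abs_nonneg (Real.log ζ)]) hζA hAL hs0 hsL hbKL hb₁A hdA hb1K.le hb₁θ hdb h1L
  have hcθ : c * (θ * L) ≤ η * L := by
    rw [← mul_assoc]; exact mul_le_mul_of_nonneg_right hθc (abs_nonneg _)
  have hT : expTime P (tildeT W M p α) ≤
      approxTime W M p α + ENNReal.ofReal (η * L) := by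
    unfold tildeT
    rw [expTime_proposedTime]
    refine (tsum_measure_le hsum).trans ?_
    have hL0 : 0 ≤ L / DK := div_nonneg (abs_nonneg _) hDK0.le
    calc _ ≤ ENNReal.ofReal ((lam W (M.π α) 0).toReal + L / DK + η * L) := by
          refine ENNReal.ofReal_le_ofReal ?_
          rw [← hc] at harith
          linarith
      _ = _ := by
          rw [ENNReal.ofReal_add (by positivity) (by positivity),
            ENNReal.ofReal_add ENNReal.toReal_nonneg hL0, ENNReal.ofReal_toReal hlam]
          rfl
  refine ⟨hlam, ?_, hT⟩
  have hαK : 1 / (1 + bK) = α := by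
    have := hα.1.ne'
    rw [hbK, thrK]
    field_simp
    ring
  have hmem := proposed_mem_procedures (W := W) (b₁ := b₁) (bK := bK) (d := d) H hR hlam
    (by linarith) hbK0.le (by linarith) hB0 (by linarith)
    (ne_top_of_le_ne_top (ENNReal.add_ne_top.2 ⟨ENNReal.add_ne_top.2 ⟨hlam, ENNReal.ofReal_ne_top⟩,
      ENNReal.ofReal_ne_top⟩) hT)
  rw [hαK] at hmem
  exact hmem

end Upper

/-! ### First-order optimality -/

section Optimality

lemma equivalent_of_le {u v : ℝ → ℝ≥0∞} (hv : ∀ᶠ α in 𝓝[>] (0 : ℝ), v α ≠ 0 ∧ v α ≠ ⊤)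
    (h : ∀ r : ℝ, 1 < r → ∀ᶠ α in 𝓝[>] (0 : ℝ),
      u α ≤ ENNReal.ofReal r * v α ∧ v α ≤ ENNReal.ofReal r * u α) : Equivalent u v := by
  have h1 : Tendsto (fun r : ℝ => ENNReal.ofReal r) (𝓝[>] 1) (𝓝 1) := by
    have := ENNReal.tendsto_ofReal (tendsto_id.mono_left
      (nhdsWithin_le_nhds (a := (1 : ℝ)) (s := Ioi 1)))
    simpa using this
  have h2 : Tendsto (fun r : ℝ => (ENNReal.ofReal r)⁻¹) (𝓝[>] 1) (𝓝 1) := by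
    have := tendsto_inv_iff.2 h1
    simpa using this
  refine tendsto_order.2 ⟨fun a ha => ?_, fun a ha => ?_⟩
  · obtain ⟨r, hr, hr1⟩ := ((h2.eventually (lt_mem_nhds ha)).and self_mem_nhdsWithin).exists
    filter_upwards [h r hr1, hv] with α hα hvα
    refine hr.trans_le ?_
    have hr0 : ENNReal.ofReal r ≠ 0 := (ENNReal.ofReal_pos.2 (zero_lt_one.trans hr1)).ne'
    rw [ENNReal.le_div_iff_mul_le (Or.inl hvα.1) (Or.inl hvα.2), mul_comm, ← div_eq_mul_inv]
    exact ENNReal.div_le_of_le_mul' hα.2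
  · obtain ⟨r, hr, hr1⟩ := ((h1.eventually (gt_mem_nhds ha)).and self_mem_nhdsWithin).exists
    filter_upwards [h r hr1] with α hα
    exact (ENNReal.div_le_of_le_mul hα.1).trans_lt hr

variable {k : ℕ} {𝕐 : Type*} [MeasurableSpace 𝕐] {R : ResponseModel k 𝕐}
  {Ω : Type*} [MeasurableSpace Ω] {P : Measure Ω}
  {W : Noise R P} {M : ChangeModel k} {p : Fin (k + 1) → ℝ → ℝ}

lemma exists_le_approxTime (W : Noise R P) (hR : R.Regular) (hMarkov : AsympMarkov M p)
    (hB : BoundedAway M) :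
    ∃ D : ℝ, 0 < D ∧ (∀ᶠ α in 𝓝[>] (0 : ℝ), 0 < detRate R p (Fin.last k) α) ∧
      ∀ η : ℝ, 0 ≤ η → ∀ᶠ α in 𝓝[>] (0 : ℝ),
        ENNReal.ofReal (η * |Real.log α|) ≤ ENNReal.ofReal (η * D) * approxTime W M p α := by
  obtain ⟨i, C, D, hi, hC, hD, hunif⟩ := exists_uniform_bounds hR hMarkov hB
  refine ⟨D, hD, ?_, fun η hη => ?_⟩
  · filter_upwards [eventually_mem_Ioo] with α hα
    exact hi.trans_le ((hunif α hα).2.2 _).2.1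
  · filter_upwards [eventually_mem_Ioo] with α hα
    obtain ⟨-, h1, h2, -⟩ := (hunif α hα).2.2 (Fin.last k)
    refine le_trans ?_ (mul_le_mul_right le_add_self _)
    rw [← ENNReal.ofReal_mul (by positivity)]
    refine ENNReal.ofReal_le_ofReal ?_
    have h3 : 0 < detRate R p (Fin.last k) α := hi.trans_le h1
    rw [mul_assoc, mul_div_left_comm]
    refine mul_le_mul_of_nonneg_left ?_ hη
    exact le_mul_of_one_le_right (abs_nonneg _) ((one_le_div h3).2 h2)

variable [IsProbabilityMeasure P]

/-- No procedure improves on the first-order approximation by more than a factor close to one.  If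
the expected change-point under the first treatment is asymptotically the smallest conceivable one,
it is compared with the latter; otherwise it is negligible. -/
theorem eventually_approxTime_le (hR : R.Regular) (hMarkov : AsympMarkov M p) (hZeta : ZetaRate M)
    (hB : BoundedAway M) (hLast : ∀ α ∈ Ioo (0 : ℝ) 1, ∀ x,
      detRate R p x α ≤ detRate R p (Fin.last k) α)
    (hA4 : Equivalent (fun α => lam W (M.π α) 0) (fun α => lamStar W (M.π α)) ∨
      Tendsto (fun α => lam W (M.π α) 0 / ENNReal.ofReal |Real.log α|) (𝓝[>] 0) (𝓝 0))
    (hfin : ∀ᶠ α in 𝓝[>] (0 : ℝ), approxTime W M p α ≠ ⊤)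
    {r : ℝ} (hr : 1 < r) : ∀ᶠ α in 𝓝[>] (0 : ℝ),
      approxTime W M p α ≤ ENNReal.ofReal r * optimalTime W (M.π α) α := by
  obtain ⟨D, hD, hDK, hsmall⟩ := exists_le_approxTime W hR hMarkov hB
  set η := (1 - 1 / r) / 3 with hη
  have hr0 : 0 < r := by linarith
  have hr1 : 1 / r < 1 := by rw [div_lt_one hr0]; exact hr
  have hη0 : 0 < η := by rw [hη]; linarith
  have hη3 : η ≤ 1 / 3 := by
    have : 0 < 1 / r := by positivity
    rw [hη]; linarith
  obtain ⟨K, hK⟩ := eventually_lamStar_le (W := W) hR hMarkov hZeta hB hLast hη0 (by linarith)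
  have hlam : ∀ᶠ α in 𝓝[>] (0 : ℝ), ENNReal.ofReal (1 - η) * lam W (M.π α) 0 ≤
      lamStar W (M.π α) + ENNReal.ofReal (η / D * |Real.log α|) := by
    rcases hA4 with h | h
    · have h1 : (1 : ℝ≥0∞) < ENNReal.ofReal (1 + η) := by
        rw [ENNReal.one_lt_ofReal]; linarith
      filter_upwards [h.eventually (gt_mem_nhds h1)] with α hα
      have h2 : lam W (M.π α) 0 ≤ ENNReal.ofReal (1 + η) * lamStar W (M.π α) := by
        refine (ENNReal.div_le_iff_le_mul (Or.inr ENNReal.ofReal_ne_top) (Or.inr ?_)).1 hα.le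
        exact (zero_lt_one.trans h1).ne'
      calc _ ≤ ENNReal.ofReal (1 - η) * (ENNReal.ofReal (1 + η) * lamStar W (M.π α)) := by gcongr
        _ = ENNReal.ofReal ((1 - η) * (1 + η)) * lamStar W (M.π α) := by
          rw [← mul_assoc, ENNReal.ofReal_mul (by linarith)]
        _ ≤ 1 * lamStar W (M.π α) := by
          gcongr
          rw [ENNReal.ofReal_le_one]
          nlinarith
        _ ≤ _ := by rw [one_mul]; exact le_self_add
    · have h1 : (0 : ℝ≥0∞) < ENNReal.ofReal (η / D) := ENNReal.ofReal_pos.2 (by positivity)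
      filter_upwards [h.eventually (gt_mem_nhds h1), tendsto_abs_log.eventually_gt_atTop 0]
        with α hα hL
      have h2 : lam W (M.π α) 0 ≤ ENNReal.ofReal (η / D) * ENNReal.ofReal |Real.log α| :=
        (ENNReal.div_le_iff_le_mul (Or.inl (ENNReal.ofReal_pos.2 hL).ne')
          (Or.inl ENNReal.ofReal_ne_top)).1 hα.le
      rw [← ENNReal.ofReal_mul (by positivity)] at h2
      calc _ ≤ 1 * lam W (M.π α) 0 := by
            gcongr
            rw [ENNReal.ofReal_le_one]
            linarith
        _ ≤ _ := by rw [one_mul]; exact h2.trans le_add_self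
  filter_upwards [hK, hlam, hsmall (η / D) (by positivity), hfin, hDK,
    tendsto_abs_log.eventually_ge_atTop (K / (η / D))] with α hKα hlamα hsα hfα hDKα hL
  set A := approxTime W M p α with hA
  set O := optimalTime W (M.π α) α with hO
  set L := |Real.log α| with hLdef
  rw [div_mul_cancel₀ _ hD.ne'] at hsα
  have hKL : ENNReal.ofReal K ≤ ENNReal.ofReal η * A := by
    refine (ENNReal.ofReal_le_ofReal ?_).trans hsα
    rw [div_le_iff₀ (by positivity)] at hL
    linarith
  have hopt : lamStar W (M.π α) + ENNReal.ofReal ((1 - η) * L / detRate R p (Fin.last k) α) ≤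
      O + ENNReal.ofReal K := by
    rw [← tsub_le_iff_right]
    exact le_iInf₂ fun q hq => tsub_le_iff_right.2 (hKα q hq)
  by_cases hOtop : O = ⊤
  · rw [hOtop, ENNReal.mul_top (ENNReal.ofReal_pos.2 hr0).ne']
    exact le_top
  have hmain : ENNReal.ofReal (1 - η) * A ≤ O + ENNReal.ofReal (2 * η) * A := by
    calc _ = ENNReal.ofReal (1 - η) * lam W (M.π α) 0 +
          ENNReal.ofReal ((1 - η) * L / detRate R p (Fin.last k) α) := by
          rw [hA, approxTime, mul_add, ← ENNReal.ofReal_mul (by linarith), mul_div_assoc]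
      _ ≤ lamStar W (M.π α) + ENNReal.ofReal (η / D * L) +
          ENNReal.ofReal ((1 - η) * L / detRate R p (Fin.last k) α) := by gcongr
      _ = lamStar W (M.π α) + ENNReal.ofReal ((1 - η) * L / detRate R p (Fin.last k) α) +
          ENNReal.ofReal (η / D * L) := by ring
      _ ≤ O + ENNReal.ofReal η * A + ENNReal.ofReal η * A :=
          add_le_add (hopt.trans (add_le_add le_rfl hKL)) hsα
      _ = _ := by rw [two_mul, ENNReal.ofReal_add hη0.le hη0.le]; ring
  -- In real numbers: `(1 - 3 η) A ≤ O`, and `1 - 3 η = 1 / r`.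
  lift A to NNReal using hfα with a
  lift O to NNReal using hOtop with o
  have e : ∀ x : NNReal, (x : ℝ≥0∞) = ENNReal.ofReal (x : ℝ) := fun x => by simp
  rw [e, e, ← ENNReal.ofReal_mul (by linarith), ← ENNReal.ofReal_mul (by linarith),
    ← ENNReal.ofReal_add (by positivity) (by positivity),
    ENNReal.ofReal_le_ofReal_iff (by positivity)] at hmain
  rw [e, e, ← ENNReal.ofReal_mul hr0.le]
  refine ENNReal.ofReal_le_ofReal ?_
  have h3 : 1 / r * a ≤ (o : ℝ) := by
    have : 1 / r = 1 - η - 2 * η := by rw [hη]; ring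
    rw [this]
    linarith
  rw [one_div, inv_mul_le_iff₀ hr0] at h3
  exact h3

end Optimality

end ChangeAccel

end

theorem corollary1 {k : ℕ} {𝕐 : Type*} [TopologicalSpace 𝕐] [PolishSpace 𝕐] [MeasurableSpace 𝕐]
    [BorelSpace 𝕐] (R : ChangeAccel.ResponseModel k 𝕐)
    {Ω : Type*} [MeasurableSpace Ω] (P : Measure Ω) [IsProbabilityMeasure P]
    (W : ChangeAccel.Noise R P) (M : ChangeAccel.ChangeModel k) (p : Fin (k + 1) → ℝ → ℝ)
    (hResponse : R.Regular)
    (hMarkov : ChangeAccel.AsympMarkov M p)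
    (hZeta : ChangeAccel.ZetaRate M)
    (hBounded : ChangeAccel.BoundedAway M)
    (hFirst : ∀ α ∈ Ioo (0 : ℝ) 1, ∀ x,
      ChangeAccel.lam W (M.π α) 0 ≤ ChangeAccel.lam W (M.π α) x)
    (hLast : ∀ α ∈ Ioo (0 : ℝ) 1, ∀ x,
      ChangeAccel.detRate R p x α ≤ ChangeAccel.detRate R p (Fin.last k) α)
    (hThresholds : ∀ᶠ α in 𝓝[>] (0 : ℝ),
      ChangeAccel.detRate R p 0 α < ChangeAccel.detRate R p (Fin.last k) α ∧
        ChangeAccel.thr1 R M p α < ChangeAccel.thrK α)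
    (hA4 : ChangeAccel.Equivalent (fun α => ChangeAccel.lam W (M.π α) 0)
        (fun α => ChangeAccel.lamStar W (M.π α)) ∨
      Tendsto (fun α => ChangeAccel.lam W (M.π α) 0 / ENNReal.ofReal |Real.log α|)
        (𝓝[>] 0) (𝓝 0)) :
    (∀ᶠ α in 𝓝[>] (0 : ℝ), (ChangeAccel.tildeT W M p α, ChangeAccel.tildeX W M p α) ∈
        ChangeAccel.procedures W (M.π α) α) ∧
      ChangeAccel.Equivalent (fun α => ChangeAccel.expTime P (ChangeAccel.tildeT W M p α))
        (ChangeAccel.approxTime W M p) ∧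
      ChangeAccel.Equivalent (ChangeAccel.approxTime W M p)
        (fun α => ChangeAccel.optimalTime W (M.π α) α) := by
  obtain ⟨D, hD, hDK, hsmall⟩ := ChangeAccel.exists_le_approxTime W hResponse hMarkov hBounded
  have hprop := fun η : ℝ => ChangeAccel.eventually_proposed W hResponse hMarkov hZeta hBounded
    hThresholds (η := η)
  have hmem := (hprop 1 one_pos).mono fun α h => h.2.1
  have happrox : ∀ᶠ α in 𝓝[>] (0 : ℝ), ChangeAccel.approxTime W M p α ≠ 0 ∧
      ChangeAccel.approxTime W M p α ≠ ⊤ := by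
    filter_upwards [hprop 1 one_pos, hDK, ChangeAccel.tendsto_abs_log.eventually_gt_atTop 0]
      with α hα hDα hL
    refine ⟨fun h => ?_, ENNReal.add_ne_top.2 ⟨hα.1, ENNReal.ofReal_ne_top⟩⟩
    exact (ENNReal.ofReal_pos.2 (div_pos hL hDα)).ne' (add_eq_zero.1 h).2
  have hopt : ∀ᶠ α in 𝓝[>] (0 : ℝ), ChangeAccel.optimalTime W (M.π α) α ≤
      ChangeAccel.expTime P (ChangeAccel.tildeT W M p α) :=
    hmem.mono fun α hα => iInf₂_le _ hα
  have hupper : ∀ r : ℝ, 1 < r → ∀ᶠ α in 𝓝[>] (0 : ℝ),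
      ChangeAccel.expTime P (ChangeAccel.tildeT W M p α) ≤
        ENNReal.ofReal r * ChangeAccel.approxTime W M p α := by
    intro r hr
    have hη : 0 < (r - 1) / D := div_pos (by linarith) hD
    filter_upwards [hprop _ hη, hsmall _ hη.le] with α hα hs
    rw [div_mul_cancel₀ _ hD.ne'] at hs
    calc _ ≤ 1 * ChangeAccel.approxTime W M p α +
          ENNReal.ofReal (r - 1) * ChangeAccel.approxTime W M p α := by
          rw [one_mul]
          exact hα.2.2.trans (add_le_add le_rfl hs)
      _ = ENNReal.ofReal (1 + (r - 1)) * ChangeAccel.approxTime W M p α := by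
          rw [ENNReal.ofReal_add zero_le_one (by linarith), ENNReal.ofReal_one, add_mul]
      _ = _ := by rw [add_sub_cancel]
  have hlower := fun (r : ℝ) (hr : 1 < r) => ChangeAccel.eventually_approxTime_le (W := W)
    hResponse hMarkov hZeta hBounded hLast hA4 (happrox.mono fun α h => h.2) hr
  refine ⟨hmem, ChangeAccel.equivalent_of_le happrox fun r hr => ?_,
    ChangeAccel.equivalent_of_le ?_ fun r hr => ?_⟩
  · filter_upwards [hupper r hr, hlower r hr, hopt] with α h1 h2 h3
    exact ⟨h1, h2.trans (by gcongr)⟩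
  · filter_upwards [hupper 2 one_lt_two, hlower 2 one_lt_two, hopt, happrox] with α h1 h2 h3 h4
    refine ⟨fun h => h4.1 ?_, ne_top_of_le_ne_top ?_ (h3.trans h1)⟩
    · rw [h, mul_zero] at h2
      exact le_antisymm h2 zero_le
    · exact ENNReal.mul_ne_top ENNReal.ofReal_ne_top h4.2
  · filter_upwards [hupper r hr, hlower r hr, hopt] with α h1 h2 h3
    exact ⟨h2, h3.trans h1⟩
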